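/- Functional Energy Inequality. Let $0<\varepsilon\le\frac14$ and $r\in\mathbb N$. There is a constant $C$ depending only on $\varepsilon$ and $r$ such that the following holds. A weight is a non-negative locally finite Borel measure on $\mathbb R$. Let $\sigma,w$ be weights without common point masses, i.e. $\sigma(\{x\})\,w(\{x\})=0$ for all $x$. For a bounded interval $I$ of length $|I|>0$ set $$P(\nu,I)=\int_{\mathbb R}\frac{|I|}{(|I|+\operatorname{dist}(x,I))^2}\,\nu(dx),\qquad H_{\alpha,\beta}\nu(x)=\int_{\alpha<|x-y|<\beta}\frac{\nu(dy)}{y-x}\quad(0<\alpha<\beta<\infty).$$ Let $\mathscr H=\mathscr A_2^{1/2}+\mathscr T\in[0,\infty]$, where $\mathscr A_2$ and $\mathscr T$ are the best constants in $$P(\sigma,I)P(w,I)\le\mathscr A_2,\qquad \int_I|H_{\alpha,\beta}(\sigma\mathbf 1_I)|^2\,dw\le\mathscr T^2\sigma(I),\qquad \int_I|H_{\alpha,\beta}(w\mathbf 1_I)|^2\,d\sigma\le\mathscr T^2w(I),$$ uniformly over $I$ and over $0<\alpha<\beta<\infty$. Let $\mathcal D$ be a dyadic grid: a collection of closed intervals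 whose lengths are integer powers of $2$, any two of which are nested or have disjoint interiors, and such that for each $n\in\mathbb Z$ those of length $2^n$ cover $\mathbb R$. Assume that neither $\sigma$ nor $w$ has a point mass at an endpoint of an interval of $\mathcal D$. For $J\in\mathcal D$ with left and right halves $J_-,J_+$ let $$h^w_J=\sqrt{\tfrac{w(J_-)w(J_+)}{w(J)}}\Bigl(\tfrac{\mathbf 1_{J_+}}{w(J_+)}-\tfrac{\mathbf 1_{J_-}}{w(J_-)}\Bigr),$$ and $h_J^w=0$ if $w(J_-)$ or $w(J_+)$ is $0$. The Haar support of $g\in L^2(w)$ is $\{J\in\mathcal D:\langle g,h^w_J\rangle_w\ne0\}$. An interval $I$ is good if for all $J\in\mathcal D$ with $|J|\ge2^{r-1}|I|$ the distance from $\partial J$ to either half of $I$ is at least $|I|^\varepsilon|J|^{1-\varepsilon}$. Write $J\Subset F$ if $J\subset F$ and $2^r|J|\le|F|$. Let $\mathcal F\subset\mathcal D$ be $\sigma$-Carleson: $\sum_{F\in\mathcal F,\,F\subset S}\sigma(F)\le2\sigma(S)$ for all $S\in\mathcal D$. Let $\pi^1_{\mathcal F}J$ be the smallest member of $\mathcal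 F$ containing $J$ and $\pi^2_{\mathcal F}J$ the smallest member of $\mathcal F$ strictly containing $\pi^1_{\mathcal F}J$. Fix $s\in\{1,2\}$ and let $\{g_F\}_{F\in\mathcal F}\subset L^2(w)$ be $\mathcal F_\Subset$-adapted: each $g_F$ belongs to the closed linear span in $L^2(w)$ of $\{h^w_J:J\in\mathcal D\}$, and its Haar support $\mathcal J(F)$ consists of good intervals $J$ with $\pi^s_{\mathcal F}J=F$ and $J\Subset F$. Let $\mathcal J^*(F)$ be the set of maximal intervals of $\mathcal J(F)$. Then for every non-negative $h\in L^2(\sigma)$, $$\sum_{F\in\mathcal F}\ \sum_{J^*\in\mathcal J^*(F)}P(h\sigma,J^*)\,\Bigl|\Bigl\langle\frac{x}{|J^*|},\,g_F\mathbf 1_{J^*}\Bigr\rangle_w\Bigr|\le C\,\mathscr H\,\|h\|_{L^2(\sigma)}\Bigl[\sum_{F\in\mathcal F}\|g_F\|_{L^2(w)}^2\Bigr]^{1/2},$$ where both sides are in $[0,\infty]$ and $0\cdot\infty=0$. -/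

import Mathlib

open MeasureTheory Set
open scoped ENNReal NNReal

noncomputable section

namespace FunctionalEnergy

/-- Compact intervals `[a, b]` of the real line; `I ≤ J` is inclusion, `I.fst`, `I.snd` are the
endpoints and `I.length` is `b - a`. -/
abbrev Interval : Type := NonemptyInterval ℝ

/-! ### The constant `ℋ` of a pair of weights -/

/-- The Poisson average `P(ν, I) = ∫ |I| / (|I| + dist(x, I))² ν(dx)`, for `|I| > 0`. -/
def poisson (ν : Measure ℝ) (I : Interval) : ℝ≥0∞ :=
  ∫⁻ x, ENNReal.ofReal (I.length / (I.length + Metric.infDist x (I : Set ℝ)) ^ 2) ∂ν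

/-- The truncated Hilbert transform `∫_{α < |x - y| < β} ν(dy) / (y - x)`. -/
def hilbert (α β : ℝ) (ν : Measure ℝ) (x : ℝ) : ℝ :=
  ∫ y in {y : ℝ | α < |x - y| ∧ |x - y| < β}, 1 / (y - x) ∂ν

/-- The best constant in `P(σ, I) P(w, I) ≤ 𝒜₂`, uniformly over intervals. -/
def A2Const (σ w : Measure ℝ) : ℝ≥0∞ :=
  ⨆ (I : Interval) (_ : 0 < I.length), poisson σ I * poisson w I

/-- The testing inequality `∫_I |H(σ 1_I)|² dw ≤ T² σ(I)`, uniformly over intervals and over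
truncations. -/
def Testing (σ w : Measure ℝ) (T : ℝ≥0∞) : Prop :=
  ∀ I : Interval, 0 < I.length → ∀ α β : ℝ, 0 < α → α < β →
    ∫⁻ x in (I : Set ℝ), ‖hilbert α β (σ.restrict (I : Set ℝ)) x‖ₑ ^ 2 ∂w ≤ T ^ 2 * σ (I : Set ℝ)

/-- The best constant in the testing inequality and its dual. -/
def testingConst (σ w : Measure ℝ) : ℝ≥0∞ :=
  sInf {T : ℝ≥0∞ | Testing σ w T ∧ Testing w σ T}

/-- `ℋ = 𝒜₂^{1/2} + 𝒯`. -/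
def HConst (σ w : Measure ℝ) : ℝ≥0∞ :=
  A2Const σ w ^ (1 / 2 : ℝ) + testingConst σ w

/-! ### Dyadic grids and good intervals -/

/-- A dyadic grid: closed intervals whose lengths are integer powers of two, any two of them nested
or without common interior points, those of each length `2 ^ n` covering the line. -/
structure IsDyadicGrid (D : Set Interval) : Prop where
  length_eq : ∀ I ∈ D, ∃ n : ℤ, I.length = (2 : ℝ) ^ n
  cover : ∀ (n : ℤ) (x : ℝ), ∃ I ∈ D, I.length = (2 : ℝ) ^ n ∧ x ∈ I
  nested : ∀ I ∈ D, ∀ J ∈ D,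
    I ≤ J ∨ J ≤ I ∨ Disjoint (interior (I : Set ℝ)) (interior (J : Set ℝ))

/-- The weight has no point mass at an endpoint of an interval of the grid. -/
def Admissible (D : Set Interval) (ν : Measure ℝ) : Prop :=
  ∀ I ∈ D, ν {I.fst} = 0 ∧ ν {I.snd} = 0

/-- The left half of an interval. -/
def leftChild (I : Interval) : Interval :=
  ⟨(I.fst, (I.fst + I.snd) / 2), by have := I.fst_le_snd; dsimp only; linarith⟩

/-- The right half of an interval. -/
def rightChild (I : Interval) : Interval :=
  ⟨((I.fst + I.snd) / 2, I.snd), by have := I.fst_le_snd; dsimp only; linarith⟩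

/-- `(ε, r)`-good intervals: for all `J ∈ D` with `|J| ≥ 2 ^ (r - 1) |I|`, the distance from `∂J`
to either child of `I` is at least `|I| ^ ε |J| ^ (1 - ε)`. -/
def IsGood (D : Set Interval) (ε : ℝ) (r : ℕ) (I : Interval) : Prop :=
  ∀ J ∈ D, (2 : ℝ) ^ ((r : ℤ) - 1) * I.length ≤ J.length →
    ∀ K ∈ ({leftChild I, rightChild I} : Set Interval), ∀ p ∈ ({J.fst, J.snd} : Set ℝ),
      I.length ^ ε * J.length ^ (1 - ε) ≤ Metric.infDist p (K : Set ℝ)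

/-- `J ⋐ I`: `J ⊆ I` and `2 ^ r |J| ≤ |I|`. -/
def StronglyContained (r : ℕ) (J I : Interval) : Prop :=
  J ≤ I ∧ (2 : ℝ) ^ r * J.length ≤ I.length

/-! ### Haar functions -/

/-- The Haar function `h_I^w`. If a child of `I` is `w`-null, the square root vanishes and so does
the function. -/
def haar (w : Measure ℝ) (I : Interval) (x : ℝ) : ℝ :=
  √(w.real (leftChild I : Set ℝ) * w.real (rightChild I : Set ℝ) / w.real (I : Set ℝ)) *
    ((rightChild I : Set ℝ).indicator 1 x / w.real (rightChild I : Set ℝ)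
      - (leftChild I : Set ℝ).indicator 1 x / w.real (leftChild I : Set ℝ))

lemma memLp_indicator (w : Measure ℝ) [IsLocallyFiniteMeasure w] (I : Interval) :
    MemLp ((I : Set ℝ).indicator (1 : ℝ → ℝ)) 2 w := by
  have hI : (I : Set ℝ) = Icc I.fst I.snd := rfl
  rw [hI]
  exact memLp_indicator_const 2 measurableSet_Icc (1 : ℝ) (Or.inr isCompact_Icc.measure_ne_top)

lemma memLp_haar (w : Measure ℝ) [IsLocallyFiniteMeasure w] (I : Interval) :
    MemLp (haar w I) 2 w := by
  have h := (((memLp_indicator w (rightChild I)).const_mul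
    (w.real (rightChild I : Set ℝ))⁻¹).sub ((memLp_indicator w (leftChild I)).const_mul
    (w.real (leftChild I : Set ℝ))⁻¹)).const_mul
    (√(w.real (leftChild I : Set ℝ) * w.real (rightChild I : Set ℝ) / w.real (I : Set ℝ)))
  refine h.ae_eq (Filter.Eventually.of_forall fun x => ?_)
  simp only [haar, Pi.sub_apply]
  ring

/-- The Haar function as an element of `L²(w)`. -/
def haarLp (w : Measure ℝ) [IsLocallyFiniteMeasure w] (I : Interval) : Lp ℝ 2 w :=
  (memLp_haar w I).toLp (haar w I)

/-- The Haar coefficient `⟨g, h_I^w⟩_w`. -/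
def haarCoeff (w : Measure ℝ) (g : Lp ℝ 2 w) (I : Interval) : ℝ :=
  ∫ x, g x * haar w I x ∂w

/-- The Haar support `{J ∈ D : ⟨g, h_J^w⟩_w ≠ 0}`. -/
def haarSupport (D : Set Interval) (w : Measure ℝ) (g : Lp ℝ 2 w) : Set Interval :=
  {J | J ∈ D ∧ haarCoeff w g J ≠ 0}

/-- The closed linear span in `L²(w)` of the Haar functions of the grid. -/
def haarSpan (D : Set Interval) (w : Measure ℝ) [IsLocallyFiniteMeasure w] :
    Submodule ℝ (Lp ℝ 2 w) :=
  (Submodule.span ℝ (haarLp w '' D)).topologicalClosure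

/-- The maximal intervals of the Haar support. -/
def maxHaarSupport (D : Set Interval) (w : Measure ℝ) (g : Lp ℝ 2 w) : Set Interval :=
  {J | Maximal (· ∈ haarSupport D w g) J}

/-! ### Carleson families and adapted functions -/

/-- `∑_{F ∈ 𝓕, F ⊆ S} σ(F) ≤ 2 σ(S)` for all `S ∈ D`. -/
def IsCarleson (D : Set Interval) (σ : Measure ℝ) (𝓕 : Set Interval) : Prop :=
  ∀ S ∈ D, ∑' F : {F : Interval // F ∈ 𝓕 ∧ F ≤ S}, σ (F.1 : Set ℝ) ≤ 2 * σ (S : Set ℝ)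

/-- `F = π_𝓕 J`, the smallest member of `𝓕` that contains `J`. -/
def IsParent (𝓕 : Set Interval) (J F : Interval) : Prop :=
  IsLeast {K | K ∈ 𝓕 ∧ J ≤ K} F

/-- `F` is the smallest member of `𝓕` that strictly contains `π_𝓕 J`. -/
def IsGrandparent (𝓕 : Set Interval) (J F : Interval) : Prop :=
  ∃ F', IsParent 𝓕 J F' ∧ IsLeast {K | K ∈ 𝓕 ∧ F' < K} F

/-- `F = π_𝓕^s J`, for `s = 1` or `s = 2` (no other value of `s` is allowed). -/
def IsAncestor (𝓕 : Set Interval) (s : ℕ) (J F : Interval) : Prop :=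
  (s = 1 ∧ IsParent 𝓕 J F) ∨ (s = 2 ∧ IsGrandparent 𝓕 J F)

/-- `𝓕_⋐`-adapted collections in `L²(w)`: each `g_F` is in the closed span of the Haar functions,
and its Haar support consists of good intervals `J` with `π_𝓕^s J = F` and `J ⋐ F`. -/
def IsAdapted (D : Set Interval) (ε : ℝ) (r s : ℕ) (w : Measure ℝ) [IsLocallyFiniteMeasure w]
    (𝓕 : Set Interval) (g : 𝓕 → Lp ℝ 2 w) : Prop :=
  ∀ F : 𝓕, g F ∈ haarSpan D w ∧ ∀ J ∈ haarSupport D w (g F),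
    IsGood D ε r J ∧ IsAncestor 𝓕 s J F ∧ StronglyContained r J F

end FunctionalEnergy

end

/-!
The left-hand side is an operator `h ↦ ∫ h · kern J dσ`, with `kern J y = (|J| + dist(y, J))⁻²`,
tested on the pairs `t = (F, J)` of a member `F` of `𝓕` and a maximal interval `J` of the Haar
support of `g F`. Expanding `g F` in Haar functions on `J` (`enorm_setIntegral_sq_le`) bounds
`|∫_J x g_F dw|²` by `e t * γ t`, where `e t` is the sum of the squared Haar coefficients of `x`
over the part of the support inside `J`, and the `γ t` add up to at most `∑ ‖g_F‖²`. By
Cauchy-Schwarz everything reduces to the two-weight inequality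
`∑ e t (∫ h · kern (J t) dσ)² ≤ C ℋ² ‖h‖²`, which follows from two testing inequalities.

Forward testing (`IsEnergyFamily.forward_testing`) takes `h = 1_I`. It rests on the energy
inequality `energy_le`: for nonoverlapping `L ⊆ I`, the Hilbert transform of `σ 1_{I \ L}` increases
on `L` with slope at least `∫_{I \ L} kern L dσ`, so that its square integral over `L` controls the
variance of `x` there, and the testing condition controls the sum over `L`. The intervals `J t` that
belong to tops `F t` sticking out of `I` overlap at most twice. For the others, the part of `σ`
inside `F t` is handled by the energy inequality in each `F` and the Carleson condition, and the
part outside by an induction on the finite family of tops: off a maximal top, goodness makes `kern`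
of a small interval comparable to that of the maximal interval `J t` above it.

Dual testing (`lintegral_sum_kern_sq_le`) asks for `∫ (∑ e t kern (J t))² dσ ≤ C 𝒜₂ ∑ e t`. This is
a Schur test: the weight of `J t` is spread over smaller intervals `K` with masses at most
`|K|² w(K)`, which are summed scale by scale, and the scales form a geometric series.

The kernel is comparable to the sum of `|K|⁻² 1_K` over the cells `K ⊇ J` of two adjacent dyadic
grids (`kern_le_sum_cell`, `sum_cell_le`). For such a positive dyadic operator the two testing
inequalities imply boundedness (`sum_sq_le_of_testing`): the cells are sorted by the level of the
largest average of `h` above them; pairs of cells of one level are controlled by forward testing,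
pairs of different levels by dual testing, and the maximal inequality sums the levels.

Goodness enters only through the distance, at least `|J|`, from `J` to the boundary of `F`
(`IsGood.gap`), which is why the constant depends on neither `ε` nor `r`.
-/

open MeasureTheory Set Filter Topology
open scoped ENNReal NNReal

namespace FunctionalEnergy

/-! ### Inequalities for sums in `[0, ∞]` -/

lemma sum_sq_le_of_sq_le_mul {ι : Type*} (s : Finset ι) (x U V : ι → ℝ≥0∞)
    (h : ∀ i ∈ s, x i ^ 2 ≤ U i * V i) :
    (∑ i ∈ s, x i) ^ 2 ≤ (∑ i ∈ s, U i) * ∑ i ∈ s, V i := by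
  have h1 : ∀ i ∈ s, x i ≤ U i ^ (1 / 2 : ℝ) * V i ^ (1 / 2 : ℝ) := by
    intro i hi
    rw [← ENNReal.mul_rpow_of_nonneg _ _ (by norm_num)]
    calc x i = (x i ^ 2) ^ (1 / 2 : ℝ) := by
          rw [← ENNReal.rpow_natCast, ← ENNReal.rpow_mul]; norm_num
      _ ≤ _ := ENNReal.rpow_le_rpow (h i hi) (by norm_num)
  have h2 := ENNReal.inner_le_Lp_mul_Lq s (fun i => U i ^ (1 / 2 : ℝ))
    (fun i => V i ^ (1 / 2 : ℝ)) Real.HolderConjugate.two_two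
  have e : ∀ a : ℝ≥0∞, (a ^ (1 / 2 : ℝ)) ^ (2 : ℝ) = a := fun a => by
    rw [← ENNReal.rpow_mul]; norm_num
  simp only [e] at h2
  have h3 := (Finset.sum_le_sum h1).trans h2
  calc (∑ i ∈ s, x i) ^ 2
      ≤ ((∑ i ∈ s, U i) ^ (1 / 2 : ℝ) * (∑ i ∈ s, V i) ^ (1 / 2 : ℝ)) ^ 2 := by gcongr
    _ = _ := by
      rw [mul_pow, ← ENNReal.rpow_natCast, ← ENNReal.rpow_natCast]
      push_cast
      rw [e, e]

lemma lintegral_mul_sq_le {Y : Type*} [MeasurableSpace Y] (σ : Measure Y) {f g : Y → ℝ≥0∞}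
    (hf : AEMeasurable f σ) (hg : AEMeasurable g σ) :
    (∫⁻ y, f y * g y ∂σ) ^ 2 ≤ (∫⁻ y, f y ^ 2 ∂σ) * ∫⁻ y, g y ^ 2 ∂σ := by
  have h := ENNReal.lintegral_mul_le_Lp_mul_Lq σ Real.HolderConjugate.two_two hf hg
  have e : ∀ a : ℝ≥0∞, (a ^ (1 / 2 : ℝ)) ^ (2 : ℕ) = a := fun a => by
    rw [← ENNReal.rpow_natCast, ← ENNReal.rpow_mul]; norm_num
  have e2 : ∀ a : ℝ≥0∞, a ^ (2 : ℝ) = a ^ (2 : ℕ) := fun a => by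
    rw [← ENNReal.rpow_natCast]; norm_num
  simp only [e2, Pi.mul_apply] at h
  calc _ ≤ _ := pow_le_pow_left₀ (by positivity) h 2
    _ = _ := by rw [mul_pow, e, e]

/-- The square of a sum is at most twice its part below the diagonal, when the terms are ordered
by a function. -/
lemma sum_sq_le_two_mul_sum_le {ι α : Type*} [LinearOrder α] (s : Finset ι) (x : ι → ℝ≥0∞)
    (f : ι → α) :
    (∑ i ∈ s, x i) ^ 2 ≤ 2 * ∑ i ∈ s, x i * ∑ j ∈ s with f j ≤ f i, x j := by
  classical
  have h1 : (∑ i ∈ s, x i) ^ 2 ≤ ∑ i ∈ s, ∑ j ∈ s,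
      ((if f j ≤ f i then x i * x j else 0) + (if f i ≤ f j then x i * x j else 0)) := by
    rw [sq, Finset.sum_mul_sum]
    refine Finset.sum_le_sum fun i _ => Finset.sum_le_sum fun j _ => ?_
    rcases le_total (f j) (f i) with h | h
    · simp only [if_pos h]; exact le_self_add
    · simp only [if_pos h]; exact le_add_self
  refine h1.trans (le_of_eq ?_)
  simp only [Finset.sum_add_distrib]
  have h2 : ∑ i ∈ s, ∑ j ∈ s, (if f i ≤ f j then x i * x j else 0) =
      ∑ i ∈ s, ∑ j ∈ s, (if f j ≤ f i then x i * x j else 0) := by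
    rw [Finset.sum_comm]
    refine Finset.sum_congr rfl fun i _ => Finset.sum_congr rfl fun j _ => ?_
    rw [mul_comm]
  rw [h2, ← two_mul]
  congr 1
  refine Finset.sum_congr rfl fun i _ => ?_
  rw [Finset.mul_sum, Finset.sum_filter]

/-- Sums of distinct powers are dominated by the largest one. -/
lemma sum_zpow_le (b : ℝ≥0∞) (hb : 2 ≤ b) (hb' : b ≠ ∞) (Z : Finset ℤ) (N : ℤ)
    (hZ : ∀ n ∈ Z, n ≤ N) : ∑ n ∈ Z, b ^ n ≤ 2 * b ^ N := by
  classical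
  have hb0 : b ≠ 0 := by
    rintro rfl; simp at hb
  have h1 : ∀ n ∈ Z, b ^ n ≤ b ^ N * (2⁻¹ : ℝ≥0∞) ^ (N - n).toNat := by
    intro n hn
    have : n = N + -((N - n).toNat : ℤ) := by have := hZ n hn; omega
    conv_lhs => rw [this]
    rw [ENNReal.zpow_add hb0 hb', ENNReal.zpow_neg, zpow_natCast, ← ENNReal.inv_pow]
    gcongr
  calc ∑ n ∈ Z, b ^ n ≤ ∑ n ∈ Z, b ^ N * (2⁻¹ : ℝ≥0∞) ^ (N - n).toNat := Finset.sum_le_sum h1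
    _ = b ^ N * ∑ j ∈ Z.image fun n => (N - n).toNat, (2⁻¹ : ℝ≥0∞) ^ j := by
      rw [Finset.mul_sum, Finset.sum_image]
      intro a ha c hc hac
      have := hZ a ha; have := hZ c hc
      simp only at hac
      omega
    _ ≤ b ^ N * ∑' j : ℕ, (2⁻¹ : ℝ≥0∞) ^ j := by gcongr; exact ENNReal.sum_le_tsum _
    _ = 2 * b ^ N := by
      rw [ENNReal.tsum_geometric, ENNReal.one_sub_inv_two, inv_inv, mul_comm]

/-- Absorption of `X` from the right-hand side of an estimate for `X ^ 2`. -/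
lemma le_of_le_mul_sqrt {X R : ℝ≥0∞} {c : ℝ≥0} (hc : 1 ≤ c) (hX : X ≠ ∞)
    (h : X ^ 2 ≤ (c : ℝ≥0∞) * R * X ∨ X ≤ R) : X ≤ c * R := by
  rcases h with h | h
  · by_cases h0 : X = 0
    · simp [h0]
    rw [sq] at h
    exact (ENNReal.mul_le_mul_iff_left h0 hX).1 h
  · calc X ≤ 1 * R := by rwa [one_mul]
      _ ≤ _ := by gcongr; exact_mod_cast hc

lemma two_zpow_sq (n : ℤ) : ((2 : ℝ≥0∞) ^ n) ^ 2 = 4 ^ n := by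
  have h2 : (2 : ℝ≥0∞) = ((2 : ℝ≥0) : ℝ≥0∞) := by norm_num
  have h4 : (4 : ℝ≥0∞) = ((4 : ℝ≥0) : ℝ≥0∞) := by norm_num
  rw [h2, h4, ← ENNReal.coe_zpow two_ne_zero, ← ENNReal.coe_zpow four_ne_zero, ← ENNReal.coe_pow,
    ← zpow_natCast, ← zpow_mul, mul_comm, zpow_mul]
  norm_num

lemma add_sq_le_two_mul (a b : ℝ≥0∞) : (a + b) ^ 2 ≤ 2 * (a ^ 2 + b ^ 2) := by
  rcases eq_or_ne a ∞ with rfl | ha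
  · simp
  rcases eq_or_ne b ∞ with rfl | hb
  · simp
  lift a to ℝ≥0 using ha
  lift b to ℝ≥0 using hb
  have : (a + b) ^ 2 ≤ 2 * (a ^ 2 + b ^ 2) := by
    rw [← NNReal.coe_le_coe]
    push_cast
    nlinarith [sq_nonneg ((a : ℝ) - b)]
  exact_mod_cast this

lemma two_mul_add_sq_le (a b : ℝ≥0∞) : 2 * (a + b) ^ 2 ≤ 6 * a ^ 2 + 3 * b ^ 2 := by
  rcases eq_or_ne a ∞ with rfl | ha
  · simp
  rcases eq_or_ne b ∞ with rfl | hb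
  · simp
  lift a to ℝ≥0 using ha
  lift b to ℝ≥0 using hb
  have : 2 * (a + b) ^ 2 ≤ 6 * a ^ 2 + 3 * b ^ 2 := by
    rw [← NNReal.coe_le_coe]
    push_cast
    nlinarith [sq_nonneg (2 * (a : ℝ) - b)]
  exact_mod_cast this

/-! ### Testing for positive dyadic operators -/

section Dyadic

variable {Y : Type*}

/-- The union of the members of `𝒦` of level `n`. -/
def levelSet (𝒦 : Finset (Set Y)) (n : Set Y → ℤ) (k : ℤ) : Set Y :=
  {y | ∃ K ∈ 𝒦, n K = k ∧ y ∈ K}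

/-- `n` is a level function of `h` on the finite family `𝒦`: it is the integer part of the
logarithm to base two of the largest average of `h` over a member of `𝒦` containing a given one. -/
structure IsLevel [MeasurableSpace Y] (σ : Measure Y) (h : Y → ℝ≥0∞) (𝒦 : Finset (Set Y))
    (n : Set Y → ℤ) : Prop where
  anti : ∀ K ∈ 𝒦, ∀ K' ∈ 𝒦, K ⊆ K' → n K' ≤ n K
  le : ∀ K ∈ 𝒦, ∫⁻ y in K, h y ∂σ ≤ 2 ^ (n K + 1) * σ K
  exists_le : ∀ K ∈ 𝒦, ∃ H ∈ 𝒦, K ⊆ H ∧ n H = n K ∧ 2 ^ n H * σ H ≤ ∫⁻ y in H, h y ∂σ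

lemma exists_isLevel [MeasurableSpace Y] (σ : Measure Y) (h : Y → ℝ≥0∞) (𝒦 : Finset (Set Y))
    (hfin : ∀ K ∈ 𝒦, σ K ≠ ∞) (h0 : ∀ K ∈ 𝒦, ∫⁻ y in K, h y ∂σ ≠ 0)
    (htop : ∀ K ∈ 𝒦, ∫⁻ y in K, h y ∂σ ≠ ∞) : ∃ n, IsLevel σ h 𝒦 n := by
  classical
  have hσ0 : ∀ K ∈ 𝒦, σ K ≠ 0 := fun K hK h1 => h0 K hK (setLIntegral_measure_zero K h h1)
  have hex : ∀ K : Set Y, ∃ k : ℤ, K ∈ 𝒦 →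
      2 ^ k * σ K ≤ ∫⁻ y in K, h y ∂σ ∧ ∫⁻ y in K, h y ∂σ ≤ 2 ^ (k + 1) * σ K := by
    intro K
    by_cases hK : K ∈ 𝒦
    · obtain ⟨k, hk1, hk2⟩ := ENNReal.exists_mem_Ico_zpow
        (x := (∫⁻ y in K, h y ∂σ) / σ K) (y := 2)
        (ENNReal.div_ne_zero.2 ⟨h0 K hK, hfin K hK⟩)
        (ENNReal.div_ne_top (htop K hK) (hσ0 K hK)) (by norm_num) (by norm_num)
      refine ⟨k, fun _ => ⟨?_, ?_⟩⟩
      · exact (ENNReal.le_div_iff_mul_le (Or.inl (hσ0 K hK)) (Or.inl (hfin K hK))).1 hk1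
      · exact (ENNReal.div_le_iff_le_mul (Or.inl (hσ0 K hK)) (Or.inl (hfin K hK))).1 hk2.le
    · exact ⟨0, fun h => absurd h hK⟩
  choose l hl using hex
  have hne : ∀ K ∈ 𝒦, (𝒦.filter (K ⊆ ·)).Nonempty := fun K hK => ⟨K, by simp [hK]⟩
  let n : Set Y → ℤ := fun K =>
    if hK : (𝒦.filter (K ⊆ ·)).Nonempty then (𝒦.filter (K ⊆ ·)).sup' hK l else 0
  have hn : ∀ K (hK : K ∈ 𝒦), n K = (𝒦.filter (K ⊆ ·)).sup' (hne K hK) l := fun K hK =>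
    dif_pos (hne K hK)
  have hanti : ∀ K ∈ 𝒦, ∀ K' ∈ 𝒦, K ⊆ K' → n K' ≤ n K := by
    intro K hK K' hK' hKK'
    rw [hn K hK, hn K' hK']
    refine Finset.sup'_mono l (fun L hL => ?_) (hne K' hK')
    simp only [Finset.mem_filter] at hL ⊢
    exact ⟨hL.1, hKK'.trans hL.2⟩
  have hle : ∀ K ∈ 𝒦, l K ≤ n K := fun K hK => by
    rw [hn K hK]
    exact Finset.le_sup' l (by simp [hK])
  refine ⟨n, hanti, fun K hK => ?_, fun K hK => ?_⟩
  · refine (hl K hK).2.trans ?_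
    gcongr
    · norm_num
    · exact hle K hK
  · obtain ⟨H, hH, hHe⟩ := Finset.exists_mem_eq_sup' (hne K hK) l
    simp only [Finset.mem_filter] at hH
    have h1 : n H = l H := le_antisymm
      ((hanti K hK H hH.1 hH.2).trans ((hn K hK).trans hHe).le) (hle H hH.1)
    refine ⟨H, hH.1, hH.2, ?_, ?_⟩
    · rw [h1, hn K hK, hHe]
    · rw [h1]; exact (hl H hH.1).1

variable (𝒦 : Finset (Set Y)) (n : Set Y → ℤ)

open Classical in
/-- The maximal members of `𝒦` of level `k`. -/
noncomputable def maxLevel (k : ℤ) : Finset (Set Y) :=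
  𝒦.filter fun H => n H = k ∧ ∀ K ∈ 𝒦, n K = k → H ⊆ K → K = H

variable {𝒦 n}

lemma exists_maxLevel {K : Set Y} (hK : K ∈ 𝒦) : ∃ H ∈ maxLevel 𝒦 n (n K), K ⊆ H := by
  classical
  obtain ⟨H, hKH, hH⟩ := (𝒦.filter fun L => n L = n K).exists_le_maximal (a := K) (by simp [hK])
  have h1 := hH.prop
  simp only [Finset.mem_filter] at h1
  refine ⟨H, ?_, hKH⟩
  simp only [maxLevel, Finset.mem_filter]
  refine ⟨h1.1, h1.2, fun L hL hLn hHL => ?_⟩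
  exact le_antisymm (hH.le_of_ge (by simp [hL, hLn]) hHL) hHL

lemma levelSet_eq (k : ℤ) : levelSet 𝒦 n k = ⋃ H ∈ maxLevel 𝒦 n k, H := by
  ext y
  simp only [levelSet, mem_ofPred_eq, mem_iUnion, exists_prop]
  constructor
  · rintro ⟨K, hK, rfl, hy⟩
    obtain ⟨H, hH, hKH⟩ := exists_maxLevel (n := n) hK
    exact ⟨H, hH, hKH hy⟩
  · rintro ⟨H, hH, hy⟩
    simp only [maxLevel, Finset.mem_filter] at hH
    exact ⟨H, hH.1, hH.2.1, hy⟩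

lemma pairwise_maxLevel (hlam : ∀ K ∈ 𝒦, ∀ K' ∈ 𝒦, K ⊆ K' ∨ K' ⊆ K ∨ Disjoint K K') (k : ℤ) :
    (maxLevel 𝒦 n k : Set (Set Y)).PairwiseDisjoint id := by
  intro H hH H' hH' hne
  simp only [maxLevel, Finset.coe_filter, mem_ofPred_eq] at hH hH'
  rcases hlam H hH.1 H' hH'.1 with h | h | h
  · exact absurd (hH.2.2 H' hH'.1 hH'.2.1 h).symm hne
  · exact absurd (hH'.2.2 H hH.1 hH.2.1 h) hne
  · exact h

variable [MeasurableSpace Y] {σ : Measure Y} {h : Y → ℝ≥0∞}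

lemma measurableSet_levelSet (hmeas : ∀ K ∈ 𝒦, MeasurableSet K) (k : ℤ) :
    MeasurableSet (levelSet 𝒦 n k) := by
  rw [levelSet_eq]
  refine Finset.measurableSet_biUnion _ fun H hH => hmeas H ?_
  simp only [maxLevel, Finset.mem_filter] at hH
  exact hH.1

lemma measure_levelSet (hmeas : ∀ K ∈ 𝒦, MeasurableSet K)
    (hlam : ∀ K ∈ 𝒦, ∀ K' ∈ 𝒦, K ⊆ K' ∨ K' ⊆ K ∨ Disjoint K K') (k : ℤ) :
    σ (levelSet 𝒦 n k) = ∑ H ∈ maxLevel 𝒦 n k, σ H := by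
  rw [levelSet_eq]
  refine measure_biUnion_finset (f := id) (pairwise_maxLevel hlam k) ?_
  · intro H hH
    simp only [maxLevel, Finset.mem_filter] at hH
    exact hmeas H hH.1

/-- The weak type inequality for the dyadic maximal function. -/
lemma IsLevel.measure_levelSet_le (hn : IsLevel σ h 𝒦 n) (hmeas : ∀ K ∈ 𝒦, MeasurableSet K)
    (hlam : ∀ K ∈ 𝒦, ∀ K' ∈ 𝒦, K ⊆ K' ∨ K' ⊆ K ∨ Disjoint K K') (k : ℤ) :
    2 ^ k * σ (levelSet 𝒦 n k) ≤ ∫⁻ y in levelSet 𝒦 n k, h y ∂σ := by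
  rw [measure_levelSet hmeas hlam, levelSet_eq, lintegral_biUnion_finset, Finset.mul_sum]
  · refine Finset.sum_le_sum fun H hH => ?_
    simp only [maxLevel, Finset.mem_filter] at hH
    obtain ⟨H', hH', hHH', hnH', hle⟩ := hn.exists_le H hH.1
    obtain rfl := hH.2.2 H' hH' (hnH'.trans hH.2.1) hHH'
    rwa [hH.2.1] at hle
  · exact pairwise_maxLevel hlam k
  · intro H hH
    simp only [maxLevel, Finset.mem_filter] at hH
    exact hmeas H hH.1

/-- The maximal inequality in `L²`, as a bound on the sum of the squares of the levels. -/
lemma IsLevel.sum_levelSet_le (hn : IsLevel σ h 𝒦 n) (hmeas : ∀ K ∈ 𝒦, MeasurableSet K)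
    (hlam : ∀ K ∈ 𝒦, ∀ K' ∈ 𝒦, K ⊆ K' ∨ K' ⊆ K ∨ Disjoint K K') (hfin : ∀ K ∈ 𝒦, σ K ≠ ∞)
    (hh : AEMeasurable h σ) :
    ∑ k ∈ 𝒦.image n, 4 ^ k * σ (levelSet 𝒦 n k) ≤ 4 * ∫⁻ y, h y ^ 2 ∂σ := by
  classical
  set S := ∑ k ∈ 𝒦.image n, (4 : ℝ≥0∞) ^ k * σ (levelSet 𝒦 n k) with hS
  let g : Y → ℝ≥0∞ := fun y => ∑ k ∈ 𝒦.image n, (levelSet 𝒦 n k).indicator (fun _ => 2 ^ k) y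
  have hgm : Measurable g := Finset.measurable_sum _ fun k _ =>
    measurable_const.indicator (measurableSet_levelSet hmeas k)
  have hg : ∀ y, g y ^ 2 ≤
      4 * ∑ k ∈ 𝒦.image n, (levelSet 𝒦 n k).indicator (fun _ => 4 ^ k) y := by
    intro y
    simp only [g, indicator_apply, ← Finset.sum_filter]
    set Z := (𝒦.image n).filter fun k => y ∈ levelSet 𝒦 n k with hZ
    rcases Z.eq_empty_or_nonempty with h0 | h0
    · simp [h0]
    · calc (∑ k ∈ Z, (2 : ℝ≥0∞) ^ k) ^ 2 ≤ (2 * 2 ^ (Z.max' h0)) ^ 2 := by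
            gcongr
            exact sum_zpow_le 2 le_rfl (by norm_num) Z _ fun k hk => Z.le_max' k hk
        _ = 4 * 4 ^ (Z.max' h0) := by rw [mul_pow, two_zpow_sq]; norm_num
        _ ≤ _ := by
            gcongr
            exact Finset.single_le_sum (f := fun k => (4 : ℝ≥0∞) ^ k) (fun _ _ => zero_le)
              (Z.max'_mem h0)
  have hgS : ∫⁻ y, g y ^ 2 ∂σ ≤ 4 * S := by
    refine (lintegral_mono hg).trans (le_of_eq ?_)
    rw [lintegral_const_mul, lintegral_finsetSum]
    · congr 1
      refine Finset.sum_congr rfl fun k _ => ?_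
      rw [lintegral_indicator (measurableSet_levelSet hmeas k), lintegral_const]
      simp
    · exact fun k _ => measurable_const.indicator (measurableSet_levelSet hmeas k)
    · exact Finset.measurable_sum _ fun k _ =>
        measurable_const.indicator (measurableSet_levelSet hmeas k)
  have hSg : S ≤ ∫⁻ y, h y * g y ∂σ := by
    have : ∫⁻ y, h y * g y ∂σ =
        ∑ k ∈ 𝒦.image n, 2 ^ k * ∫⁻ y in levelSet 𝒦 n k, h y ∂σ := by
      simp only [g, Finset.mul_sum]
      rw [lintegral_finsetSum']
      · refine Finset.sum_congr rfl fun k _ => ?_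
        rw [← lintegral_const_mul' _ _ (ENNReal.zpow_ne_top (by norm_num) (by norm_num) _),
          ← lintegral_indicator (measurableSet_levelSet hmeas k)]
        refine lintegral_congr fun y => ?_
        by_cases hy : y ∈ levelSet 𝒦 n k <;> simp [hy, mul_comm]
      · exact fun k _ => hh.mul
          (measurable_const.indicator (measurableSet_levelSet hmeas k)).aemeasurable
    rw [this]
    refine Finset.sum_le_sum fun k _ => ?_
    calc (4 : ℝ≥0∞) ^ k * σ (levelSet 𝒦 n k) = 2 ^ k * (2 ^ k * σ (levelSet 𝒦 n k)) := by
          rw [← two_zpow_sq, sq, mul_assoc]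
      _ ≤ _ := by gcongr; exact hn.measure_levelSet_le hmeas hlam k
  have hStop : S ≠ ∞ := by
    refine ENNReal.sum_ne_top.2 fun k _ => ENNReal.mul_ne_top
      (ENNReal.zpow_ne_top (by norm_num) (by norm_num) _) ?_
    rw [measure_levelSet hmeas hlam]
    refine ENNReal.sum_ne_top.2 fun H hH => ?_
    simp only [maxLevel, Finset.mem_filter] at hH
    exact hfin H hH.1
  have := le_of_le_mul_sqrt (X := S) (R := ∫⁻ y, h y ^ 2 ∂σ) (c := 4) (by norm_num) hStop
    (Or.inl ?_)
  · exact_mod_cast this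
  · calc S ^ 2 ≤ (∫⁻ y, h y * g y ∂σ) ^ 2 := by gcongr
      _ ≤ (∫⁻ y, h y ^ 2 ∂σ) * ∫⁻ y, g y ^ 2 ∂σ := lintegral_mul_sq_le σ hh hgm.aemeasurable
      _ ≤ (∫⁻ y, h y ^ 2 ∂σ) * (4 * S) := by gcongr
      _ = _ := by push_cast; ring

end Dyadic

section Dyadic

/-- The integer part of the logarithm to base two. -/
lemma exists_log {α : Type*} (f : α → ℝ≥0∞) (hf : ∀ K, f K ≠ ∞) :
    ∃ p : α → ℤ, (∀ K, f K ≠ 0 → 2 ^ p K ≤ f K ∧ f K ≤ 2 ^ (p K + 1)) ∧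
      ∀ K K', f K = f K' → p K = p K' := by
  have : ∀ a : ℝ≥0∞, ∃ k : ℤ, a ≠ ∞ → a ≠ 0 → 2 ^ k ≤ a ∧ a ≤ 2 ^ (k + 1) := by
    intro a
    by_cases h1 : a ≠ ∞ ∧ a ≠ 0
    · obtain ⟨k, hk1, hk2⟩ := ENNReal.exists_mem_Ico_zpow (x := a) (y := 2) h1.2 h1.1
        (by norm_num) (by norm_num)
      exact ⟨k, fun _ _ => ⟨hk1, hk2.le⟩⟩
    · exact ⟨0, fun h2 h3 => absurd ⟨h2, h3⟩ h1⟩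
  choose q hq using this
  exact ⟨fun K => q (f K), fun K hK => hq _ (hf K) hK, fun K K' h1 => congrArg q h1⟩

variable {Y β : Type*} [MeasurableSpace Y] {σ : Measure Y} {h : Y → ℝ≥0∞} {𝒦 : Finset (Set Y)}
  {n : Set Y → ℤ} {lam : Set Y → ℝ≥0∞} {𝒮 : Finset β} {B : β → Set Y} {e : β → ℝ≥0∞} {A : ℝ≥0∞}

open Classical in
/-- Forward testing controls the part of the operator that lives on one level. -/
lemma sum_level_sq_le (hmeas : ∀ K ∈ 𝒦, MeasurableSet K)
    (hlam : ∀ K ∈ 𝒦, ∀ K' ∈ 𝒦, K ⊆ K' ∨ K' ⊆ K ∨ Disjoint K K')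
    (hB : ∀ t ∈ 𝒮, (B t).Nonempty)
    (fwd : ∀ H ∈ 𝒦, ∑ t ∈ 𝒮 with B t ⊆ H,
      e t * (∑ K ∈ 𝒦 with B t ⊆ K ∧ K ⊆ H, lam K * σ K) ^ 2 ≤ A * σ H) (k : ℤ) :
    ∑ t ∈ 𝒮, e t * (∑ K ∈ 𝒦 with B t ⊆ K ∧ n K = k, lam K * σ K) ^ 2
      ≤ A * σ (levelSet 𝒦 n k) := by
  rw [measure_levelSet hmeas hlam, Finset.mul_sum]
  calc ∑ t ∈ 𝒮, e t * (∑ K ∈ 𝒦 with B t ⊆ K ∧ n K = k, lam K * σ K) ^ 2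
      ≤ ∑ t ∈ 𝒮, ∑ H ∈ maxLevel 𝒦 n k, if B t ⊆ H then
          e t * (∑ K ∈ 𝒦 with B t ⊆ K ∧ K ⊆ H, lam K * σ K) ^ 2 else 0 := ?_
    _ = ∑ H ∈ maxLevel 𝒦 n k, ∑ t ∈ 𝒮 with B t ⊆ H,
          e t * (∑ K ∈ 𝒦 with B t ⊆ K ∧ K ⊆ H, lam K * σ K) ^ 2 := by
        rw [Finset.sum_comm]
        simp only [Finset.sum_filter]
    _ ≤ _ := Finset.sum_le_sum fun H hH => by
        simp only [maxLevel, Finset.mem_filter] at hH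
        exact fwd H hH.1
  refine Finset.sum_le_sum fun t ht => ?_
  by_cases h0 : ∃ K ∈ 𝒦, B t ⊆ K ∧ n K = k
  · obtain ⟨K₀, hK₀, hBK₀, rfl⟩ := h0
    obtain ⟨H, hH, hK₀H⟩ := exists_maxLevel (n := n) hK₀
    refine le_trans ?_ (Finset.single_le_sum (fun _ _ => zero_le) hH)
    rw [if_pos (hBK₀.trans hK₀H)]
    gcongr 2
    refine Finset.sum_le_sum_of_subset fun K hK => ?_
    simp only [Finset.mem_filter] at hK ⊢
    refine ⟨hK.1, hK.2.1, ?_⟩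
    -- `K` and `H` both contain `B t`, so `K` lies in the maximal member `H` of its level
    simp only [maxLevel, Finset.mem_filter] at hH
    rcases hlam K hK.1 H hH.1 with h1 | h1 | h1
    · exact h1
    · exact (hH.2.2 K hK.1 hK.2.2 h1).subset
    · obtain ⟨y, hy⟩ := hB t ht
      exact absurd (hBK₀.trans hK₀H hy) (disjoint_left.1 h1 (hK.2.1 hy))
  · have : (𝒦.filter fun K => B t ⊆ K ∧ n K = k) = ∅ := by
      rw [Finset.filter_eq_empty_iff]
      exact fun K hK h1 => h0 ⟨K, hK, h1⟩
    simp [this]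

open Classical in
/-- The part of the operator above `K` that comes from smaller levels than that of `K`. -/
noncomputable def upperPart (σ : Measure Y) (h : Y → ℝ≥0∞) (𝒦 : Finset (Set Y)) (n : Set Y → ℤ)
    (lam : Set Y → ℝ≥0∞) (K : Set Y) : ℝ≥0∞ :=
  ∑ K' ∈ 𝒦 with K ⊆ K' ∧ n K' < n K, lam K' * ∫⁻ y in K', h y ∂σ

/-- The members of one level that contain a given point have the same upper part. -/
lemma upperPart_eq (hlam : ∀ K ∈ 𝒦, ∀ K' ∈ 𝒦, K ⊆ K' ∨ K' ⊆ K ∨ Disjoint K K')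
    (hn : IsLevel σ h 𝒦 n) {K₁ K₂ : Set Y} (h₁ : K₁ ∈ 𝒦) (h₂ : K₂ ∈ 𝒦) {y : Y} (hy₁ : y ∈ K₁)
    (hy₂ : y ∈ K₂) (h12 : n K₁ = n K₂) :
    upperPart σ h 𝒦 n lam K₁ = upperPart σ h 𝒦 n lam K₂ := by
  classical
  have key : ∀ K₁ ∈ 𝒦, ∀ K₂ ∈ 𝒦, y ∈ K₁ → y ∈ K₂ → n K₁ = n K₂ → ∀ K' ∈ 𝒦,
      K₁ ⊆ K' ∧ n K' < n K₁ → K₂ ⊆ K' ∧ n K' < n K₂ := by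
    intro K₁ _ K₂ h₂ hy₁ hy₂ h12 K' hK' hK
    refine ⟨?_, h12 ▸ hK.2⟩
    rcases hlam K₂ h₂ K' hK' with h1 | h1 | h1
    · exact h1
    · have := hn.anti K' hK' K₂ h₂ h1
      omega
    · exact absurd (hK.1 hy₁) (disjoint_left.1 h1 hy₂)
  unfold upperPart
  refine Finset.sum_congr (Finset.filter_congr fun K' hK' => ?_) fun _ _ => rfl
  exact ⟨key K₁ h₁ K₂ h₂ hy₁ hy₂ h12 K' hK', key K₂ h₂ K₁ h₁ hy₂ hy₁ h12.symm K' hK'⟩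

open Classical in
/-- Dual testing controls the pairs of different levels. -/
lemma sum_upperPart_sq_le (hmeas : ∀ K ∈ 𝒦, MeasurableSet K)
    (hlam : ∀ K ∈ 𝒦, ∀ K' ∈ 𝒦, K ⊆ K' ∨ K' ⊆ K ∨ Disjoint K K')
    (hn : IsLevel σ h 𝒦 n) (hlamtop : ∀ K, lam K ≠ ∞)
    (htop : ∀ K ∈ 𝒦, ∫⁻ y in K, h y ∂σ ≠ ∞)
    (dual : ∀ E ⊆ 𝒮, ∫⁻ y, (∑ t ∈ E, e t * ∑ K ∈ 𝒦 with B t ⊆ K,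
      lam K * K.indicator 1 y) ^ 2 ∂σ ≤ A * ∑ t ∈ E, e t) :
    (∑ K ∈ 𝒦, (lam K * ∫⁻ y in K, h y ∂σ) * upperPart σ h 𝒦 n lam K * ∑ t ∈ 𝒮 with B t ⊆ K, e t)
        ^ 2 ≤
      32 * A * (∑ k ∈ 𝒦.image n, 4 ^ k * σ (levelSet 𝒦 n k)) *
        ∑ t ∈ 𝒮, e t * (∑ K ∈ 𝒦 with B t ⊆ K, lam K * ∫⁻ y in K, h y ∂σ) ^ 2 := by
  -- The members `K` are grouped by the size `2 ^ p K` of their upper part `τ K`. The dual testing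
  -- inequality is applied to the sets `E m` of indices where the operator is at least `2 ^ m`.
  set τ := upperPart σ h 𝒦 n lam with hτ
  have hτtop : ∀ K, τ K ≠ ∞ := by
    intro K
    refine ENNReal.sum_ne_top.2 fun K' hK' => ENNReal.mul_ne_top (hlamtop _) (htop _ ?_)
    exact (Finset.mem_filter.1 hK').1
  obtain ⟨p, hp, hpeq⟩ := exists_log τ hτtop
  set T : β → ℝ≥0∞ := fun t => ∑ K ∈ 𝒦 with B t ⊆ K, lam K * ∫⁻ y in K, h y ∂σ with hT
  set 𝒦' := 𝒦.filter fun K => τ K ≠ 0 with h𝒦'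
  set P := 𝒦'.image p with hP
  let E : ℤ → Finset β := fun m => 𝒮.filter fun t => 2 ^ m ≤ T t
  let u : ℤ → Y → ℝ≥0∞ := fun m y =>
    (𝒦'.filter fun K => p K = m).sup fun K => K.indicator (fun _ => (2 : ℝ≥0∞) ^ n K) y
  let D : ℤ → Y → ℝ≥0∞ := fun m y =>
    ∑ t ∈ E m, e t * ∑ K ∈ 𝒦 with B t ⊆ K, lam K * K.indicator 1 y
  have hmeas' : ∀ K ∈ 𝒦', MeasurableSet K := fun K hK => hmeas K (Finset.mem_filter.1 hK).1
  have hum : ∀ m, Measurable (u m) := fun m => by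
    simp only [u, Finset.sup_eq_iSup]
    refine Measurable.biSup _ (Finset.countable_toSet _) fun K hK => ?_
    exact measurable_const.indicator (hmeas' K (Finset.mem_filter.1 hK).1)
  have hDm : ∀ m, Measurable (D m) := fun m =>
    Finset.measurable_sum _ fun t _ => Measurable.const_mul
      (Finset.measurable_sum _ fun K hK => Measurable.const_mul
        (measurable_one.indicator (hmeas K (Finset.mem_filter.1 hK).1)) _) _
  -- every `t` below `K` belongs to the set `E (p K)`
  have hTτ : ∀ K ∈ 𝒦', ∀ t ∈ 𝒮, B t ⊆ K → t ∈ E (p K) := by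
    intro K hK t ht hBt
    simp only [E, Finset.mem_filter]
    refine ⟨ht, (hp K (Finset.mem_filter.1 hK).2).1.trans ?_⟩
    refine Finset.sum_le_sum_of_subset fun K' hK' => ?_
    simp only [Finset.mem_filter] at hK' ⊢
    exact ⟨hK'.1, hBt.trans hK'.2.1⟩
  have h1 : ∀ m, ∑ K ∈ 𝒦' with p K = m, 2 ^ n K * lam K * σ K * ∑ t ∈ 𝒮 with B t ⊆ K, e t
      ≤ ∫⁻ y, u m y * D m y ∂σ := by
    intro m
    have e1 : ∀ K ∈ 𝒦'.filter (fun K => p K = m),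
        2 ^ n K * lam K * σ K * ∑ t ∈ 𝒮 with B t ⊆ K, e t =
        ∫⁻ y, K.indicator (fun _ => (2 ^ n K * lam K) * ∑ t ∈ 𝒮 with B t ⊆ K, e t) y ∂σ := by
      intro K hK
      rw [lintegral_indicator (hmeas' K (Finset.mem_filter.1 hK).1), lintegral_const]
      simp only [MeasurableSet.univ, Measure.restrict_apply, univ_inter]
      ring
    rw [Finset.sum_congr rfl e1, ← lintegral_finsetSum]
    swap
    · exact fun K hK => measurable_const.indicator (hmeas' K (Finset.mem_filter.1 hK).1)
    refine lintegral_mono fun y => ?_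
    calc ∑ K ∈ 𝒦' with p K = m,
          K.indicator (fun _ => (2 ^ n K * lam K) * ∑ t ∈ 𝒮 with B t ⊆ K, e t) y
        ≤ ∑ K ∈ 𝒦' with p K = m,
          u m y * (lam K * K.indicator 1 y * ∑ t ∈ E m with B t ⊆ K, e t) := by
          refine Finset.sum_le_sum fun K hK => ?_
          by_cases hy : y ∈ K
          · simp only [indicator_of_mem hy, Pi.one_apply, mul_one, mul_assoc]
            have hu : (2 : ℝ≥0∞) ^ n K ≤ u m y := by
              have := Finset.le_sup (f := fun K : Set Y =>
                K.indicator (fun _ => (2 : ℝ≥0∞) ^ n K) y) hK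
              simpa only [indicator_of_mem hy] using this
            gcongr 1
            · gcongr 1
              refine Finset.sum_le_sum_of_subset fun t ht => ?_
              have hK' := Finset.mem_filter.1 hK
              have ht' := Finset.mem_filter.1 ht
              rw [← hK'.2]
              exact Finset.mem_filter.2 ⟨hTτ K hK'.1 t ht'.1 ht'.2, ht'.2⟩
          · simp [indicator_of_notMem hy]
      _ ≤ ∑ K ∈ 𝒦, u m y * (lam K * K.indicator 1 y * ∑ t ∈ E m with B t ⊆ K, e t) :=
          Finset.sum_le_sum_of_subset
            ((Finset.filter_subset _ _).trans (Finset.filter_subset _ _))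
      _ = u m y * D m y := by
          simp only [D, Finset.mul_sum, Finset.sum_filter]
          rw [Finset.sum_comm]
          refine Finset.sum_congr rfl fun t _ => Finset.sum_congr rfl fun K _ => ?_
          split_ifs
          · ring
          · simp
  have h2 : ∑ K ∈ 𝒦, (lam K * ∫⁻ y in K, h y ∂σ) * τ K * ∑ t ∈ 𝒮 with B t ⊆ K, e t ≤
      4 * ∑ m ∈ P, 2 ^ m * ∫⁻ y, u m y * D m y ∂σ := by
    have e0 : ∑ K ∈ 𝒦, (lam K * ∫⁻ y in K, h y ∂σ) * τ K * ∑ t ∈ 𝒮 with B t ⊆ K, e t =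
        ∑ K ∈ 𝒦', (lam K * ∫⁻ y in K, h y ∂σ) * τ K * ∑ t ∈ 𝒮 with B t ⊆ K, e t := by
      refine (Finset.sum_subset (Finset.filter_subset _ _) fun K hK hK' => ?_).symm
      have : τ K = 0 := by
        by_contra h0
        exact hK' (Finset.mem_filter.2 ⟨hK, h0⟩)
      simp [this]
    rw [e0, ← Finset.sum_fiberwise_of_maps_to (t := P) (g := p)
      fun K hK => Finset.mem_image_of_mem p hK, Finset.mul_sum]
    refine Finset.sum_le_sum fun m _ => ?_
    refine le_trans ?_ (mul_le_mul_right (mul_le_mul_right (h1 m) _) _)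
    rw [Finset.mul_sum, Finset.mul_sum]
    refine Finset.sum_le_sum fun K hK => ?_
    have hK' := Finset.mem_filter.1 hK
    have hK'' := Finset.mem_filter.1 hK'.1
    have e2 : ∀ k : ℤ, (2 : ℝ≥0∞) ^ (k + 1) = 2 * 2 ^ k := fun k => by
      rw [ENNReal.zpow_add two_ne_zero (by norm_num), zpow_one, mul_comm]
    calc (lam K * ∫⁻ y in K, h y ∂σ) * τ K * ∑ t ∈ 𝒮 with B t ⊆ K, e t
        ≤ (lam K * (2 ^ (n K + 1) * σ K)) * 2 ^ (m + 1) * ∑ t ∈ 𝒮 with B t ⊆ K, e t := by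
          gcongr
          · exact hn.le K hK''.1
          · rw [← hK'.2]; exact (hp K hK''.2).2
      _ = _ := by rw [e2, e2]; ring
  -- at a fixed point, all members of one level have the same upper part
  have h3 : ∑ m ∈ P, ∫⁻ y, u m y ^ 2 ∂σ ≤ ∑ k ∈ 𝒦.image n, 4 ^ k * σ (levelSet 𝒦 n k) := by
    have e1 : ∀ k ∈ 𝒦.image n, 4 ^ k * σ (levelSet 𝒦 n k) =
        ∫⁻ y, (levelSet 𝒦 n k).indicator (fun _ => (4 : ℝ≥0∞) ^ k) y ∂σ := by
      intro k _
      rw [lintegral_indicator (measurableSet_levelSet hmeas k), lintegral_const]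
      simp
    rw [Finset.sum_congr rfl e1, ← lintegral_finsetSum, ← lintegral_finsetSum]
    rotate_left
    · exact fun k _ => measurable_const.indicator (measurableSet_levelSet hmeas k)
    · exact fun m _ => (hum m).pow_const 2
    refine lintegral_mono fun y => ?_
    have e2 : ∀ m ∈ P, u m y ^ 2 ≤ ∑ k ∈ 𝒦.image n,
        if ∃ K ∈ 𝒦, y ∈ K ∧ n K = k ∧ p K = m then (4 : ℝ≥0∞) ^ k else 0 := by
      intro m _
      rcases (𝒦'.filter fun K => p K = m).eq_empty_or_nonempty with h0 | h0
      · simp [u, h0]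
      obtain ⟨K, hK, hKu⟩ := Finset.exists_mem_eq_sup _ h0
        fun K : Set Y => K.indicator (fun _ => (2 : ℝ≥0∞) ^ n K) y
      have hK' := Finset.mem_filter.1 hK
      have hK'' := Finset.mem_filter.1 hK'.1
      simp only [u]
      rw [hKu]
      by_cases hy : y ∈ K
      · rw [indicator_of_mem hy, two_zpow_sq]
        refine le_trans ?_ (Finset.single_le_sum (fun _ _ => zero_le)
          (Finset.mem_image_of_mem n hK''.1))
        rw [if_pos ⟨K, hK''.1, hy, rfl, hK'.2⟩]
      · simp [indicator_of_notMem hy]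
    refine (Finset.sum_le_sum e2).trans ?_
    rw [Finset.sum_comm]
    refine Finset.sum_le_sum fun k _ => ?_
    rw [← Finset.sum_filter, Finset.sum_const, nsmul_eq_mul]
    by_cases hy : y ∈ levelSet 𝒦 n k
    · rw [indicator_of_mem hy]
      have : (P.filter fun m => ∃ K ∈ 𝒦, y ∈ K ∧ n K = k ∧ p K = m).card ≤ 1 := by
        rw [Finset.card_le_one]
        intro a ha b hb
        obtain ⟨K₁, hK₁, hy₁, hn₁, rfl⟩ := (Finset.mem_filter.1 ha).2
        obtain ⟨K₂, hK₂, hy₂, hn₂, rfl⟩ := (Finset.mem_filter.1 hb).2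
        exact hpeq _ _ (upperPart_eq hlam hn hK₁ hK₂ hy₁ hy₂ (hn₁.trans hn₂.symm))
      calc _ ≤ (1 : ℝ≥0∞) * 4 ^ k := by gcongr; exact_mod_cast this
        _ = _ := one_mul _
    · have : (P.filter fun m => ∃ K ∈ 𝒦, y ∈ K ∧ n K = k ∧ p K = m) = ∅ := by
        rw [Finset.filter_eq_empty_iff]
        rintro m _ ⟨K, hK, hyK, hnK, _⟩
        exact hy ⟨K, hK, hnK, hyK⟩
      simp [this]
  have h4 : ∑ m ∈ P, 4 ^ m * (A * ∑ t ∈ E m, e t) ≤ 2 * A * ∑ t ∈ 𝒮, e t * T t ^ 2 := by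
    have : ∑ m ∈ P, 4 ^ m * (A * ∑ t ∈ E m, e t) =
        A * ∑ t ∈ 𝒮, e t * ∑ m ∈ P with 2 ^ m ≤ T t, (4 : ℝ≥0∞) ^ m := by
      simp only [E, Finset.mul_sum, Finset.sum_filter]
      rw [Finset.sum_comm]
      refine Finset.sum_congr rfl fun t _ => Finset.sum_congr rfl fun m _ => ?_
      split_ifs
      · ring
      · simp
    rw [this, mul_comm 2 A, mul_assoc, Finset.mul_sum 𝒮 _ 2]
    gcongr A * ?_
    refine Finset.sum_le_sum fun t _ => ?_
    rw [mul_left_comm]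
    gcongr e t * ?_
    set Z := P.filter fun m => 2 ^ m ≤ T t with hZ
    rcases Z.eq_empty_or_nonempty with h0 | h0
    · simp [h0]
    · calc ∑ m ∈ Z, (4 : ℝ≥0∞) ^ m ≤ 2 * 4 ^ (Z.max' h0) :=
            sum_zpow_le 4 (by norm_num) (by norm_num) Z _ fun k hk => Z.le_max' k hk
        _ = 2 * (2 ^ (Z.max' h0)) ^ 2 := by rw [two_zpow_sq]
        _ ≤ _ := by
            gcongr
            exact (Finset.mem_filter.1 (Z.max'_mem h0)).2
  have h5 : (∑ m ∈ P, 2 ^ m * ∫⁻ y, u m y * D m y ∂σ) ^ 2 ≤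
      (∑ m ∈ P, ∫⁻ y, u m y ^ 2 ∂σ) * ∑ m ∈ P, 4 ^ m * (A * ∑ t ∈ E m, e t) := by
    refine sum_sq_le_of_sq_le_mul _ _ _ _ fun m _ => ?_
    calc (2 ^ m * ∫⁻ y, u m y * D m y ∂σ) ^ 2
        = 4 ^ m * (∫⁻ y, u m y * D m y ∂σ) ^ 2 := by rw [mul_pow, two_zpow_sq]
      _ ≤ 4 ^ m * ((∫⁻ y, u m y ^ 2 ∂σ) * (A * ∑ t ∈ E m, e t)) := by
          gcongr
          exact (lintegral_mul_sq_le σ (hum m).aemeasurable (hDm m).aemeasurable).trans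
            (mul_le_mul_right (dual _ (Finset.filter_subset _ _)) _)
      _ = _ := by ring
  calc _ ≤ (4 * ∑ m ∈ P, 2 ^ m * ∫⁻ y, u m y * D m y ∂σ) ^ 2 := by gcongr
    _ = 16 * (∑ m ∈ P, 2 ^ m * ∫⁻ y, u m y * D m y ∂σ) ^ 2 := by rw [mul_pow]; norm_num
    _ ≤ 16 * ((∑ k ∈ 𝒦.image n, 4 ^ k * σ (levelSet 𝒦 n k)) *
        (2 * A * ∑ t ∈ 𝒮, e t * T t ^ 2)) := by
      gcongr
      exact h5.trans (mul_le_mul' h3 h4)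
    _ = _ := by ring

open Classical in
lemma sum_sq_le_of_testing_of_ne_zero (hmeas : ∀ K ∈ 𝒦, MeasurableSet K)
    (hlam : ∀ K ∈ 𝒦, ∀ K' ∈ 𝒦, K ⊆ K' ∨ K' ⊆ K ∨ Disjoint K K') (hfin : ∀ K ∈ 𝒦, σ K ≠ ∞)
    (hB : ∀ t ∈ 𝒮, (B t).Nonempty) (he : ∀ t ∈ 𝒮, e t ≠ ∞) (hlamtop : ∀ K, lam K ≠ ∞)
    (hh : AEMeasurable h σ)
    (h0 : ∀ K ∈ 𝒦, ∫⁻ y in K, h y ∂σ ≠ 0) (htop : ∀ K ∈ 𝒦, ∫⁻ y in K, h y ∂σ ≠ ∞)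
    (fwd : ∀ H ∈ 𝒦, ∑ t ∈ 𝒮 with B t ⊆ H,
      e t * (∑ K ∈ 𝒦 with B t ⊆ K ∧ K ⊆ H, lam K * σ K) ^ 2 ≤ A * σ H)
    (dual : ∀ E ⊆ 𝒮, ∫⁻ y, (∑ t ∈ E, e t * ∑ K ∈ 𝒦 with B t ⊆ K,
      lam K * K.indicator 1 y) ^ 2 ∂σ ≤ A * ∑ t ∈ E, e t) :
    ∑ t ∈ 𝒮, e t * (∑ K ∈ 𝒦 with B t ⊆ K, lam K * ∫⁻ y in K, h y ∂σ) ^ 2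
      ≤ 2400 * A * ∫⁻ y, h y ^ 2 ∂σ := by
  obtain ⟨n, hn⟩ := exists_isLevel σ h 𝒦 hfin h0 htop
  set a : Set Y → ℝ≥0∞ := fun K => lam K * ∫⁻ y in K, h y ∂σ with ha
  set S := ∑ k ∈ 𝒦.image n, (4 : ℝ≥0∞) ^ k * σ (levelSet 𝒦 n k) with hS
  set X := ∑ t ∈ 𝒮, e t * (∑ K ∈ 𝒦 with B t ⊆ K, a K) ^ 2 with hX
  set V := ∑ K ∈ 𝒦, a K * upperPart σ h 𝒦 n lam K * ∑ t ∈ 𝒮 with B t ⊆ K, e t with hV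
  have hXtop : X ≠ ∞ := by
    refine ENNReal.sum_ne_top.2 fun t ht => ENNReal.mul_ne_top (he t ht) (ENNReal.pow_ne_top ?_)
    refine ENNReal.sum_ne_top.2 fun K hK => ENNReal.mul_ne_top (hlamtop K) (htop K ?_)
    exact (Finset.mem_filter.1 hK).1
  have hsame : ∑ t ∈ 𝒮, e t * ∑ k ∈ 𝒦.image n, (∑ K ∈ 𝒦 with B t ⊆ K ∧ n K = k, a K) ^ 2
      ≤ 4 * A * S := by
    calc ∑ t ∈ 𝒮, e t * ∑ k ∈ 𝒦.image n, (∑ K ∈ 𝒦 with B t ⊆ K ∧ n K = k, a K) ^ 2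
        ≤ ∑ t ∈ 𝒮, e t * ∑ k ∈ 𝒦.image n,
          4 * 4 ^ k * (∑ K ∈ 𝒦 with B t ⊆ K ∧ n K = k, lam K * σ K) ^ 2 := by
          gcongr with t ht k hk
          have : (4 : ℝ≥0∞) * 4 ^ k = (2 * 2 ^ k) ^ 2 := by
            rw [mul_pow, two_zpow_sq]; norm_num
          rw [this, ← mul_pow, Finset.mul_sum]
          gcongr with K hK
          have hK' := Finset.mem_filter.1 hK
          have := hn.le K hK'.1
          rw [hK'.2.2, ENNReal.zpow_add two_ne_zero (by norm_num), zpow_one] at this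
          calc a K ≤ lam K * (2 ^ k * 2 * σ K) := by simp only [a]; gcongr
            _ = _ := by ring
      _ = ∑ k ∈ 𝒦.image n, 4 * 4 ^ k *
          ∑ t ∈ 𝒮, e t * (∑ K ∈ 𝒦 with B t ⊆ K ∧ n K = k, lam K * σ K) ^ 2 := by
          simp only [Finset.mul_sum]
          rw [Finset.sum_comm]
          refine Finset.sum_congr rfl fun k _ => Finset.sum_congr rfl fun t _ => ?_
          ring
      _ ≤ ∑ k ∈ 𝒦.image n, 4 * 4 ^ k * (A * σ (levelSet 𝒦 n k)) := by
          gcongr with k hk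
          exact sum_level_sq_le hmeas hlam hB fwd k
      _ = 4 * A * S := by
          rw [hS, Finset.mul_sum]
          refine Finset.sum_congr rfl fun k _ => ?_
          ring
  have hlow : ∑ t ∈ 𝒮, e t * ∑ K ∈ 𝒦 with B t ⊆ K,
      a K * ∑ K' ∈ 𝒦 with B t ⊆ K' ∧ n K' < n K, a K' ≤ V := by
    calc _ ≤ ∑ t ∈ 𝒮, e t * ∑ K ∈ 𝒦 with B t ⊆ K, a K * upperPart σ h 𝒦 n lam K := by
          gcongr with t ht K hK
          refine Finset.sum_le_sum_of_subset fun K' hK' => ?_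
          have h1 := Finset.mem_filter.1 hK
          have h2 := Finset.mem_filter.1 hK'
          refine Finset.mem_filter.2 ⟨h2.1, ?_, h2.2.2⟩
          rcases hlam K h1.1 K' h2.1 with h3 | h3 | h3
          · exact h3
          · have := hn.anti K' h2.1 K h1.1 h3
            omega
          · obtain ⟨y, hy⟩ := hB t ht
            exact absurd (h2.2.1 hy) (disjoint_left.1 h3 (h1.2 hy))
      _ = V := by
          simp only [hV, Finset.mul_sum, Finset.sum_filter]
          rw [Finset.sum_comm]
          refine Finset.sum_congr rfl fun K _ => Finset.sum_congr rfl fun t _ => ?_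
          split_ifs
          · ring
          · simp
  have hXle : X ≤ 8 * A * S + 2 * V := by
    have h1 : ∀ t ∈ 𝒮, (∑ K ∈ 𝒦 with B t ⊆ K, a K) ^ 2 ≤
        2 * (∑ k ∈ 𝒦.image n, (∑ K ∈ 𝒦 with B t ⊆ K ∧ n K = k, a K) ^ 2 +
          ∑ K ∈ 𝒦 with B t ⊆ K, a K * ∑ K' ∈ 𝒦 with B t ⊆ K' ∧ n K' < n K, a K') := by
      intro t _
      refine (sum_sq_le_two_mul_sum_le _ a n).trans (le_of_eq ?_)
      congr 1
      have e1 : ∀ K, ∑ K' ∈ (𝒦.filter fun K => B t ⊆ K) with n K' ≤ n K, a K' =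
          ∑ K' ∈ 𝒦 with B t ⊆ K' ∧ n K' = n K, a K' +
            ∑ K' ∈ 𝒦 with B t ⊆ K' ∧ n K' < n K, a K' := by
        intro K
        rw [← Finset.sum_union]
        · refine Finset.sum_congr ?_ fun _ _ => rfl
          ext K'
          simp only [Finset.mem_filter, Finset.mem_union]
          have : n K' ≤ n K ↔ n K' = n K ∨ n K' < n K := by omega
          rw [this]
          tauto
        · rw [Finset.disjoint_filter]
          rintro K' _ ⟨_, h2⟩ ⟨_, h3⟩
          omega
      simp only [e1, mul_add, Finset.sum_add_distrib]
      congr 1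
      rw [← Finset.sum_fiberwise_of_maps_to (t := 𝒦.image n) (g := n)
        fun K hK => Finset.mem_image_of_mem n (Finset.mem_filter.1 hK).1]
      refine Finset.sum_congr rfl fun k _ => ?_
      rw [sq, Finset.sum_mul, Finset.filter_filter]
      refine Finset.sum_congr rfl fun K hK => ?_
      rw [(Finset.mem_filter.1 hK).2.2]
    calc X ≤ ∑ t ∈ 𝒮, e t * (2 * (∑ k ∈ 𝒦.image n, (∑ K ∈ 𝒦 with B t ⊆ K ∧ n K = k, a K) ^ 2 +
          ∑ K ∈ 𝒦 with B t ⊆ K, a K * ∑ K' ∈ 𝒦 with B t ⊆ K' ∧ n K' < n K, a K')) := by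
          simp only [hX]
          gcongr with t ht
          exact h1 t ht
      _ = 2 * (∑ t ∈ 𝒮, e t * ∑ k ∈ 𝒦.image n, (∑ K ∈ 𝒦 with B t ⊆ K ∧ n K = k, a K) ^ 2 +
          ∑ t ∈ 𝒮, e t * ∑ K ∈ 𝒦 with B t ⊆ K,
            a K * ∑ K' ∈ 𝒦 with B t ⊆ K' ∧ n K' < n K, a K') := by
          rw [← Finset.sum_add_distrib, Finset.mul_sum]
          refine Finset.sum_congr rfl fun t _ => ?_
          ring
      _ ≤ 2 * (4 * A * S + V) := by gcongr
      _ = _ := by ring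
  have hVsq : V ^ 2 ≤ 32 * A * S * X :=
    sum_upperPart_sq_le hmeas hlam hn hlamtop htop dual
  have hXS : X ≤ (600 : ℝ≥0) * (A * S) := by
    refine le_of_le_mul_sqrt (by norm_num) hXtop ?_
    by_cases hR : X ≤ A * S
    · exact Or.inr hR
    · left
      have hR' := (not_le.1 hR).le
      calc X ^ 2 ≤ (8 * A * S + 2 * V) ^ 2 := by gcongr
        _ ≤ 2 * ((8 * A * S) ^ 2 + (2 * V) ^ 2) := add_sq_le_two_mul _ _
        _ = 2 * (64 * (A * S) * (A * S) + 4 * V ^ 2) := by ring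
        _ ≤ 2 * (64 * (A * S) * X + 4 * (32 * A * S * X)) := by gcongr
        _ = 384 * (A * S) * X := by ring
        _ ≤ _ := by
          gcongr
          norm_num
  calc X ≤ (600 : ℝ≥0) * (A * S) := hXS
    _ ≤ (600 : ℝ≥0) * (A * (4 * ∫⁻ y, h y ^ 2 ∂σ)) := by
      gcongr
      exact hn.sum_levelSet_le hmeas hlam hfin hh
    _ = _ := by push_cast; ring

open Classical in
/-- Testing for a positive dyadic operator `h ↦ ∑ λ_K ∫_K h dσ`, the sum over the members `K` of a
finite family of nested or disjoint sets containing a given set `B t`. If the forward testing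
inequality holds for the members of the family and the dual one for all sets of indices, then the
operator is bounded from `L²(σ)` to `ℓ²(e)`. -/
theorem sum_sq_le_of_testing (hmeas : ∀ K ∈ 𝒦, MeasurableSet K)
    (hlam : ∀ K ∈ 𝒦, ∀ K' ∈ 𝒦, K ⊆ K' ∨ K' ⊆ K ∨ Disjoint K K') (hfin : ∀ K ∈ 𝒦, σ K ≠ ∞)
    (hB : ∀ t ∈ 𝒮, (B t).Nonempty) (he : ∀ t ∈ 𝒮, e t ≠ ∞) (hlamtop : ∀ K, lam K ≠ ∞)
    (hh : AEMeasurable h σ) (htop : ∀ K ∈ 𝒦, ∫⁻ y in K, h y ∂σ ≠ ∞)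
    (fwd : ∀ H ∈ 𝒦, ∑ t ∈ 𝒮 with B t ⊆ H,
      e t * (∑ K ∈ 𝒦 with B t ⊆ K ∧ K ⊆ H, lam K * σ K) ^ 2 ≤ A * σ H)
    (dual : ∀ E ⊆ 𝒮, ∫⁻ y, (∑ t ∈ E, e t * ∑ K ∈ 𝒦 with B t ⊆ K,
      lam K * K.indicator 1 y) ^ 2 ∂σ ≤ A * ∑ t ∈ E, e t) :
    ∑ t ∈ 𝒮, e t * (∑ K ∈ 𝒦 with B t ⊆ K, lam K * ∫⁻ y in K, h y ∂σ) ^ 2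
      ≤ 2400 * A * ∫⁻ y, h y ^ 2 ∂σ := by
  -- the members on which `h` vanishes do not contribute
  set 𝒦' := 𝒦.filter fun K => ∫⁻ y in K, h y ∂σ ≠ 0 with h𝒦'
  have hsub : 𝒦' ⊆ 𝒦 := Finset.filter_subset _ _
  have e1 : ∀ t ∈ 𝒮, ∑ K ∈ 𝒦 with B t ⊆ K, lam K * ∫⁻ y in K, h y ∂σ =
      ∑ K ∈ 𝒦' with B t ⊆ K, lam K * ∫⁻ y in K, h y ∂σ := by
    intro t _
    refine (Finset.sum_subset (Finset.filter_subset_filter _ hsub) fun K hK hK' => ?_).symm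
    have h1 := Finset.mem_filter.1 hK
    have : ∫⁻ y in K, h y ∂σ = 0 := by
      by_contra h0
      exact hK' (Finset.mem_filter.2 ⟨Finset.mem_filter.2 ⟨h1.1, h0⟩, h1.2⟩)
    rw [this, mul_zero]
  rw [Finset.sum_congr rfl fun t ht => by rw [e1 t ht]]
  refine sum_sq_le_of_testing_of_ne_zero (fun K hK => hmeas K (hsub hK))
    (fun K hK K' hK' => hlam K (hsub hK) K' (hsub hK')) (fun K hK => hfin K (hsub hK)) hB he
    hlamtop hh (fun K hK => (Finset.mem_filter.1 hK).2) (fun K hK => htop K (hsub hK)) ?_ ?_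
  · intro H hH
    refine le_trans ?_ (fwd H (hsub hH))
    gcongr
  · intro E hE
    refine le_trans (lintegral_mono fun y => ?_) (dual E hE)
    simp only
    gcongr

end Dyadic

/-! ### The Poisson kernel -/

lemma coe_eq_Icc (I : Interval) : (I : Set ℝ) = Icc I.fst I.snd := rfl

lemma length_eq (I : Interval) : I.length = I.snd - I.fst := rfl

lemma le_iff (I J : Interval) : I ≤ J ↔ J.fst ≤ I.fst ∧ I.snd ≤ J.snd := Iff.rfl

lemma coe_subset {I J : Interval} (h : I ≤ J) : (I : Set ℝ) ⊆ J := Icc_subset_Icc h.1 h.2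

lemma nonempty_coe (I : Interval) : (I : Set ℝ).Nonempty := ⟨I.fst, le_rfl, I.fst_le_snd⟩

lemma measurableSet_coe (I : Interval) : MeasurableSet (I : Set ℝ) := measurableSet_Icc

lemma length_nonneg (I : Interval) : 0 ≤ I.length := sub_nonneg.2 I.fst_le_snd

lemma length_mono {I J : Interval} (h : I ≤ J) : I.length ≤ J.length := by
  rw [length_eq, length_eq]
  have := (le_iff I J).1 h
  linarith

lemma abs_sub_le_length {I : Interval} {x y : ℝ} (hx : x ∈ (I : Set ℝ)) (hy : y ∈ (I : Set ℝ)) :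
    |x - y| ≤ I.length := by
  rw [coe_eq_Icc] at hx hy
  rw [length_eq, abs_le]
  constructor <;> linarith [hx.1, hx.2, hy.1, hy.2]

lemma infDist_le_abs {I : Interval} {x y : ℝ} (hx : x ∈ (I : Set ℝ)) :
    Metric.infDist y (I : Set ℝ) ≤ |y - x| := Metric.infDist_le_dist_of_mem hx

lemma abs_sub_le_infDist {I : Interval} {x y : ℝ} (hx : x ∈ (I : Set ℝ)) :
    |y - x| ≤ I.length + Metric.infDist y (I : Set ℝ) := by
  obtain ⟨z, hz, hzd⟩ := (isCompact_Icc : IsCompact (Icc I.fst I.snd)).exists_infDist_eq_dist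
    (nonempty_coe I) y
  rw [coe_eq_Icc, hzd, Real.dist_eq]
  have h1 := abs_sub_le_length hz hx
  calc |y - x| ≤ |y - z| + |z - x| := abs_sub_le _ _ _
    _ ≤ _ := by linarith

/-- The kernel `(|J| + dist(y, J))⁻²`, so that `P(ν, J) = |J| ∫ kern J dν`. -/
noncomputable def kern (J : Interval) (y : ℝ) : ℝ≥0∞ :=
  ENNReal.ofReal (1 / (J.length + Metric.infDist y (J : Set ℝ)) ^ 2)

lemma measurable_kern (J : Interval) : Measurable (kern J) := by
  unfold kern
  refine ENNReal.measurable_ofReal.comp ?_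
  have : Measurable fun y : ℝ => Metric.infDist y (J : Set ℝ) :=
    (Metric.continuous_infDist_pt _).measurable
  fun_prop

lemma poisson_eq (ν : Measure ℝ) (J : Interval) :
    poisson ν J = ENNReal.ofReal J.length * ∫⁻ y, kern J y ∂ν := by
  rw [poisson, ← lintegral_const_mul _ (measurable_kern J)]
  refine lintegral_congr fun y => ?_
  rw [kern, ← ENNReal.ofReal_mul (length_nonneg J)]
  congr 1
  ring

lemma kern_le_mul {I J : Interval} {x y c : ℝ} (hc : 0 < c) (hI : 0 < I.length)
    (h : I.length + Metric.infDist x (I : Set ℝ) ≤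
      c * (J.length + Metric.infDist y (J : Set ℝ))) :
    kern J y ≤ ENNReal.ofReal (c ^ 2) * kern I x := by
  rw [kern, kern, ← ENNReal.ofReal_mul (by positivity)]
  refine ENNReal.ofReal_le_ofReal ?_
  have h1 : 0 < I.length + Metric.infDist x (I : Set ℝ) :=
    add_pos_of_pos_of_nonneg hI Metric.infDist_nonneg
  have h2 : 0 < J.length + Metric.infDist y (J : Set ℝ) := by
    by_contra h0
    have := mul_nonpos_of_nonneg_of_nonpos hc.le (not_lt.1 h0)
    linarith
  rw [mul_one_div, div_le_div_iff₀ (by positivity) (by positivity), one_mul, ← mul_pow]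
  gcongr

lemma kern_of_mem {J : Interval} {y : ℝ} (hy : y ∈ (J : Set ℝ)) :
    kern J y = ENNReal.ofReal (1 / J.length ^ 2) := by
  rw [kern, Metric.infDist_zero_of_mem hy, add_zero]

lemma kern_le (J : Interval) (hJ : 0 < J.length) (y : ℝ) :
    kern J y ≤ ENNReal.ofReal (1 / J.length ^ 2) := by
  rw [kern]
  refine ENNReal.ofReal_le_ofReal ?_
  have := Metric.infDist_nonneg (x := y) (s := (J : Set ℝ))
  gcongr
  linarith

lemma measure_coe_lt_top (μ : Measure ℝ) [IsLocallyFiniteMeasure μ] (I : Interval) :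
    μ (I : Set ℝ) < ∞ := isCompact_Icc.measure_lt_top

lemma setLIntegral_kern_ne_top (μ : Measure ℝ) [IsLocallyFiniteMeasure μ] (I J : Interval)
    (hJ : 0 < J.length) {s : Set ℝ} (hs : s ⊆ I) : ∫⁻ y in s, kern J y ∂μ ≠ ∞ := by
  refine ne_top_of_le_ne_top ?_ ((lintegral_mono (kern_le J hJ)).trans_eq (lintegral_const _))
  refine ENNReal.mul_ne_top ENNReal.ofReal_ne_top ?_
  rw [Measure.restrict_apply_univ]
  exact ne_top_of_le_ne_top (measure_coe_lt_top μ I).ne (measure_mono hs)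

/-- The measure has no mass at the endpoints of the interval. -/
def NullEnds (μ : Measure ℝ) (L : Interval) : Prop := μ {L.fst} = 0 ∧ μ {L.snd} = 0

/-- Two intervals have no common interior points. -/
def Nonoverlapping (L M : Interval) : Prop := Disjoint (Ioo L.fst L.snd) (Ioo M.fst M.snd)

lemma NullEnds.ae_eq {μ : Measure ℝ} {L : Interval} (h : NullEnds μ L) :
    (L : Set ℝ) =ᵐ[μ] Ioo L.fst L.snd := (Ioo_ae_eq_Icc' h.1 h.2).symm

lemma sum_setLIntegral_le {ι : Type*} {μ : Measure ℝ} {Z : Finset ι} {L : ι → Interval}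
    {s : Set ℝ} (hs : ∀ i ∈ Z, (L i : Set ℝ) ⊆ s) (hn : ∀ i ∈ Z, NullEnds μ (L i))
    (hd : (Z : Set ι).Pairwise fun i j => Nonoverlapping (L i) (L j)) (f : ℝ → ℝ≥0∞) :
    ∑ i ∈ Z, ∫⁻ x in (L i : Set ℝ), f x ∂μ ≤ ∫⁻ x in s, f x ∂μ := by
  calc ∑ i ∈ Z, ∫⁻ x in (L i : Set ℝ), f x ∂μ
      = ∑ i ∈ Z, ∫⁻ x in Ioo (L i).fst (L i).snd, f x ∂μ :=
        Finset.sum_congr rfl fun i hi => setLIntegral_congr (hn i hi).ae_eq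
    _ = ∫⁻ x in ⋃ i ∈ Z, Ioo (L i).fst (L i).snd, f x ∂μ :=
        (lintegral_biUnion_finset hd (fun i _ => measurableSet_Ioo) f).symm
    _ ≤ _ := lintegral_mono_set (iUnion₂_subset fun i hi => Ioo_subset_Icc_self.trans (hs i hi))

lemma sum_measure_le {ι : Type*} {μ : Measure ℝ} {Z : Finset ι} {L : ι → Interval}
    {s : Set ℝ} (hs : ∀ i ∈ Z, (L i : Set ℝ) ⊆ s) (hn : ∀ i ∈ Z, NullEnds μ (L i))
    (hd : (Z : Set ι).Pairwise fun i j => Nonoverlapping (L i) (L j)) :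
    ∑ i ∈ Z, μ (L i : Set ℝ) ≤ μ s := by
  simpa using sum_setLIntegral_le hs hn hd (fun _ => 1)

/-! ### The energy inequality -/

/-- A function that increases with slope at least `Q` on an interval is at least `Q` times the
distance to one of its points. -/
lemma exists_abs_sub_le {f : ℝ → ℝ} {Q p q : ℝ} (hQ : 0 ≤ Q) (hpq : p ≤ q)
    (hf : ∀ x ∈ Icc p q, ∀ x' ∈ Icc p q, x ≤ x' → Q * (x' - x) ≤ f x' - f x) :
    ∃ c ∈ Icc p q, ∀ x ∈ Icc p q, Q * |x - c| ≤ |f x| := by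
  set S := {x ∈ Icc p q | f x ≤ 0} with hS
  -- `c` is the point where `f` changes sign
  rcases S.eq_empty_or_nonempty with h0 | h0
  · refine ⟨p, ⟨le_rfl, hpq⟩, fun x hx => ?_⟩
    have hp : 0 < f p := by
      by_contra h
      exact h0.subset ⟨⟨le_rfl, hpq⟩, not_lt.1 h⟩
    have := hf p ⟨le_rfl, hpq⟩ x hx hx.1
    rw [abs_of_nonneg (sub_nonneg.2 hx.1)]
    exact (by linarith : Q * (x - p) ≤ f x).trans (le_abs_self _)
  · have hbdd : BddAbove S := ⟨q, fun x hx => hx.1.2⟩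
    obtain ⟨z, hz⟩ := h0
    have hcz := le_csSup hbdd hz
    have hcq : sSup S ≤ q := csSup_le ⟨z, hz⟩ fun x hx => hx.1.2
    refine ⟨sSup S, ⟨hz.1.1.trans hcz, hcq⟩, fun x hx => ?_⟩
    rcases le_total (sSup S) x with h | h
    · rw [abs_of_nonneg (sub_nonneg.2 h)]
      refine le_of_forall_pos_le_add fun η hη => ?_
      rcases h.eq_or_lt with h' | h'
      · rw [h', sub_self, mul_zero]; positivity
      set t := min x (sSup S + η / (Q + 1)) with ht
      have htc : sSup S < t := lt_min h' (lt_add_of_pos_right _ (by positivity))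
      have htx : t ≤ x := min_le_left _ _
      have htI : t ∈ Icc p q := ⟨(hz.1.1.trans hcz).trans htc.le, htx.trans hx.2⟩
      have hft : 0 < f t := by
        by_contra h1
        exact absurd (le_csSup hbdd ⟨htI, not_lt.1 h1⟩) (not_le.2 htc)
      have h2 := hf t htI x hx htx
      have h3 : t ≤ sSup S + η / (Q + 1) := min_le_right _ _
      have h4 : Q * (t - sSup S) ≤ η := by
        calc Q * (t - sSup S) ≤ (Q + 1) * (η / (Q + 1)) := by
              apply mul_le_mul <;> linarith
          _ = η := by field_simp
      have := le_abs_self (f x)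
      nlinarith
    · rw [abs_of_nonpos (sub_nonpos.2 h)]
      refine le_of_forall_pos_le_add fun η hη => ?_
      rcases h.eq_or_lt with h' | h'
      · rw [← h', sub_self, neg_zero, mul_zero]; positivity
      obtain ⟨t, htS, ht⟩ := exists_lt_of_lt_csSup ⟨z, hz⟩
        (max_lt h' (sub_lt_self (sSup S) (by positivity : 0 < η / (Q + 1))))
      have h2 := hf x hx t htS.1 ((le_max_left _ _).trans ht.le)
      have h3 : sSup S - η / (Q + 1) ≤ t := (le_max_right _ _).trans ht.le
      have h4 : Q * (sSup S - t) ≤ η := by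
        calc Q * (sSup S - t) ≤ (Q + 1) * (η / (Q + 1)) := by
              apply mul_le_mul
              · linarith
              · linarith
              · exact sub_nonneg.2 (le_csSup hbdd htS)
              · linarith
          _ = η := by field_simp
      have := neg_abs_le (f x)
      have := htS.2
      nlinarith

lemma measurableSet_annulus (α β x : ℝ) : MeasurableSet {y : ℝ | α < |x - y| ∧ |x - y| < β} := by
  have h1 : MeasurableSet {y : ℝ | α < |x - y|} := measurableSet_lt (by fun_prop) (by fun_prop)
  have h2 : MeasurableSet {y : ℝ | |x - y| < β} := measurableSet_lt (by fun_prop) (by fun_prop)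
  exact h1.inter h2

lemma measurable_hilbert (α β : ℝ) (ν : Measure ℝ) [SFinite ν] : Measurable (hilbert α β ν) := by
  have hs : MeasurableSet {p : ℝ × ℝ | α < |p.1 - p.2| ∧ |p.1 - p.2| < β} := by
    have h1 : MeasurableSet {p : ℝ × ℝ | α < |p.1 - p.2|} :=
      measurableSet_lt (by fun_prop) (by fun_prop)
    have h2 : MeasurableSet {p : ℝ × ℝ | |p.1 - p.2| < β} :=
      measurableSet_lt (by fun_prop) (by fun_prop)
    exact h1.inter h2
  have h : Measurable
      ({p : ℝ × ℝ | α < |p.1 - p.2| ∧ |p.1 - p.2| < β}.indicator fun p => 1 / (p.2 - p.1)) :=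
    Measurable.indicator (by fun_prop) hs
  have h2 := (h.stronglyMeasurable.integral_prod_right' (ν := ν)).measurable
  convert h2 using 2 with x
  rw [hilbert, ← integral_indicator (measurableSet_annulus α β x)]
  rfl

lemma integrable_hilbert_kernel {α β : ℝ} (hα : 0 < α) (ν : Measure ℝ) [IsFiniteMeasure ν]
    (x : ℝ) : IntegrableOn (fun y => 1 / (y - x)) {y : ℝ | α < |x - y| ∧ |x - y| < β} ν := by
  have hm := measurableSet_annulus α β x
  refine Measure.integrableOn_of_bounded (M := 1 / α) (measure_ne_top _ _)
    (Measurable.aestronglyMeasurable (by fun_prop)) ?_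
  filter_upwards [ae_restrict_mem hm] with y hy
  rw [Real.norm_eq_abs, abs_div, abs_one, abs_sub_comm]
  exact one_div_le_one_div_of_le hα hy.1.le

lemma hilbert_add {α β : ℝ} (hα : 0 < α) (μ ν : Measure ℝ) [IsFiniteMeasure μ]
    [IsFiniteMeasure ν] (x : ℝ) : hilbert α β (μ + ν) x = hilbert α β μ x + hilbert α β ν x := by
  rw [hilbert, Measure.restrict_add, integral_add_measure]
  · rfl
  · exact integrable_hilbert_kernel hα μ x
  · exact integrable_hilbert_kernel hα ν x

/-- At distance more than `α` from the boundary of `L`, the truncations do not affect the Hilbert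
transform of the measure outside `L`. -/
lemma hilbert_restrict_diff {σ : Measure ℝ} {I L : Interval} (hLI : L ≤ I) {α β δ x : ℝ}
    (hα : α ≤ δ) (hβ : I.length < β) (hx : x ∈ Icc (L.fst + δ) (L.snd - δ)) (hδ : 0 < δ) :
    hilbert α β (σ.restrict ((I : Set ℝ) \ L)) x = ∫ y in (I : Set ℝ) \ L, 1 / (y - x) ∂σ := by
  rw [hilbert, Measure.restrict_restrict (measurableSet_annulus α β x)]
  congr 2
  refine inter_eq_right.2 fun y hy => ?_
  have hxI : x ∈ (I : Set ℝ) := coe_subset hLI ⟨by linarith [hx.1], by linarith [hx.2]⟩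
  refine ⟨?_, (abs_sub_le_length hxI hy.1).trans_lt hβ⟩
  have hy2 : ¬ (L.fst ≤ y ∧ y ≤ L.snd) := hy.2
  rw [lt_abs]
  by_contra h
  push Not at h
  exact hy2 ⟨by linarith [hx.1, h.1], by linarith [hx.2, h.2]⟩

/-- Off `L`, the Hilbert transform increases on `L` with slope at least the integral of the kernel
of `L`. -/
lemma slope_hilbert {σ : Measure ℝ} [IsLocallyFiniteMeasure σ] {I L : Interval} (hLI : L ≤ I)
    (hL : 0 < L.length) {α β δ : ℝ} (hα0 : 0 < α)
    (hα : α ≤ δ) (hβ : I.length < β) {x x' : ℝ} (hx : x ∈ Icc (L.fst + δ) (L.snd - δ))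
    (hx' : x' ∈ Icc (L.fst + δ) (L.snd - δ)) (hxx' : x ≤ x') :
    (∫⁻ y in (I : Set ℝ) \ L, kern L y ∂σ).toReal * (x' - x) ≤
      hilbert α β (σ.restrict ((I : Set ℝ) \ L)) x' -
        hilbert α β (σ.restrict ((I : Set ℝ) \ L)) x := by
  have hδ : 0 < δ := hα0.trans_le hα
  have hms : MeasurableSet ((I : Set ℝ) \ L) := (measurableSet_coe I).diff (measurableSet_coe L)
  have hfin : σ ((I : Set ℝ) \ L) ≠ ∞ :=
    ne_top_of_le_ne_top (measure_coe_lt_top σ I).ne (measure_mono sdiff_subset)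
  have hgap : ∀ z ∈ Icc (L.fst + δ) (L.snd - δ), ∀ y ∈ (I : Set ℝ) \ L, δ ≤ |y - z| := by
    intro z hz y hy
    have hy2 : ¬ (L.fst ≤ y ∧ y ≤ L.snd) := hy.2
    rw [le_abs]
    by_contra h
    push Not at h
    exact hy2 ⟨by linarith [hz.1, h.2], by linarith [hz.2, h.1]⟩
  have hint : ∀ z ∈ Icc (L.fst + δ) (L.snd - δ),
      IntegrableOn (fun y => 1 / (y - z)) ((I : Set ℝ) \ L) σ := by
    intro z hz
    refine Measure.integrableOn_of_bounded (M := 1 / δ) hfin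
      (Measurable.aestronglyMeasurable (by fun_prop)) ?_
    filter_upwards [ae_restrict_mem hms] with y hy
    rw [Real.norm_eq_abs, abs_div, abs_one]
    exact one_div_le_one_div_of_le hδ (hgap z hz y hy)
  rw [hilbert_restrict_diff hLI hα hβ hx hδ, hilbert_restrict_diff hLI hα hβ hx' hδ,
    ← integral_sub (hint x' hx') (hint x hx)]
  have hmd : Measurable fun y : ℝ => 1 / (L.length + Metric.infDist y (L : Set ℝ)) ^ 2 := by
    have : Measurable fun y : ℝ => Metric.infDist y (L : Set ℝ) :=
      (Metric.continuous_infDist_pt _).measurable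
    fun_prop
  have hki : IntegrableOn (fun y => 1 / (L.length + Metric.infDist y (L : Set ℝ)) ^ 2)
      ((I : Set ℝ) \ L) σ := by
    refine Measure.integrableOn_of_bounded (M := 1 / L.length ^ 2) hfin
      hmd.aestronglyMeasurable ?_
    refine Eventually.of_forall fun y => ?_
    have := Metric.infDist_nonneg (x := y) (s := (L : Set ℝ))
    rw [Real.norm_eq_abs, abs_of_nonneg (by positivity)]
    gcongr
    linarith
  have hQ : (∫⁻ y in (I : Set ℝ) \ L, kern L y ∂σ).toReal =
      ∫ y in (I : Set ℝ) \ L, 1 / (L.length + Metric.infDist y (L : Set ℝ)) ^ 2 ∂σ := by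
    rw [integral_eq_lintegral_of_nonneg_ae]
    · rfl
    · exact Eventually.of_forall fun y => by positivity
    · exact hmd.aestronglyMeasurable
  rw [hQ, ← integral_mul_const]
  refine setIntegral_mono_on (hki.mul_const _) ((hint x' hx').sub (hint x hx)) hms fun y hy => ?_
  have hzL : ∀ z ∈ Icc (L.fst + δ) (L.snd - δ), z ∈ (L : Set ℝ) := fun z hz =>
    ⟨by linarith [hz.1], by linarith [hz.2]⟩
  have h1 := abs_sub_le_infDist (y := y) (hzL x hx)
  have h2 := abs_sub_le_infDist (y := y) (hzL x' hx')
  have h3 := hgap x hx y hy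
  have h4 := hgap x' hx' y hy
  have hne : y - x ≠ 0 := fun h => by rw [h, abs_zero] at h3; linarith
  have hne' : y - x' ≠ 0 := fun h => by rw [h, abs_zero] at h4; linarith
  have hpos : 0 < (y - x) * (y - x') := by
    have hy2 : ¬ (L.fst ≤ y ∧ y ≤ L.snd) := hy.2
    rcases lt_or_ge y L.fst with h5 | h5
    · exact mul_pos_of_neg_of_neg (by linarith [hx.1]) (by linarith [hx'.1])
    · have h6 : L.snd < y := by
        by_contra h
        exact hy2 ⟨h5, not_lt.1 h⟩
      exact mul_pos (by linarith [hx.2]) (by linarith [hx'.2])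
  have e1 : 1 / (y - x') - 1 / (y - x) = 1 / ((y - x) * (y - x')) * (x' - x) := by
    field_simp
    ring
  rw [e1]
  refine mul_le_mul_of_nonneg_right (one_div_le_one_div_of_le hpos ?_) (sub_nonneg.2 hxx')
  rw [← abs_of_pos hpos, abs_mul, sq]
  exact mul_le_mul h1 h2 (abs_nonneg _) ((abs_nonneg _).trans h1)

lemma measure_le_poisson (μ : Measure ℝ) {L : Interval} (hL : 0 < L.length) :
    μ (L : Set ℝ) ≤ ENNReal.ofReal L.length * poisson μ L := by
  rw [poisson_eq, ← mul_assoc, ← ENNReal.ofReal_mul hL.le]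
  calc μ (L : Set ℝ) = ∫⁻ y in (L : Set ℝ), 1 ∂μ := by simp
    _ = ∫⁻ y in (L : Set ℝ), ENNReal.ofReal (L.length * L.length) * kern L y ∂μ := by
      refine setLIntegral_congr_fun (measurableSet_coe L) fun y hy => ?_
      rw [kern_of_mem hy, ← ENNReal.ofReal_mul (by positivity)]
      rw [show L.length * L.length * (1 / L.length ^ 2) = 1 by field_simp, ENNReal.ofReal_one]
    _ ≤ ∫⁻ y, ENNReal.ofReal (L.length * L.length) * kern L y ∂μ := setLIntegral_le_lintegral _ _
    _ = _ := lintegral_const_mul _ (measurable_kern L)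

lemma poisson_mul_poisson_le (σ w : Measure ℝ) {L : Interval} (hL : 0 < L.length) :
    poisson σ L * poisson w L ≤ A2Const σ w :=
  le_iSup₂_of_le (f := fun (I : Interval) (_ : 0 < I.length) =>
    poisson σ I * poisson w I) L hL le_rfl

lemma A2_measure_le {σ w : Measure ℝ} {L : Interval} (hL : 0 < L.length) :
    σ (L : Set ℝ) * w (L : Set ℝ) ≤ A2Const σ w * ENNReal.ofReal (L.length ^ 2) := by
  calc σ (L : Set ℝ) * w (L : Set ℝ)
      ≤ (ENNReal.ofReal L.length * poisson σ L) * (ENNReal.ofReal L.length * poisson w L) :=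
        mul_le_mul' (measure_le_poisson σ hL) (measure_le_poisson w hL)
    _ = (poisson σ L * poisson w L) * ENNReal.ofReal (L.length ^ 2) := by
        rw [sq, ENNReal.ofReal_mul hL.le]; ring
    _ ≤ _ := by
        gcongr
        exact poisson_mul_poisson_le σ w hL

/-- The interval `[a + δ, b - δ]` inside `[a, b]`. -/
def shrink (L : Interval) (δ : ℝ) : Set ℝ := Icc (L.fst + δ) (L.snd - δ)

lemma shrink_subset (L : Interval) {δ : ℝ} (hδ : 0 ≤ δ) : shrink L δ ⊆ (L : Set ℝ) :=
  Icc_subset_Icc (by linarith) (by linarith)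

lemma tendsto_measure_diff_shrink {w : Measure ℝ} [IsLocallyFiniteMeasure w] {L : Interval}
    (hw : NullEnds w L) :
    Tendsto (fun n : ℕ => w ((L : Set ℝ) \ shrink L (1 / ((n : ℝ) + 1)))) atTop (𝓝 0) := by
  have h := tendsto_measure_iInter_atTop (μ := w)
    (s := fun n : ℕ => (L : Set ℝ) \ shrink L (1 / ((n : ℝ) + 1)))
    (fun n => ((measurableSet_coe L).diff measurableSet_Icc).nullMeasurableSet)
    (fun m n hmn => sdiff_subset_sdiff_right (Icc_subset_Icc
      (by have := Nat.one_div_le_one_div (α := ℝ) hmn; linarith)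
      (by have := Nat.one_div_le_one_div (α := ℝ) hmn; linarith)))
    ⟨0, ne_top_of_le_ne_top (measure_coe_lt_top w L).ne (measure_mono sdiff_subset)⟩
  have h0 : w (⋂ n : ℕ, (L : Set ℝ) \ shrink L (1 / ((n : ℝ) + 1))) = 0 := by
    refine measure_mono_null (t := {L.fst} ∪ {L.snd}) (fun x hx => ?_)
      (measure_union_null hw.1 hw.2)
    rw [mem_iInter] at hx
    have hxL : L.fst ≤ x ∧ x ≤ L.snd := (hx 0).1
    by_contra hne
    simp only [mem_union, mem_singleton_iff, not_or] at hne
    have h1 : 0 < x - L.fst := sub_pos.2 (lt_of_le_of_ne hxL.1 (Ne.symm hne.1))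
    have h2 : 0 < L.snd - x := sub_pos.2 (lt_of_le_of_ne hxL.2 hne.2)
    obtain ⟨n, hn⟩ := exists_nat_one_div_lt (lt_min h1 h2)
    refine (hx n).2 ⟨?_, ?_⟩
    · linarith [hn.le.trans (min_le_left _ _)]
    · linarith [hn.le.trans (min_le_right _ _)]
  rwa [h0] at h

lemma setLIntegral_sub_sq_le (w : Measure ℝ) (L : Interval) {c : ℝ} (hc : c ∈ (L : Set ℝ))
    {s : Set ℝ} (hs : s ⊆ L) (hm : MeasurableSet s) :
    ∫⁻ x in s, ENNReal.ofReal ((x - c) ^ 2) ∂w ≤ ENNReal.ofReal (L.length ^ 2) * w s := by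
  calc ∫⁻ x in s, ENNReal.ofReal ((x - c) ^ 2) ∂w
      ≤ ∫⁻ _ in s, ENNReal.ofReal (L.length ^ 2) ∂w := by
        refine setLIntegral_mono' hm fun x hx => ENNReal.ofReal_le_ofReal ?_
        rw [← sq_abs (x - c)]
        have := abs_sub_le_length (hs hx) hc
        gcongr
    _ = _ := by simp

/-- One interval in the energy inequality, up to the mass of `w` near the endpoints. -/
lemma energy_single {σ w : Measure ℝ} [IsLocallyFiniteMeasure σ] [IsLocallyFiniteMeasure w]
    {I L : Interval} (hLI : L ≤ I) (hL : 0 < L.length) {E : ℝ≥0∞}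
    (hE : ∀ c : ℝ, E ≤ ∫⁻ x in (L : Set ℝ), ENNReal.ofReal ((x - c) ^ 2) ∂w) {α β : ℝ}
    (hα : 0 < α) (hβ : I.length < β) :
    E * (∫⁻ y in (I : Set ℝ) \ L, kern L y ∂σ) ^ 2 ≤
      (2 * ∫⁻ x in (L : Set ℝ), ‖hilbert α β (σ.restrict (I : Set ℝ)) x‖ₑ ^ 2 ∂w) +
      (2 * ∫⁻ x in (L : Set ℝ), ‖hilbert α β (σ.restrict (L : Set ℝ)) x‖ₑ ^ 2 ∂w) +
      (∫⁻ y in (I : Set ℝ) \ L, kern L y ∂σ) ^ 2 * ENNReal.ofReal (L.length ^ 2) *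
        w ((L : Set ℝ) \ shrink L α) := by
  set Q := ∫⁻ y in (I : Set ℝ) \ L, kern L y ∂σ with hQ
  have hQtop : Q ≠ ∞ := setLIntegral_kern_ne_top σ I L hL sdiff_subset
  have : IsFiniteMeasure (σ.restrict (I : Set ℝ)) := ⟨by
    rw [Measure.restrict_apply_univ]; exact measure_coe_lt_top σ I⟩
  have : IsFiniteMeasure (σ.restrict (L : Set ℝ)) := ⟨by
    rw [Measure.restrict_apply_univ]; exact measure_coe_lt_top σ L⟩
  have : IsFiniteMeasure (σ.restrict ((I : Set ℝ) \ L)) := ⟨by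
    rw [Measure.restrict_apply_univ]
    exact (measure_mono sdiff_subset).trans_lt (measure_coe_lt_top σ I)⟩
  rcases (shrink L α).eq_empty_or_nonempty with h0 | h0
  · refine le_trans ?_ le_add_self
    rw [h0, sdiff_empty, mul_comm E, mul_assoc]
    gcongr
    exact (hE L.fst).trans (setLIntegral_sub_sq_le w L ⟨le_rfl, L.fst_le_snd⟩ subset_rfl
      (measurableSet_coe L))
  · obtain ⟨c, hc, hψ⟩ := exists_abs_sub_le (f := hilbert α β (σ.restrict ((I : Set ℝ) \ L)))
      (Q := Q.toReal) ENNReal.toReal_nonneg (nonempty_Icc.1 h0) fun x hx x' hx' hxx' =>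
        slope_hilbert hLI hL hα le_rfl hβ hx hx' hxx'
    have hcL : c ∈ (L : Set ℝ) := shrink_subset L hα.le hc
    have hmi : MeasurableSet (shrink L α) := measurableSet_Icc
    have hsplit : ∫⁻ x in (L : Set ℝ), ENNReal.ofReal ((x - c) ^ 2) ∂w =
        ∫⁻ x in shrink L α, ENNReal.ofReal ((x - c) ^ 2) ∂w +
        ∫⁻ x in (L : Set ℝ) \ shrink L α, ENNReal.ofReal ((x - c) ^ 2) ∂w := by
      rw [← lintegral_inter_add_sdiff _ _ hmi, inter_eq_right.2 (shrink_subset L hα.le)]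
    have hH : ∀ x, hilbert α β (σ.restrict (I : Set ℝ)) x =
        hilbert α β (σ.restrict ((I : Set ℝ) \ L)) x + hilbert α β (σ.restrict (L : Set ℝ)) x := by
      intro x
      rw [← hilbert_add hα, ← Measure.restrict_union disjoint_sdiff_left (measurableSet_coe L),
        sdiff_union_of_subset (coe_subset hLI)]
    have hmain : Q ^ 2 * ∫⁻ x in shrink L α, ENNReal.ofReal ((x - c) ^ 2) ∂w ≤
        (2 * ∫⁻ x in (L : Set ℝ), ‖hilbert α β (σ.restrict (I : Set ℝ)) x‖ₑ ^ 2 ∂w) +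
        (2 * ∫⁻ x in (L : Set ℝ), ‖hilbert α β (σ.restrict (L : Set ℝ)) x‖ₑ ^ 2 ∂w) := by
      rw [← lintegral_const_mul' _ _ (ENNReal.pow_ne_top hQtop), ← mul_add,
        ← lintegral_add_left ((measurable_hilbert α β _).enorm.pow_const 2),
        ← lintegral_const_mul' _ _ (by norm_num)]
      refine (setLIntegral_mono' hmi fun x hx => ?_).trans
        (lintegral_mono_set (shrink_subset L hα.le))
      calc Q ^ 2 * ENNReal.ofReal ((x - c) ^ 2)
          = (ENNReal.ofReal (Q.toReal * |x - c|)) ^ 2 := by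
            rw [ENNReal.ofReal_mul ENNReal.toReal_nonneg, ENNReal.ofReal_toReal hQtop, mul_pow,
              ← ENNReal.ofReal_pow (abs_nonneg _), sq_abs]
        _ ≤ ‖hilbert α β (σ.restrict ((I : Set ℝ) \ L)) x‖ₑ ^ 2 := by
            rw [Real.enorm_eq_ofReal_abs]
            gcongr
            exact hψ x hx
        _ = ‖hilbert α β (σ.restrict (I : Set ℝ)) x - hilbert α β (σ.restrict (L : Set ℝ)) x‖ₑ ^ 2
            := by rw [hH, add_sub_cancel_right]
        _ ≤ (‖hilbert α β (σ.restrict (I : Set ℝ)) x‖ₑ +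
              ‖hilbert α β (σ.restrict (L : Set ℝ)) x‖ₑ) ^ 2 := by gcongr; exact enorm_sub_le
        _ ≤ _ := add_sq_le_two_mul _ _
    calc E * Q ^ 2 ≤ (∫⁻ x in (L : Set ℝ), ENNReal.ofReal ((x - c) ^ 2) ∂w) * Q ^ 2 := by
          gcongr; exact hE c
      _ = Q ^ 2 * ∫⁻ x in shrink L α, ENNReal.ofReal ((x - c) ^ 2) ∂w + Q ^ 2 *
          ∫⁻ x in (L : Set ℝ) \ shrink L α, ENNReal.ofReal ((x - c) ^ 2) ∂w := by
          rw [hsplit]; ring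
      _ ≤ _ := by
          refine add_le_add hmain ?_
          rw [mul_assoc]
          gcongr
          exact setLIntegral_sub_sq_le w L hcL sdiff_subset ((measurableSet_coe L).diff hmi)

/-- The energy inequality. The number `E i` stands for the variance of `x` on `L i`. The part of `σ`
outside `L i` is controlled by testing, the part inside by `𝒜₂`. -/
theorem energy_le {ι : Type*} {σ w : Measure ℝ} [IsLocallyFiniteMeasure σ]
    [IsLocallyFiniteMeasure w] {Z : Finset ι} {L : ι → Interval} {E : ι → ℝ≥0∞} {I : Interval}
    (hI : 0 < I.length) (hLI : ∀ i ∈ Z, L i ≤ I) (hL : ∀ i ∈ Z, 0 < (L i).length)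
    (hσ : ∀ i ∈ Z, NullEnds σ (L i)) (hw : ∀ i ∈ Z, NullEnds w (L i))
    (hd : (Z : Set ι).Pairwise fun i j => Nonoverlapping (L i) (L j))
    (hE : ∀ i ∈ Z, ∀ c : ℝ, E i ≤ ∫⁻ x in (L i : Set ℝ), ENNReal.ofReal ((x - c) ^ 2) ∂w)
    {T : ℝ≥0∞} (hT : Testing σ w T) :
    ∑ i ∈ Z, E i * (∫⁻ y in (I : Set ℝ), kern (L i) y ∂σ) ^ 2 ≤
      8 * (A2Const σ w + T ^ 2) * σ (I : Set ℝ) := by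
  set Q : ι → ℝ≥0∞ := fun i => ∫⁻ y in (I : Set ℝ) \ L i, kern (L i) y ∂σ with hQ
  have hσI := measure_coe_lt_top σ I
  have hsumσ : ∑ i ∈ Z, σ (L i : Set ℝ) ≤ σ (I : Set ℝ) :=
    sum_measure_le (fun i hi => coe_subset (hLI i hi)) hσ hd
  -- the truncation `α` tends to zero, and `w` has no mass at the endpoints of the `L i`
  have hhole : ∑ i ∈ Z, E i * Q i ^ 2 ≤ 4 * T ^ 2 * σ (I : Set ℝ) := by
    have hn : ∀ n : ℕ, ∑ i ∈ Z, E i * Q i ^ 2 ≤ 4 * T ^ 2 * σ (I : Set ℝ) +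
        ∑ i ∈ Z, Q i ^ 2 * ENNReal.ofReal ((L i).length ^ 2) *
          w ((L i : Set ℝ) \ shrink (L i) (1 / ((n : ℝ) + 1))) := by
      intro n
      set α : ℝ := 1 / ((n : ℝ) + 1) with hα
      have hα0 : 0 < α := by positivity
      set β : ℝ := max I.length α + 1 with hβ
      have hβI : I.length < β := (le_max_left _ _).trans_lt (lt_add_one _)
      have hβα : α < β := (le_max_right _ _).trans_lt (lt_add_one _)
      refine (Finset.sum_le_sum fun i hi =>
        energy_single (hLI i hi) (hL i hi) (hE i hi) hα0 hβI).trans ?_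
      rw [Finset.sum_add_distrib, Finset.sum_add_distrib, ← Finset.mul_sum, ← Finset.mul_sum]
      gcongr ?_ + _
      have h1 : ∑ i ∈ Z, ∫⁻ x in (L i : Set ℝ),
          ‖hilbert α β (σ.restrict (I : Set ℝ)) x‖ₑ ^ 2 ∂w ≤ T ^ 2 * σ (I : Set ℝ) :=
        (sum_setLIntegral_le (fun i hi => coe_subset (hLI i hi)) hw hd _).trans
          (hT I hI α β hα0 hβα)
      have h2 : ∑ i ∈ Z, ∫⁻ x in (L i : Set ℝ),
          ‖hilbert α β (σ.restrict (L i : Set ℝ)) x‖ₑ ^ 2 ∂w ≤ T ^ 2 * σ (I : Set ℝ) := by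
        refine (Finset.sum_le_sum fun i hi => hT (L i) (hL i hi) α β hα0 hβα).trans ?_
        rw [← Finset.mul_sum]
        gcongr
      calc _ ≤ 2 * (T ^ 2 * σ (I : Set ℝ)) + 2 * (T ^ 2 * σ (I : Set ℝ)) := by gcongr
        _ = _ := by ring
    have hlim : Tendsto (fun n : ℕ => 4 * T ^ 2 * σ (I : Set ℝ) +
        ∑ i ∈ Z, Q i ^ 2 * ENNReal.ofReal ((L i).length ^ 2) *
          w ((L i : Set ℝ) \ shrink (L i) (1 / ((n : ℝ) + 1)))) atTop
        (𝓝 (4 * T ^ 2 * σ (I : Set ℝ) +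
          ∑ i ∈ Z, Q i ^ 2 * ENNReal.ofReal ((L i).length ^ 2) * 0)) := by
      refine tendsto_const_nhds.add (tendsto_finsetSum _ fun i hi => ?_)
      refine ENNReal.Tendsto.const_mul (tendsto_measure_diff_shrink (hw i hi)) (Or.inr ?_)
      exact ENNReal.mul_ne_top (ENNReal.pow_ne_top
        (setLIntegral_kern_ne_top σ I (L i) (hL i hi) sdiff_subset)) ENNReal.ofReal_ne_top
    simpa using ge_of_tendsto' hlim hn
  have hself : ∀ i ∈ Z, E i * (∫⁻ y in (L i : Set ℝ), kern (L i) y ∂σ) ^ 2 ≤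
      A2Const σ w * σ (L i : Set ℝ) := by
    intro i hi
    have hl := hL i hi
    set l := ENNReal.ofReal ((L i).length ^ 2) with hl'
    have hl0 : l ≠ 0 := by
      rw [hl', Ne, ENNReal.ofReal_eq_zero, not_le]; positivity
    have hE' : E i ≤ l * w (L i : Set ℝ) := (hE i hi (L i).fst).trans
      (setLIntegral_sub_sq_le w (L i) ⟨le_rfl, (L i).fst_le_snd⟩ subset_rfl (measurableSet_coe _))
    have hk : ∫⁻ y in (L i : Set ℝ), kern (L i) y ∂σ = l⁻¹ * σ (L i : Set ℝ) := by
      rw [setLIntegral_congr_fun (measurableSet_coe _) fun y hy => kern_of_mem hy]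
      simp only [lintegral_const, Measure.restrict_apply_univ]
      rw [hl', one_div, ENNReal.ofReal_inv_of_pos (by positivity)]
    calc E i * (∫⁻ y in (L i : Set ℝ), kern (L i) y ∂σ) ^ 2
        ≤ (l * w (L i : Set ℝ)) * (l⁻¹ * σ (L i : Set ℝ)) ^ 2 := by rw [hk]; gcongr
      _ = (l * l⁻¹) * l⁻¹ * (σ (L i : Set ℝ) * w (L i : Set ℝ)) * σ (L i : Set ℝ) := by ring
      _ ≤ 1 * l⁻¹ * (A2Const σ w * l) * σ (L i : Set ℝ) := by
          exact mul_le_mul' (mul_le_mul' (mul_le_mul' (ENNReal.mul_inv_le_one l) le_rfl)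
            (A2_measure_le hl)) le_rfl
      _ = (l * l⁻¹) * A2Const σ w * σ (L i : Set ℝ) := by ring
      _ ≤ _ := by
          rw [ENNReal.mul_inv_cancel hl0 ENNReal.ofReal_ne_top, one_mul]
  calc ∑ i ∈ Z, E i * (∫⁻ y in (I : Set ℝ), kern (L i) y ∂σ) ^ 2
      ≤ ∑ i ∈ Z, 2 * (E i * Q i ^ 2 + A2Const σ w * σ (L i : Set ℝ)) := by
        refine Finset.sum_le_sum fun i hi => ?_
        rw [← lintegral_inter_add_sdiff (kern (L i)) (I : Set ℝ) (measurableSet_coe (L i)),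
          inter_eq_right.2 (coe_subset (hLI i hi))]
        calc _ ≤ E i * (2 * ((∫⁻ y in (L i : Set ℝ), kern (L i) y ∂σ) ^ 2 + Q i ^ 2)) := by
              gcongr; exact add_sq_le_two_mul _ _
          _ = 2 * (E i * Q i ^ 2 + E i * (∫⁻ y in (L i : Set ℝ), kern (L i) y ∂σ) ^ 2) := by ring
          _ ≤ _ := by gcongr 2 * (_ + ?_); exact hself i hi
    _ = 2 * (∑ i ∈ Z, E i * Q i ^ 2 + A2Const σ w * ∑ i ∈ Z, σ (L i : Set ℝ)) := by
        rw [← Finset.mul_sum, Finset.sum_add_distrib, Finset.mul_sum]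
    _ ≤ 2 * (4 * T ^ 2 * σ (I : Set ℝ) + A2Const σ w * σ (I : Set ℝ)) := by gcongr
    _ = (8 * T ^ 2 + 2 * A2Const σ w) * σ (I : Set ℝ) := by ring
    _ ≤ (8 * T ^ 2 + 8 * A2Const σ w) * σ (I : Set ℝ) := by gcongr; norm_num
    _ = _ := by ring

/-! ### Forward testing -/

lemma IsDyadicGrid.length_pos {D : Set Interval} (hD : IsDyadicGrid D) {I : Interval}
    (hI : I ∈ D) : 0 < I.length := by
  obtain ⟨n, hn⟩ := hD.length_eq I hI
  rw [hn]; positivity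

lemma Nonoverlapping.symm {I J : Interval} (h : Nonoverlapping I J) : Nonoverlapping J I :=
  Disjoint.symm h

lemma IsDyadicGrid.trichotomy {D : Set Interval} (hD : IsDyadicGrid D) {I J : Interval}
    (hI : I ∈ D) (hJ : J ∈ D) : I ≤ J ∨ J ≤ I ∨ Nonoverlapping I J := by
  have := hD.nested I hI J hJ
  rwa [coe_eq_Icc, coe_eq_Icc, interior_Icc, interior_Icc] at this

lemma not_nonoverlapping {I J K : Interval} (hK : 0 < K.length) (hI : K ≤ I) (hJ : K ≤ J) :
    ¬ Nonoverlapping I J := by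
  intro h
  rw [length_eq] at hK
  refine absurd (⟨?_, ?_⟩ : (K.fst + K.snd) / 2 ∈ Ioo J.fst J.snd)
    (disjoint_left.1 (show Disjoint _ _ from h) ⟨?_, ?_⟩) <;>
    linarith [show I.fst ≤ K.fst from hI.1, show K.snd ≤ I.snd from hI.2,
      show J.fst ≤ K.fst from hJ.1, show K.snd ≤ J.snd from hJ.2]

lemma IsDyadicGrid.le_or_le {D : Set Interval} (hD : IsDyadicGrid D) {I J K : Interval}
    (hI : I ∈ D) (hJ : J ∈ D) (hK : 0 < K.length) (hKI : K ≤ I) (hKJ : K ≤ J) :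
    I ≤ J ∨ J ≤ I := by
  rcases hD.trichotomy hI hJ with h | h | h
  · exact Or.inl h
  · exact Or.inr h
  · exact absurd h (not_nonoverlapping hK hKI hKJ)

lemma Admissible.nullEnds {D : Set Interval} {ν : Measure ℝ} (h : Admissible D ν) {I : Interval}
    (hI : I ∈ D) : NullEnds ν I := h I hI

open Classical in
/-- The maximal members of a finite family of intervals. -/
noncomputable def maximals (𝒢 : Finset Interval) : Finset Interval :=
  𝒢.filter fun M => ∀ F ∈ 𝒢, M ≤ F → F = M

lemma maximals_subset (𝒢 : Finset Interval) : maximals 𝒢 ⊆ 𝒢 := Finset.filter_subset _ _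

lemma exists_maximals_ge {𝒢 : Finset Interval} {F : Interval} (hF : F ∈ 𝒢) :
    ∃ M ∈ maximals 𝒢, F ≤ M := by
  obtain ⟨M, hFM, hM⟩ := 𝒢.exists_le_maximal hF
  refine ⟨M, Finset.mem_filter.2 ⟨hM.prop, fun K hK hMK => ?_⟩, hFM⟩
  exact le_antisymm (hM.le_of_ge hK hMK) hMK

lemma eq_of_mem_maximals {D : Set Interval} (hD : IsDyadicGrid D) {𝒢 : Finset Interval}
    (h𝒢 : ∀ F ∈ 𝒢, F ∈ D) {M M' K : Interval} (hM : M ∈ maximals 𝒢) (hM' : M' ∈ maximals 𝒢)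
    (hK : 0 < K.length) (hKM : K ≤ M) (hKM' : K ≤ M') : M = M' := by
  have h1 := Finset.mem_filter.1 hM
  have h2 := Finset.mem_filter.1 hM'
  rcases hD.le_or_le (h𝒢 _ h1.1) (h𝒢 _ h2.1) hK hKM hKM' with h | h
  · exact (h1.2 _ h2.1 h).symm
  · exact h2.2 _ h1.1 h

lemma pairwise_maximals {D : Set Interval} (hD : IsDyadicGrid D) {𝒢 : Finset Interval}
    (h𝒢 : ∀ F ∈ 𝒢, F ∈ D) : (maximals 𝒢 : Set Interval).Pairwise Nonoverlapping := by
  intro M hM M' hM' hne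
  have h1 := Finset.mem_filter.1 (Finset.mem_coe.1 hM)
  have h2 := Finset.mem_filter.1 (Finset.mem_coe.1 hM')
  rcases hD.trichotomy (h𝒢 _ h1.1) (h𝒢 _ h2.1) with h | h | h
  · exact absurd (h1.2 _ h2.1 h).symm hne
  · exact absurd (h2.2 _ h1.1 h) hne
  · exact h

open Classical in
lemma sum_maximals {D : Set Interval} (hD : IsDyadicGrid D) {𝒢 : Finset Interval}
    (h𝒢 : ∀ F ∈ 𝒢, F ∈ D) {ι : Type*} (s : Finset ι) (F : ι → Interval) (hF : ∀ i ∈ s, F i ∈ 𝒢)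
    (f : ι → ℝ≥0∞) :
    ∑ M ∈ maximals 𝒢, ∑ i ∈ s with F i ≤ M, f i = ∑ i ∈ s, f i := by
  simp only [Finset.sum_filter]
  rw [Finset.sum_comm]
  refine Finset.sum_congr rfl fun i hi => ?_
  obtain ⟨M, hM, hFM⟩ := exists_maximals_ge (hF i hi)
  rw [Finset.sum_eq_single M, if_pos hFM]
  · intro M' hM' hne
    rw [if_neg]
    intro h
    exact hne (eq_of_mem_maximals hD h𝒢 hM' hM (hD.length_pos (h𝒢 _ (hF i hi))) h hFM)
  · exact fun h => absurd hM h

lemma IsCarleson.sum_le {D : Set Interval} {σ : Measure ℝ} {𝓕 : Set Interval}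
    (hC : IsCarleson D σ 𝓕) {S : Interval} (hS : S ∈ D) (𝒢 : Finset Interval)
    (h𝒢 : ∀ F ∈ 𝒢, F ∈ 𝓕 ∧ F ≤ S) : ∑ F ∈ 𝒢, σ (F : Set ℝ) ≤ 2 * σ (S : Set ℝ) := by
  classical
  refine le_trans ?_ (hC S hS)
  have h := ENNReal.sum_le_tsum
    (f := fun F : {F : Interval // F ∈ 𝓕 ∧ F ≤ S} => σ (F.1 : Set ℝ)) (𝒢.subtype _)
  refine le_trans (le_of_eq ?_) h
  rw [Finset.sum_subtype_of_mem (fun F : Interval => σ (F : Set ℝ)) h𝒢]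

/-- The Carleson condition also holds on intervals that do not belong to the grid. -/
lemma IsCarleson.sum_le_of_interval {D : Set Interval} (hD : IsDyadicGrid D) {σ : Measure ℝ}
    (hσ : Admissible D σ) {𝓕 : Set Interval} (h𝓕 : 𝓕 ⊆ D) (hC : IsCarleson D σ 𝓕)
    {I : Interval} (𝒢 : Finset Interval) (h𝒢 : ∀ F ∈ 𝒢, F ∈ 𝓕 ∧ F ≤ I) :
    ∑ F ∈ 𝒢, σ (F : Set ℝ) ≤ 2 * σ (I : Set ℝ) := by
  classical
  have h𝒢D : ∀ F ∈ 𝒢, F ∈ D := fun F hF => h𝓕 (h𝒢 F hF).1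
  rw [← sum_maximals hD h𝒢D 𝒢 id (fun F hF => hF)]
  calc ∑ M ∈ maximals 𝒢, ∑ F ∈ 𝒢 with id F ≤ M, σ (F : Set ℝ)
      ≤ ∑ M ∈ maximals 𝒢, 2 * σ (M : Set ℝ) := by
        refine Finset.sum_le_sum fun M hM => ?_
        refine hC.sum_le (h𝒢D M (maximals_subset _ hM)) _ fun F hF => ?_
        have := Finset.mem_filter.1 hF
        exact ⟨(h𝒢 F this.1).1, this.2⟩
    _ ≤ _ := by
        rw [← Finset.mul_sum]
        gcongr
        exact sum_measure_le (L := id)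
          (fun M hM => coe_subset (h𝒢 M (maximals_subset _ hM)).2)
          (fun M hM => hσ.nullEnds (h𝒢D M (maximals_subset _ hM))) (pairwise_maximals hD h𝒢D)

open Classical in
/-- A finite family of intervals `J t` of the grid with weights `e t`, each inside a member `F t` of
the `σ`-Carleson family `𝓕`, at distance at least `|J t|` from the boundary. The intervals with the
same `F` do not overlap, and the weights inside an interval are bounded by the variance of `x` with
respect to `w` on it. The condition `chain` implies that the intervals inside `I`
whose tops are not overlap at most twice. -/
structure IsEnergyFamily (D : Set Interval) (σ w : Measure ℝ) (𝓕 : Set Interval) {β : Type*}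
    (𝒮 : Finset β) (J F : β → Interval) (e : β → ℝ≥0∞) : Prop where
  grid : IsDyadicGrid D
  null_left : Admissible D σ
  null_right : Admissible D w
  subset : 𝓕 ⊆ D
  carleson : IsCarleson D σ 𝓕
  mem : ∀ t ∈ 𝒮, J t ∈ D
  top_mem : ∀ t ∈ 𝒮, F t ∈ 𝓕
  gap : ∀ t ∈ 𝒮, (F t).fst + (J t).length ≤ (J t).fst ∧ (J t).snd + (J t).length ≤ (F t).snd
  sep : ∀ t ∈ 𝒮, ∀ t' ∈ 𝒮, t ≠ t' → F t = F t' → Nonoverlapping (J t) (J t')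
  inj : ∀ t ∈ 𝒮, ∀ t' ∈ 𝒮, J t = J t' → t = t'
  chain : ∀ t₁ ∈ 𝒮, ∀ t₂ ∈ 𝒮, ∀ t₃ ∈ 𝒮, J t₁ < J t₂ → J t₂ < J t₃ → J t₃ ≤ F t₁ →
    ¬ J t₃ ≤ F t₂
  energy : ∀ (I : Interval) (c : ℝ),
    ∑ t ∈ 𝒮 with J t ≤ I, e t ≤ ∫⁻ x in (I : Set ℝ), ENNReal.ofReal ((x - c) ^ 2) ∂w

namespace IsEnergyFamily

variable {D : Set Interval} {σ w : Measure ℝ} {𝓕 : Set Interval} {β : Type*}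
  {𝒮 : Finset β} {J F : β → Interval} {e : β → ℝ≥0∞}

lemma length_pos (h : IsEnergyFamily D σ w 𝓕 𝒮 J F e) {t : β} (ht : t ∈ 𝒮) : 0 < (J t).length :=
  h.grid.length_pos (h.mem t ht)

lemma le_top (h : IsEnergyFamily D σ w 𝓕 𝒮 J F e) {t : β} (ht : t ∈ 𝒮) : J t ≤ F t := by
  have := h.gap t ht
  have := h.length_pos ht
  exact ⟨show (F t).fst ≤ (J t).fst by linarith, show (J t).snd ≤ (F t).snd by linarith⟩

open Classical in
lemma energy_self (h : IsEnergyFamily D σ w 𝓕 𝒮 J F e) {t : β} (ht : t ∈ 𝒮) (c : ℝ) :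
    e t ≤ ∫⁻ x in (J t : Set ℝ), ENNReal.ofReal ((x - c) ^ 2) ∂w :=
  le_trans (Finset.single_le_sum (fun _ _ => zero_le) (Finset.mem_filter.2 ⟨ht, le_refl (J t)⟩))
    (h.energy (J t) c)

variable [IsLocallyFiniteMeasure σ] [IsLocallyFiniteMeasure w]

lemma sum_le_of_pairwise (h : IsEnergyFamily D σ w 𝓕 𝒮 J F e) {T : ℝ≥0∞} (hT : Testing σ w T)
    {I : Interval} (hI : 0 < I.length) {Z : Finset β} (hZ : Z ⊆ 𝒮) (hZI : ∀ t ∈ Z, J t ≤ I)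
    (hd : ∀ t ∈ Z, ∀ t' ∈ Z, t ≠ t' → Nonoverlapping (J t) (J t')) :
    ∑ t ∈ Z, e t * (∫⁻ y in (I : Set ℝ), kern (J t) y ∂σ) ^ 2 ≤
      8 * (A2Const σ w + T ^ 2) * σ (I : Set ℝ) :=
  energy_le hI hZI (fun _ ht => h.length_pos (hZ ht))
    (fun t ht => h.null_left.nullEnds (h.mem t (hZ ht)))
    (fun t ht => h.null_right.nullEnds (h.mem t (hZ ht)))
    (fun t ht t' ht' hne => hd t ht t' ht' hne) (fun _ ht c => h.energy_self (hZ ht) c) hT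

open Classical in
/-- Forward testing for the intervals whose top is not contained in `I`: these overlap at most
twice. -/
lemma sum_le_of_not_le (h : IsEnergyFamily D σ w 𝓕 𝒮 J F e) {T : ℝ≥0∞} (hT : Testing σ w T)
    {I : Interval} (hI : 0 < I.length) :
    ∑ t ∈ 𝒮 with J t ≤ I ∧ ¬ F t ≤ I, e t * (∫⁻ y in (I : Set ℝ), kern (J t) y ∂σ) ^ 2 ≤
      16 * (A2Const σ w + T ^ 2) * σ (I : Set ℝ) := by
  set Z := 𝒮.filter fun t => J t ≤ I ∧ ¬ F t ≤ I with hZ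
  have hZS : Z ⊆ 𝒮 := Finset.filter_subset _ _
  have hZI : ∀ t ∈ Z, J t ≤ I := fun t ht => (Finset.mem_filter.1 ht).2.1
  have hcomp : ∀ t ∈ 𝒮, ∀ t' ∈ 𝒮, t ≠ t' → J t < J t' ∨ J t' < J t ∨
      Nonoverlapping (J t) (J t') := by
    intro t ht t' ht' hne
    rcases h.grid.trichotomy (h.mem t ht) (h.mem t' ht') with h1 | h1 | h1
    · exact Or.inl (lt_of_le_of_ne h1 fun h2 => hne (h.inj t ht t' ht' h2))
    · exact Or.inr (Or.inl (lt_of_le_of_ne h1 fun h2 => hne (h.inj t' ht' t ht h2).symm))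
    · exact Or.inr (Or.inr h1)
  rw [← Finset.sum_filter_add_sum_filter_not Z fun t => ∃ t' ∈ Z, J t < J t']
  have h1 : ∑ t ∈ Z with ∃ t' ∈ Z, J t < J t',
      e t * (∫⁻ y in (I : Set ℝ), kern (J t) y ∂σ) ^ 2 ≤
      8 * (A2Const σ w + T ^ 2) * σ (I : Set ℝ) := by
    refine h.sum_le_of_pairwise hT hI ((Finset.filter_subset _ _).trans hZS)
      (fun t ht => hZI t (Finset.mem_filter.1 ht).1) ?_
    -- three nested intervals would contradict the condition on chains
    have key : ∀ t ∈ Z, ∀ t' ∈ Z, J t < J t' → ¬ ∃ t'' ∈ Z, J t' < J t'' := by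
      rintro t ht t' ht' htt' ⟨t'', ht'', ht't''⟩
      have hF : ∀ s ∈ Z, J s ≤ J t'' → J t'' ≤ F s := by
        intro s hs hst
        rcases h.grid.le_or_le (h.mem t'' (hZS ht'')) (h.subset (h.top_mem s (hZS hs)))
          (h.length_pos (hZS hs)) hst (h.le_top (hZS hs)) with h2 | h2
        · exact h2
        · exact absurd (h2.trans (hZI t'' ht'')) (Finset.mem_filter.1 hs).2.2
      exact h.chain t (hZS ht) t' (hZS ht') t'' (hZS ht'') htt' ht't''
        (hF t ht (htt'.trans ht't'').le) (hF t' ht' ht't''.le)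
    intro t ht t' ht' hne
    have ht1 := Finset.mem_filter.1 ht
    have ht1' := Finset.mem_filter.1 ht'
    rcases hcomp t (hZS ht1.1) t' (hZS ht1'.1) hne with h2 | h2 | h2
    · exact absurd ht1'.2 (key t ht1.1 t' ht1'.1 h2)
    · exact absurd ht1.2 (key t' ht1'.1 t ht1.1 h2)
    · exact h2
  have h2 : ∑ t ∈ Z with ¬ ∃ t' ∈ Z, J t < J t',
      e t * (∫⁻ y in (I : Set ℝ), kern (J t) y ∂σ) ^ 2 ≤
      8 * (A2Const σ w + T ^ 2) * σ (I : Set ℝ) := by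
    refine h.sum_le_of_pairwise hT hI ((Finset.filter_subset _ _).trans hZS)
      (fun t ht => hZI t (Finset.mem_filter.1 ht).1) ?_
    intro t ht t' ht' hne
    have ht1 := Finset.mem_filter.1 ht
    have ht1' := Finset.mem_filter.1 ht'
    rcases hcomp t (hZS ht1.1) t' (hZS ht1'.1) hne with h3 | h3 | h3
    · exact absurd ⟨t', ht1'.1, h3⟩ ht1.2
    · exact absurd ⟨t, ht1.1, h3⟩ ht1'.2
    · exact h3
  calc _ ≤ _ := add_le_add h1 h2
    _ = _ := by ring

open Classical in
/-- Forward testing for the part of `σ` inside the top of each interval. -/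
lemma sum_plug_le (h : IsEnergyFamily D σ w 𝓕 𝒮 J F e) {T : ℝ≥0∞} (hT : Testing σ w T)
    {I : Interval} :
    ∑ t ∈ 𝒮 with F t ≤ I, e t * (∫⁻ y in (F t : Set ℝ), kern (J t) y ∂σ) ^ 2 ≤
      16 * (A2Const σ w + T ^ 2) * σ (I : Set ℝ) := by
  set Z := 𝒮.filter fun t => F t ≤ I with hZ
  have hZS : Z ⊆ 𝒮 := Finset.filter_subset _ _
  rw [← Finset.sum_fiberwise_of_maps_to (t := Z.image F) (g := F)
    fun t ht => Finset.mem_image_of_mem F ht]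
  calc ∑ G ∈ Z.image F, ∑ t ∈ Z with F t = G,
        e t * (∫⁻ y in (F t : Set ℝ), kern (J t) y ∂σ) ^ 2
      ≤ ∑ G ∈ Z.image F, 8 * (A2Const σ w + T ^ 2) * σ (G : Set ℝ) := by
        refine Finset.sum_le_sum fun G hG => ?_
        obtain ⟨t₀, ht₀, rfl⟩ := Finset.mem_image.1 hG
        have e1 : ∀ t ∈ Z.filter (fun t => F t = F t₀),
            e t * (∫⁻ y in (F t : Set ℝ), kern (J t) y ∂σ) ^ 2 =
            e t * (∫⁻ y in (F t₀ : Set ℝ), kern (J t) y ∂σ) ^ 2 := fun t ht => by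
          rw [(Finset.mem_filter.1 ht).2]
        rw [Finset.sum_congr rfl e1]
        refine h.sum_le_of_pairwise hT (h.grid.length_pos (h.subset (h.top_mem _ (hZS ht₀))))
          ((Finset.filter_subset _ _).trans hZS) (fun t ht => ?_) fun t ht t' ht' hne => ?_
        · have := Finset.mem_filter.1 ht
          rw [← this.2]
          exact h.le_top (hZS this.1)
        · have h1 := Finset.mem_filter.1 ht
          have h2 := Finset.mem_filter.1 ht'
          exact h.sep t (hZS h1.1) t' (hZS h2.1) hne (h1.2.trans h2.2.symm)
    _ = 8 * (A2Const σ w + T ^ 2) * ∑ G ∈ Z.image F, σ (G : Set ℝ) := by rw [Finset.mul_sum]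
    _ ≤ 8 * (A2Const σ w + T ^ 2) * (2 * σ (I : Set ℝ)) := by
        gcongr
        refine h.carleson.sum_le_of_interval h.grid h.null_left h.subset _ fun G hG => ?_
        obtain ⟨t, ht, rfl⟩ := Finset.mem_image.1 hG
        exact ⟨h.top_mem t (hZS ht), (Finset.mem_filter.1 ht).2⟩
    _ = _ := by ring

open Classical in
/-- Forward testing for the part of `σ` outside the maximal members of a subfamily. -/
lemma sum_diff_maximals_le (h : IsEnergyFamily D σ w 𝓕 𝒮 J F e) {T : ℝ≥0∞} (hT : Testing σ w T)
    {I : Interval} (hI : 0 < I.length) {𝒢 : Finset Interval} (h𝒢 : ∀ G ∈ 𝒢, G ∈ 𝓕 ∧ G ≤ I)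
    {M : β → Interval} (hM : ∀ t ∈ 𝒮, F t ∈ 𝒢 → M t ∈ maximals 𝒢 ∧ F t ≤ M t) :
    ∑ t ∈ 𝒮 with F t ∈ 𝒢, e t * (∫⁻ y in (I : Set ℝ) \ M t, kern (J t) y ∂σ) ^ 2 ≤
      128 * (A2Const σ w + T ^ 2) * σ (I : Set ℝ) := by
  have h𝒢D : ∀ G ∈ 𝒢, G ∈ D := fun G hG => h.subset (h𝒢 G hG).1
  set Z := 𝒮.filter fun t => F t ∈ 𝒢 with hZ
  have hZS : ∀ t ∈ Z, t ∈ 𝒮 := fun t ht => (Finset.mem_filter.1 ht).1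
  have hZG : ∀ t ∈ Z, F t ∈ 𝒢 := fun t ht => (Finset.mem_filter.1 ht).2
  set N := Z.filter fun t => J t ∈ maximals (Z.image J) with hN
  have hJD : ∀ G ∈ Z.image J, G ∈ D := by
    intro G hG
    obtain ⟨t, ht, rfl⟩ := Finset.mem_image.1 hG
    exact h.mem t (hZS t ht)
  have hex : ∀ t ∈ Z, ∃ t' ∈ N, J t ≤ J t' := by
    intro t ht
    obtain ⟨L, hL, htL⟩ := exists_maximals_ge (Finset.mem_image_of_mem J ht)
    obtain ⟨t', ht', rfl⟩ := Finset.mem_image.1 (maximals_subset _ hL)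
    exact ⟨t', Finset.mem_filter.2 ⟨ht', hL⟩, htL⟩
  -- off `M t`, the kernel of `J t` is dominated by that of the maximal interval above `J t`
  have hker : ∀ t ∈ Z, ∀ t' ∈ N, J t ≤ J t' →
      ∫⁻ y in (I : Set ℝ) \ M t, kern (J t) y ∂σ ≤
        4 * ∫⁻ y in (I : Set ℝ), kern (J t') y ∂σ := by
    intro t ht t' ht' htt'
    have ht'Z := (Finset.mem_filter.1 ht').1
    have hMt := hM t (hZS t ht) (hZG t ht)
    have hMt' := hM t' (hZS t' ht'Z) (hZG t' ht'Z)
    have hMM : M t = M t' := eq_of_mem_maximals h.grid h𝒢D hMt.1 hMt'.1 (h.length_pos (hZS t ht))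
      ((h.le_top (hZS t ht)).trans hMt.2)
      (htt'.trans ((h.le_top (hZS t' ht'Z)).trans hMt'.2))
    rw [← lintegral_const_mul' _ _ (by norm_num)]
    refine (setLIntegral_mono' ((measurableSet_coe I).diff (measurableSet_coe _))
      fun y hy => ?_).trans (lintegral_mono_set sdiff_subset)
    have h1 := kern_le_mul (I := J t') (J := J t) (x := y) (y := y) (c := 2) two_pos
      (h.length_pos (hZS t' ht'Z)) ?_
    · refine h1.trans (le_of_eq ?_)
      norm_num
    have h2 : Metric.infDist y (J t' : Set ℝ) ≤ Metric.infDist y (J t : Set ℝ) :=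
      Metric.infDist_le_infDist_of_subset (coe_subset htt') (nonempty_coe _)
    have h3 : (J t').length ≤ Metric.infDist y (J t' : Set ℝ) := by
      refine (Metric.le_infDist (nonempty_coe _)).2 fun x hx => ?_
      have hx' : (J t').fst ≤ x ∧ x ≤ (J t').snd := hx
      have hyM : ¬ ((M t').fst ≤ y ∧ y ≤ (M t').snd) := hMM ▸ hy.2
      have hg := h.gap t' (hZS t' ht'Z)
      have h5 : (M t').fst ≤ (F t').fst := hMt'.2.1
      have h6 : (F t').snd ≤ (M t').snd := hMt'.2.2
      rw [Real.dist_eq, le_abs]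
      by_contra h4
      push Not at h4
      exact hyM ⟨by linarith, by linarith⟩
    have := h.length_pos (hZS t ht)
    linarith
  have hEn : ∑ t' ∈ N, (∑ t ∈ Z with J t ≤ J t', e t) *
      (∫⁻ y in (I : Set ℝ), kern (J t') y ∂σ) ^ 2 ≤
      8 * (A2Const σ w + T ^ 2) * σ (I : Set ℝ) := by
    have hNZ : ∀ t ∈ N, t ∈ Z := fun t ht => (Finset.mem_filter.1 ht).1
    refine energy_le hI (fun t ht => ?_) (fun t ht => h.length_pos (hZS t (hNZ t ht)))
      (fun t ht => h.null_left.nullEnds (h.mem t (hZS t (hNZ t ht))))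
      (fun t ht => h.null_right.nullEnds (h.mem t (hZS t (hNZ t ht))))
      (fun t ht t' ht' hne => ?_) (fun t ht c => ?_) hT
    · exact (h.le_top (hZS t (hNZ t ht))).trans (h𝒢 _ (hZG t (hNZ t ht))).2
    · refine pairwise_maximals h.grid hJD (Finset.mem_filter.1 ht).2 (Finset.mem_filter.1 ht').2
        fun h1 => hne (h.inj t (hZS t (hNZ t ht)) t' (hZS t' (hNZ t' ht')) h1)
    · refine le_trans (Finset.sum_le_sum_of_subset ?_) (h.energy (J t) c)
      exact Finset.filter_subset_filter _ (Finset.filter_subset _ _)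
  calc ∑ t ∈ Z, e t * (∫⁻ y in (I : Set ℝ) \ M t, kern (J t) y ∂σ) ^ 2
      ≤ ∑ t ∈ Z, ∑ t' ∈ N, if J t ≤ J t' then
          16 * (e t * (∫⁻ y in (I : Set ℝ), kern (J t') y ∂σ) ^ 2) else 0 := by
        refine Finset.sum_le_sum fun t ht => ?_
        obtain ⟨t', ht', htt'⟩ := hex t ht
        refine le_trans ?_ (Finset.single_le_sum (fun _ _ => zero_le) ht')
        rw [if_pos htt']
        calc _ ≤ e t * (4 * ∫⁻ y in (I : Set ℝ), kern (J t') y ∂σ) ^ 2 := by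
              gcongr; exact hker t ht t' ht' htt'
          _ = _ := by ring
    _ = 16 * ∑ t' ∈ N, (∑ t ∈ Z with J t ≤ J t', e t) *
          (∫⁻ y in (I : Set ℝ), kern (J t') y ∂σ) ^ 2 := by
        rw [Finset.sum_comm, Finset.mul_sum]
        refine Finset.sum_congr rfl fun t' _ => ?_
        rw [← Finset.sum_filter, Finset.sum_mul, Finset.mul_sum]
    _ ≤ 16 * (8 * (A2Const σ w + T ^ 2) * σ (I : Set ℝ)) := by gcongr
    _ = _ := by ring

open Classical in
/-- Forward testing for the part of `σ` outside the top of each interval, by induction on the finite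
family `𝒢` of tops: the part outside the maximal members of `𝒢` is estimated directly, and the part
inside is the same problem for the smaller family below each maximal member. The Carleson condition
makes the masses of these families at most half of what they were, which balances the factor two
lost in splitting the square. -/
lemma sum_hole_le (h : IsEnergyFamily D σ w 𝓕 𝒮 J F e) {T : ℝ≥0∞} (hT : Testing σ w T)
    (𝒢 : Finset Interval) : ∀ {I : Interval}, 0 < I.length → (∀ G ∈ 𝒢, G ∈ 𝓕 ∧ G ≤ I) →
    ∑ t ∈ 𝒮 with F t ∈ 𝒢, e t * (∫⁻ y in (I : Set ℝ) \ F t, kern (J t) y ∂σ) ^ 2 ≤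
      128 * (A2Const σ w + T ^ 2) *
        (3 * σ (I : Set ℝ) + 9 * ∑ G ∈ 𝒢, σ (G : Set ℝ)) := by
  induction 𝒢 using Finset.strongInduction with
  | H 𝒢 ih =>
  intro I hI h𝒢
  set A := 128 * (A2Const σ w + T ^ 2) with hA
  have h𝒢D : ∀ G ∈ 𝒢, G ∈ D := fun G hG => h.subset (h𝒢 G hG).1
  have hex : ∀ t, ∃ M, t ∈ 𝒮 → F t ∈ 𝒢 → M ∈ maximals 𝒢 ∧ F t ≤ M := by
    intro t
    by_cases ht : F t ∈ 𝒢
    · obtain ⟨M, hM, hFM⟩ := exists_maximals_ge ht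
      exact ⟨M, fun _ _ => ⟨hM, hFM⟩⟩
    · exact ⟨F t, fun _ h1 => absurd h1 ht⟩
  choose M hM using hex
  set Z := 𝒮.filter fun t => F t ∈ 𝒢 with hZ
  have hZS : ∀ t ∈ Z, t ∈ 𝒮 := fun t ht => (Finset.mem_filter.1 ht).1
  have hZG : ∀ t ∈ Z, F t ∈ 𝒢 := fun t ht => (Finset.mem_filter.1 ht).2
  have h1 := h.sum_diff_maximals_le hT hI h𝒢 hM
  have h2 : ∑ t ∈ Z, e t * (∫⁻ y in (M t : Set ℝ) \ F t, kern (J t) y ∂σ) ^ 2 ≤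
      ∑ K ∈ maximals 𝒢, A * (3 * σ (K : Set ℝ) + 9 * ∑ G ∈ 𝒢 with G < K, σ (G : Set ℝ)) := by
    rw [← sum_maximals h.grid h𝒢D Z F hZG]
    refine Finset.sum_le_sum fun K hK => ?_
    have hK𝒢 := maximals_subset _ hK
    refine le_trans ?_ (ih (𝒢.filter (· < K)) ?_ (h.grid.length_pos (h𝒢D K hK𝒢)) ?_)
    · -- the intervals with top `K` do not contribute
      rw [← Finset.sum_subset (s₁ := 𝒮.filter fun t => F t ∈ 𝒢.filter (· < K))
        (s₂ := Z.filter fun t => F t ≤ K)]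
      · refine Finset.sum_le_sum fun t ht => ?_
        have h3 := Finset.mem_filter.1 ht
        have h4 := Finset.mem_filter.1 h3.2
        rw [eq_of_mem_maximals h.grid h𝒢D (hM t h3.1 h4.1).1 hK
          (h.grid.length_pos (h𝒢D _ h4.1)) (hM t h3.1 h4.1).2 h4.2.le]
      · intro t ht
        have h3 := Finset.mem_filter.1 ht
        have h4 := Finset.mem_filter.1 h3.2
        exact Finset.mem_filter.2 ⟨Finset.mem_filter.2 ⟨h3.1, h4.1⟩, h4.2.le⟩
      · intro t ht ht'
        have h3 := Finset.mem_filter.1 ht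
        have h5 : F t = K := by
          by_contra hne
          exact ht' (Finset.mem_filter.2 ⟨hZS t h3.1,
            Finset.mem_filter.2 ⟨hZG t h3.1, lt_of_le_of_ne h3.2 hne⟩⟩)
        have h6 : M t = K := eq_of_mem_maximals h.grid h𝒢D (hM t (hZS t h3.1) (hZG t h3.1)).1 hK
          (h.grid.length_pos (h𝒢D _ (hZG t h3.1))) (hM t (hZS t h3.1) (hZG t h3.1)).2 h3.2
        simp [h5, h6]
    · refine Finset.filter_ssubset.2 ⟨K, hK𝒢, lt_irrefl K⟩
    · intro G hG
      have := Finset.mem_filter.1 hG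
      exact ⟨(h𝒢 G this.1).1, this.2.le⟩
  have hcar : ∀ K ∈ maximals 𝒢, ∑ G ∈ 𝒢 with G ≤ K, σ (G : Set ℝ) =
      σ (K : Set ℝ) + ∑ G ∈ 𝒢 with G < K, σ (G : Set ℝ) := by
    intro K hK
    rw [← Finset.sum_insert (s := 𝒢.filter (· < K)) (a := K)
      (f := fun G : Interval => σ (G : Set ℝ))
      (by simp)]
    refine Finset.sum_congr ?_ fun _ _ => rfl
    ext G
    simp only [Finset.mem_filter, Finset.mem_insert]
    constructor
    · rintro ⟨h3, h4⟩
      rcases h4.eq_or_lt with h5 | h5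
      · exact Or.inl h5
      · exact Or.inr ⟨h3, h5⟩
    · rintro (rfl | ⟨h3, h4⟩)
      · exact ⟨maximals_subset _ hK, le_rfl⟩
      · exact ⟨h3, h4.le⟩
  have hN : ∀ K ∈ maximals 𝒢, ∑ G ∈ 𝒢 with G < K, σ (G : Set ℝ) ≤ σ (K : Set ℝ) := by
    intro K hK
    have h3 := h.carleson.sum_le (h𝒢D K (maximals_subset _ hK)) (𝒢.filter (· ≤ K)) fun G hG =>
      ⟨(h𝒢 G (Finset.mem_filter.1 hG).1).1, (Finset.mem_filter.1 hG).2⟩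
    rw [hcar K hK, two_mul] at h3
    exact (ENNReal.add_le_add_iff_left (measure_coe_lt_top σ K).ne).1 h3
  have htot : ∑ G ∈ 𝒢, σ (G : Set ℝ) =
      ∑ K ∈ maximals 𝒢, (σ (K : Set ℝ) + ∑ G ∈ 𝒢 with G < K, σ (G : Set ℝ)) := by
    rw [← sum_maximals h.grid h𝒢D 𝒢 (fun G => G) (fun G hG => hG)]
    exact Finset.sum_congr rfl hcar
  have h3 : 2 * ∑ t ∈ Z, e t * (∫⁻ y in (I : Set ℝ) \ F t, kern (J t) y ∂σ) ^ 2 ≤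
      2 * (A * (3 * σ (I : Set ℝ) + 9 * ∑ G ∈ 𝒢, σ (G : Set ℝ))) := by
    calc 2 * ∑ t ∈ Z, e t * (∫⁻ y in (I : Set ℝ) \ F t, kern (J t) y ∂σ) ^ 2
        ≤ ∑ t ∈ Z, (6 * (e t * (∫⁻ y in (I : Set ℝ) \ M t, kern (J t) y ∂σ) ^ 2) +
            3 * (e t * (∫⁻ y in (M t : Set ℝ) \ F t, kern (J t) y ∂σ) ^ 2)) := by
          rw [Finset.mul_sum]
          refine Finset.sum_le_sum fun t ht => ?_
          have hMt := hM t (hZS t ht) (hZG t ht)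
          have hMI : M t ≤ I := (h𝒢 _ (maximals_subset _ hMt.1)).2
          have hsub : (I : Set ℝ) \ F t ⊆ ((I : Set ℝ) \ M t) ∪ ((M t : Set ℝ) \ F t) := by
            rintro y ⟨hy1, hy2⟩
            by_cases hyM : y ∈ (M t : Set ℝ)
            · exact Or.inr ⟨hyM, hy2⟩
            · exact Or.inl ⟨hy1, hyM⟩
          calc 2 * (e t * (∫⁻ y in (I : Set ℝ) \ F t, kern (J t) y ∂σ) ^ 2)
              = e t * (2 * (∫⁻ y in (I : Set ℝ) \ F t, kern (J t) y ∂σ) ^ 2) := by ring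
            _ ≤ e t * (2 * ((∫⁻ y in (I : Set ℝ) \ M t, kern (J t) y ∂σ) +
                  ∫⁻ y in (M t : Set ℝ) \ F t, kern (J t) y ∂σ) ^ 2) := by
                gcongr
                exact (lintegral_mono_set hsub).trans (lintegral_union_le _ _ _)
            _ ≤ e t * (6 * (∫⁻ y in (I : Set ℝ) \ M t, kern (J t) y ∂σ) ^ 2 +
                  3 * (∫⁻ y in (M t : Set ℝ) \ F t, kern (J t) y ∂σ) ^ 2) := by
                gcongr e t * ?_
                exact two_mul_add_sq_le _ _
            _ = _ := by ring
      _ = 6 * ∑ t ∈ Z, e t * (∫⁻ y in (I : Set ℝ) \ M t, kern (J t) y ∂σ) ^ 2 +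
            3 * ∑ t ∈ Z, e t * (∫⁻ y in (M t : Set ℝ) \ F t, kern (J t) y ∂σ) ^ 2 := by
          rw [Finset.sum_add_distrib, Finset.mul_sum, Finset.mul_sum]
      _ ≤ 6 * (A * σ (I : Set ℝ)) + 3 * ∑ K ∈ maximals 𝒢,
            A * (3 * σ (K : Set ℝ) + 9 * ∑ G ∈ 𝒢 with G < K, σ (G : Set ℝ)) :=
          add_le_add (mul_le_mul_right h1 _) (mul_le_mul_right h2 _)
      _ ≤ 6 * (A * σ (I : Set ℝ)) + ∑ K ∈ maximals 𝒢,
            A * (18 * (σ (K : Set ℝ) + ∑ G ∈ 𝒢 with G < K, σ (G : Set ℝ))) := by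
          gcongr 6 * (A * σ (I : Set ℝ)) + ?_
          rw [Finset.mul_sum]
          refine Finset.sum_le_sum fun K hK => ?_
          set N := ∑ G ∈ 𝒢 with G < K, σ (G : Set ℝ) with hNdef
          calc 3 * (A * (3 * σ (K : Set ℝ) + 9 * N))
              = A * (9 * σ (K : Set ℝ) + 18 * N + 9 * N) := by ring
            _ ≤ A * (9 * σ (K : Set ℝ) + 18 * N + 9 * σ (K : Set ℝ)) := by
                gcongr
                exact hN K hK
            _ = _ := by ring
      _ = _ := by
          rw [htot, ← Finset.mul_sum, ← Finset.mul_sum]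
          ring
  exact (ENNReal.mul_le_mul_iff_right two_ne_zero (by norm_num)).1 h3

open Classical in
/-- Forward testing on closed intervals. -/
theorem forward_testing (h : IsEnergyFamily D σ w 𝓕 𝒮 J F e) {T : ℝ≥0∞} (hT : Testing σ w T)
    {I : Interval} (hI : 0 < I.length) :
    ∑ t ∈ 𝒮 with J t ≤ I, e t * (∫⁻ y in (I : Set ℝ), kern (J t) y ∂σ) ^ 2 ≤
      5424 * (A2Const σ w + T ^ 2) * σ (I : Set ℝ) := by
  set A := A2Const σ w + T ^ 2 with hA
  set Z := 𝒮.filter fun t => F t ≤ I with hZ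
  have hZS : Z ⊆ 𝒮 := Finset.filter_subset _ _
  have hsplit : ∑ t ∈ 𝒮 with J t ≤ I, e t * (∫⁻ y in (I : Set ℝ), kern (J t) y ∂σ) ^ 2 ≤
      ∑ t ∈ 𝒮 with J t ≤ I ∧ ¬ F t ≤ I, e t * (∫⁻ y in (I : Set ℝ), kern (J t) y ∂σ) ^ 2 +
      ∑ t ∈ Z, e t * (∫⁻ y in (I : Set ℝ), kern (J t) y ∂σ) ^ 2 := by
    rw [← Finset.sum_filter_not_add_sum_filter _ fun t => F t ≤ I, Finset.filter_filter,
      Finset.filter_filter]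
    gcongr
    intro t ht
    have h1 := Finset.mem_filter.1 ht
    exact Finset.mem_filter.2 ⟨h1.1, h1.2.2⟩
  have hhole : ∑ t ∈ Z, e t * (∫⁻ y in (I : Set ℝ) \ F t, kern (J t) y ∂σ) ^ 2 ≤
      128 * A * (21 * σ (I : Set ℝ)) := by
    have h1 := h.sum_hole_le hT (Z.image F) hI (fun G hG => by
      obtain ⟨t, ht, rfl⟩ := Finset.mem_image.1 hG
      exact ⟨h.top_mem t (hZS ht), (Finset.mem_filter.1 ht).2⟩)
    have h2 := h.carleson.sum_le_of_interval h.grid h.null_left h.subset (I := I) (Z.image F)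
      (fun G hG => by
        obtain ⟨t, ht, rfl⟩ := Finset.mem_image.1 hG
        exact ⟨h.top_mem t (hZS ht), (Finset.mem_filter.1 ht).2⟩)
    calc _ ≤ ∑ t ∈ 𝒮 with F t ∈ Z.image F,
          e t * (∫⁻ y in (I : Set ℝ) \ F t, kern (J t) y ∂σ) ^ 2 := by
          refine Finset.sum_le_sum_of_subset fun t ht => ?_
          exact Finset.mem_filter.2 ⟨hZS ht, Finset.mem_image_of_mem F ht⟩
      _ ≤ _ := h1
      _ ≤ 128 * A * (3 * σ (I : Set ℝ) + 9 * (2 * σ (I : Set ℝ))) := by gcongr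
      _ = _ := by ring
  have hin : ∑ t ∈ Z, e t * (∫⁻ y in (I : Set ℝ), kern (J t) y ∂σ) ^ 2 ≤
      2 * (128 * A * (21 * σ (I : Set ℝ)) + 16 * A * σ (I : Set ℝ)) := by
    refine le_trans ?_ (mul_le_mul_right (add_le_add hhole (h.sum_plug_le hT)) 2)
    rw [← Finset.sum_add_distrib, Finset.mul_sum]
    refine Finset.sum_le_sum fun t ht => ?_
    have hsub : (I : Set ℝ) ⊆ ((I : Set ℝ) \ F t) ∪ (F t : Set ℝ) := fun y hy => by
      by_cases hyF : y ∈ (F t : Set ℝ)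
      · exact Or.inr hyF
      · exact Or.inl ⟨hy, hyF⟩
    calc e t * (∫⁻ y in (I : Set ℝ), kern (J t) y ∂σ) ^ 2
        ≤ e t * ((∫⁻ y in (I : Set ℝ) \ F t, kern (J t) y ∂σ) +
            ∫⁻ y in (F t : Set ℝ), kern (J t) y ∂σ) ^ 2 := by
          gcongr
          exact (lintegral_mono_set hsub).trans (lintegral_union_le _ _ _)
      _ ≤ e t * (2 * ((∫⁻ y in (I : Set ℝ) \ F t, kern (J t) y ∂σ) ^ 2 +
            (∫⁻ y in (F t : Set ℝ), kern (J t) y ∂σ) ^ 2)) := by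
          gcongr e t * ?_
          exact add_sq_le_two_mul _ _
      _ = _ := by ring
  calc _ ≤ _ := hsplit
    _ ≤ 16 * A * σ (I : Set ℝ) +
        2 * (128 * A * (21 * σ (I : Set ℝ)) + 16 * A * σ (I : Set ℝ)) :=
      add_le_add (h.sum_le_of_not_le hT hI) hin
    _ = 5424 * A * σ (I : Set ℝ) := by ring

end IsEnergyFamily

lemma IsEnergyFamily.weight_ne_top {D : Set Interval} {σ w : Measure ℝ}
    {𝓕 : Set Interval} {β : Type*} {𝒮 : Finset β} {J F : β → Interval} {e : β → ℝ≥0∞}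
    [IsLocallyFiniteMeasure w] (h : IsEnergyFamily D σ w 𝓕 𝒮 J F e) {t : β} (ht : t ∈ 𝒮) :
    e t ≠ ∞ := by
  refine ne_top_of_le_ne_top ?_ ((h.energy_self ht (J t).fst).trans
    (setLIntegral_sub_sq_le w (J t) ⟨le_rfl, (J t).fst_le_snd⟩ subset_rfl (measurableSet_coe _)))
  exact ENNReal.mul_ne_top ENNReal.ofReal_ne_top (measure_coe_lt_top w _).ne

open Classical in
/-- Forward testing on half-open intervals, which are the members of the auxiliary grids. -/
theorem IsEnergyFamily.forward_testing_Ico {D : Set Interval} {σ w : Measure ℝ}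
    {𝓕 : Set Interval} {β : Type*} {𝒮 : Finset β} {J F : β → Interval} {e : β → ℝ≥0∞}
    [IsLocallyFiniteMeasure σ] [IsLocallyFiniteMeasure w]
    (h : IsEnergyFamily D σ w 𝓕 𝒮 J F e) {T : ℝ≥0∞} (hT : Testing σ w T) {a b : ℝ} (hab : a < b) :
    ∑ t ∈ 𝒮 with (J t : Set ℝ) ⊆ Ico a b, e t * (∫⁻ y in Ico a b, kern (J t) y ∂σ) ^ 2 ≤
      5424 * (A2Const σ w + T ^ 2) * σ (Ico a b) := by
  set u : ℕ → ℝ := fun n => b - (b - a) / 2 * (1 / ((n : ℝ) + 1)) with hu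
  have hlim : Tendsto u atTop (𝓝 b) := by
    have := (tendsto_one_div_add_atTop_nhds_zero_nat (𝕜 := ℝ)).const_mul ((b - a) / 2)
    simpa [hu] using this.const_sub b
  have hau : ∀ n, a < u n := fun n => by
    have h1 : 1 / ((n : ℝ) + 1) ≤ 1 := by
      rw [div_le_one (by positivity)]; linarith [n.cast_nonneg (α := ℝ)]
    simp only [hu]
    nlinarith
  have hub : ∀ n, u n < b := fun n => by
    have h1 : 0 < 1 / ((n : ℝ) + 1) := by positivity
    simp only [hu]
    nlinarith
  have humono : Monotone u := fun m n hmn => by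
    have := Nat.one_div_le_one_div (α := ℝ) hmn
    simp only [hu]
    nlinarith
  have hUnion : ⋃ n, Icc a (u n) = Ico a b := by
    ext y
    simp only [mem_iUnion]
    constructor
    · rintro ⟨n, hn⟩
      exact ⟨hn.1, hn.2.trans_lt (hub n)⟩
    · intro hy
      obtain ⟨n, hn⟩ := (hlim.eventually (eventually_gt_nhds hy.2)).exists
      exact ⟨n, hy.1, hn.le⟩
  have hlt : ∀ f : ℝ → ℝ≥0∞, Tendsto (fun n => ∫⁻ y in Icc a (u n), f y ∂σ) atTop
      (𝓝 (∫⁻ y in Ico a b, f y ∂σ)) := by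
    intro f
    have hmono : Monotone fun n => Icc a (u n) := fun m n hmn => Icc_subset_Icc_right (humono hmn)
    rw [← hUnion, setLIntegral_iUnion_of_directed f hmono.directed_le]
    exact tendsto_atTop_iSup fun m n hmn => lintegral_mono_set (hmono hmn)
  set Z := 𝒮.filter fun t => (J t : Set ℝ) ⊆ Ico a b with hZ
  have hev : ∀ᶠ n in atTop, ∀ t ∈ Z, (J t).snd < u n := by
    rw [Filter.eventually_all_finset]
    intro t ht
    refine hlim.eventually (eventually_gt_nhds ?_)
    exact ((Finset.mem_filter.1 ht).2 ⟨(J t).fst_le_snd, le_rfl⟩).2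
  refine le_of_tendsto (tendsto_finsetSum _ fun t ht => ?_) (hev.mono fun n hn => ?_)
    (x := atTop) (f := fun n => ∑ t ∈ Z, e t * (∫⁻ y in Icc a (u n), kern (J t) y ∂σ) ^ 2)
  · have hfin : ∫⁻ y in Ico a b, kern (J t) y ∂σ ≠ ∞ :=
      setLIntegral_kern_ne_top σ ⟨(a, b), hab.le⟩ (J t)
        (h.length_pos (Finset.mem_filter.1 ht).1) Ico_subset_Icc_self
    exact ENNReal.Tendsto.const_mul (ENNReal.Tendsto.pow (hlt _))
      (Or.inr (h.weight_ne_top (Finset.mem_filter.1 ht).1))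
  · let I : Interval := ⟨(a, u n), (hau n).le⟩
    have h1 := h.forward_testing hT (I := I) (sub_pos.2 (hau n))
    calc ∑ t ∈ Z, e t * (∫⁻ y in Icc a (u n), kern (J t) y ∂σ) ^ 2
        ≤ ∑ t ∈ 𝒮 with J t ≤ I, e t * (∫⁻ y in (I : Set ℝ), kern (J t) y ∂σ) ^ 2 := by
          refine Finset.sum_le_sum_of_subset fun t ht => ?_
          have h2 := Finset.mem_filter.1 ht
          exact Finset.mem_filter.2 ⟨h2.1, (h2.2 ⟨le_rfl, (J t).fst_le_snd⟩).1, (hn t ht).le⟩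
      _ ≤ _ := h1
      _ ≤ _ := by
          gcongr
          exact Icc_subset_Ico_right (hub n)

/-! ### Dual testing -/

/-- The convolution of `w` with the kernel `(τ + |x|)⁻²`. -/
noncomputable def smoothing (w : Measure ℝ) (τ y : ℝ) : ℝ≥0∞ :=
  ∫⁻ x, ENNReal.ofReal (1 / (τ + |x - y|) ^ 2) ∂w

lemma measurable_smoothing (w : Measure ℝ) [SFinite w] (τ : ℝ) : Measurable (smoothing w τ) := by
  have : Measurable fun p : ℝ × ℝ => ENNReal.ofReal (1 / (τ + |p.2 - p.1|) ^ 2) := by fun_prop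
  exact this.lintegral_prod_right'

/-- On an interval of length `τ`, the smoothing is at most the kernel average over that interval. -/
lemma smoothing_le {w : Measure ℝ} {N : Interval} (hN : 0 < N.length) {y : ℝ}
    (hy : y ∈ (N : Set ℝ)) : smoothing w N.length y ≤ ∫⁻ x, kern N x ∂w := by
  refine lintegral_mono fun x => ENNReal.ofReal_le_ofReal ?_
  have h1 := infDist_le_abs (y := x) hy
  have h2 := Metric.infDist_nonneg (x := x) (s := (N : Set ℝ))
  gcongr

lemma lintegral_kern_le {J : Interval} (hJ : 0 < J.length) :
    ∫⁻ y, kern J y ≤ ENNReal.ofReal (8 / J.length) := by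
  set l := J.length with hl
  have hint : Integrable fun y : ℝ => 2 / l ^ 2 * (1 + (y / l - J.fst / l) ^ 2)⁻¹ := by
    refine Integrable.const_mul ?_ _
    exact (integrable_inv_one_add_sq.comp_sub_right (J.fst / l)).comp_div hJ.ne'
  have hval : ∫ y : ℝ, 2 / l ^ 2 * (1 + (y / l - J.fst / l) ^ 2)⁻¹ = 2 * Real.pi / l := by
    rw [integral_const_mul,
      Measure.integral_comp_div (fun y => (1 + (y - J.fst / l) ^ 2)⁻¹) l,
      integral_sub_right_eq_self (fun y => (1 + y ^ 2)⁻¹) (J.fst / l),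
      integral_univ_inv_one_add_sq, abs_of_pos hJ, smul_eq_mul]
    field_simp
  calc ∫⁻ y, kern J y ≤ ∫⁻ y : ℝ, ENNReal.ofReal (2 / l ^ 2 * (1 + (y / l - J.fst / l) ^ 2)⁻¹) := by
        refine lintegral_mono fun y => ENNReal.ofReal_le_ofReal ?_
        have h1 := abs_sub_le_infDist (I := J) (x := J.fst) (y := y) ⟨le_rfl, J.fst_le_snd⟩
        have h2 := Metric.infDist_nonneg (x := y) (s := (J : Set ℝ))
        set d := Metric.infDist y (J : Set ℝ)
        have h3 : (y - J.fst) ^ 2 ≤ (l + d) ^ 2 := by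
          rw [← sq_abs]; gcongr
        have e1 : 2 / l ^ 2 * (1 + (y / l - J.fst / l) ^ 2)⁻¹ = 2 / (l ^ 2 + (y - J.fst) ^ 2) := by
          field_simp
        rw [e1, div_le_div_iff₀ (by positivity) (by positivity)]
        nlinarith [mul_nonneg hJ.le h2]
    _ = ENNReal.ofReal (2 * Real.pi / l) := by
        rw [← hval, ofReal_integral_eq_lintegral_ofReal hint]
        exact Eventually.of_forall fun y => by positivity
    _ ≤ _ := by
        refine ENNReal.ofReal_le_ofReal ?_
        gcongr
        linarith [Real.pi_le_four]

/-- The `A₂` condition, averaged against the kernel of an interval of larger scale. -/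
lemma lintegral_kern_mul_smoothing_le (σ w : Measure ℝ)
    {J : Interval} (hJ : 0 < J.length) {τ : ℝ} (hτ : 0 < τ) (hτJ : τ ≤ J.length) :
    ENNReal.ofReal τ * ∫⁻ y, kern J y * smoothing w τ y ∂σ ≤
      A2Const σ w * ENNReal.ofReal (32 / J.length) := by
  let C : ℤ → Set ℝ := fun m => Ico (m • τ) ((m + 1) • τ)
  have hCm : ∀ m, MeasurableSet (C m) := fun m => measurableSet_Ico
  have hCd : Pairwise (Function.onFun Disjoint C) := by
    have := pairwise_disjoint_Ico_zsmul τ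
    exact this
  have hCU : ⋃ m, C m = univ := iUnion_Ico_zsmul hτ
  have hcell : ∀ m, ENNReal.ofReal τ * ∫⁻ y in C m, kern J y * smoothing w τ y ∂σ ≤
      A2Const σ w * (4 * ∫⁻ z in C m, kern J z) := by
    intro m
    have hle : m • τ ≤ (m + 1) • τ := by rw [add_zsmul, one_zsmul]; linarith
    let N : Interval := ⟨(m • τ, (m + 1) • τ), hle⟩
    have hNl : N.length = τ := by
      change (m + 1) • τ - m • τ = τ
      rw [add_zsmul, one_zsmul]; ring
    have hCN : C m ⊆ (N : Set ℝ) := Ico_subset_Icc_self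
    have hN : 0 < N.length := hNl ▸ hτ
    have hk : ∀ y ∈ C m, ENNReal.ofReal τ * kern J y ≤ 4 * ∫⁻ z in C m, kern J z := by
      intro y hy
      calc ENNReal.ofReal τ * kern J y = ∫⁻ _ in C m, kern J y := by
            rw [lintegral_const, Measure.restrict_apply_univ, Real.volume_Ico, mul_comm]
            congr 2
            exact hNl.symm
        _ ≤ ∫⁻ z in C m, 4 * kern J z := by
            refine setLIntegral_mono' (hCm m) fun z hz => ?_
            have h1 := kern_le_mul (I := J) (J := J) (x := z) (y := y) two_pos hJ ?_
            · refine h1.trans (le_of_eq ?_)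
              norm_num
            have h2 : Metric.infDist z (J : Set ℝ) ≤ Metric.infDist y (J : Set ℝ) + dist z y :=
              Metric.infDist_le_infDist_add_dist
            have h3 := abs_sub_le_length (hCN hz) (hCN hy)
            rw [Real.dist_eq] at h2
            have h4 := Metric.infDist_nonneg (x := y) (s := (J : Set ℝ))
            linarith
        _ = _ := lintegral_const_mul _ (measurable_kern J)
    have hA : (∫⁻ x, kern N x ∂w) * σ (C m) ≤ A2Const σ w := by
      calc (∫⁻ x, kern N x ∂w) * σ (C m)
          ≤ (∫⁻ x, kern N x ∂w) * (ENNReal.ofReal N.length * poisson σ N) := by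
            gcongr
            exact (measure_mono hCN).trans (measure_le_poisson σ hN)
        _ = poisson σ N * poisson w N := by rw [poisson_eq w]; ring
        _ ≤ _ := poisson_mul_poisson_le σ w hN
    calc ENNReal.ofReal τ * ∫⁻ y in C m, kern J y * smoothing w τ y ∂σ
        = ∫⁻ y in C m, (ENNReal.ofReal τ * kern J y) * smoothing w τ y ∂σ := by
          rw [← lintegral_const_mul' _ _ ENNReal.ofReal_ne_top]
          simp only [mul_assoc]
      _ ≤ ∫⁻ y in C m, (4 * ∫⁻ z in C m, kern J z) * ∫⁻ x, kern N x ∂w ∂σ := by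
          refine setLIntegral_mono' (hCm m) fun y hy => mul_le_mul' (hk y hy) ?_
          have := smoothing_le (w := w) hN (hCN hy)
          rwa [hNl] at this
      _ = (4 * ∫⁻ z in C m, kern J z) * ((∫⁻ x, kern N x ∂w) * σ (C m)) := by
          rw [lintegral_const, Measure.restrict_apply_univ, mul_assoc]
      _ ≤ (4 * ∫⁻ z in C m, kern J z) * A2Const σ w := by gcongr
      _ = _ := mul_comm _ _
  calc ENNReal.ofReal τ * ∫⁻ y, kern J y * smoothing w τ y ∂σ
      = ∑' m, ENNReal.ofReal τ * ∫⁻ y in C m, kern J y * smoothing w τ y ∂σ := by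
        rw [ENNReal.tsum_mul_left, ← lintegral_iUnion hCm hCd, hCU, Measure.restrict_univ]
    _ ≤ ∑' m, A2Const σ w * (4 * ∫⁻ z in C m, kern J z) := ENNReal.tsum_le_tsum hcell
    _ = A2Const σ w * (4 * ∫⁻ z, kern J z) := by
        rw [ENNReal.tsum_mul_left, ENNReal.tsum_mul_left, ← lintegral_iUnion hCm hCd, hCU,
          Measure.restrict_univ]
    _ ≤ A2Const σ w * (4 * ENNReal.ofReal (8 / J.length)) := by
        gcongr
        exact lintegral_kern_le hJ
    _ = _ := by
        congr 1
        rw [show (4 : ℝ≥0∞) = ENNReal.ofReal 4 by norm_num, ← ENNReal.ofReal_mul (by norm_num)]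
        congr 1
        ring

/-- Summing over the intervals of the grid of one scale amounts to smoothing `w` at this scale. -/
lemma sum_kern_le_smoothing {D : Set Interval} (hD : IsDyadicGrid D) {w : Measure ℝ}
    (hw : Admissible D w) {τ : ℝ} (hτ : 0 < τ) (Z : Finset Interval)
    (hZ : ∀ J ∈ Z, J ∈ D ∧ J.length = τ) (y : ℝ) :
    ∑ J ∈ Z, w (J : Set ℝ) * kern J y ≤ 4 * smoothing w τ y := by
  have hd : (Z : Set Interval).Pairwise fun I J => Nonoverlapping (id I) (id J) := by
    intro I hI J hJ hne
    have hI' := hZ I hI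
    have hJ' := hZ J hJ
    have hl : I.length = J.length := hI'.2.trans hJ'.2.symm
    rw [length_eq, length_eq] at hl
    rcases hD.trichotomy hI'.1 hJ'.1 with h | h | h
    · refine absurd ?_ hne
      have h1 : J.fst ≤ I.fst := h.1
      have h2 : I.snd ≤ J.snd := h.2
      exact NonemptyInterval.ext (Prod.ext (by linarith) (by linarith))
    · refine absurd ?_ hne
      have h1 : I.fst ≤ J.fst := h.1
      have h2 : J.snd ≤ I.snd := h.2
      exact NonemptyInterval.ext (Prod.ext (by linarith) (by linarith))
    · exact h
  calc ∑ J ∈ Z, w (J : Set ℝ) * kern J y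
      ≤ ∑ J ∈ Z, ∫⁻ x in (J : Set ℝ), 4 * ENNReal.ofReal (1 / (τ + |x - y|) ^ 2) ∂w := by
        refine Finset.sum_le_sum fun J hJ => ?_
        rw [mul_comm, ← setLIntegral_const]
        refine setLIntegral_mono' (measurableSet_coe J) fun x hx => ?_
        have h1 := abs_sub_le_infDist (y := y) hx
        have h2 := Metric.infDist_nonneg (x := y) (s := (J : Set ℝ))
        rw [kern, (hZ J hJ).2, show (4 : ℝ≥0∞) = ENNReal.ofReal 4 by norm_num,
          ← ENNReal.ofReal_mul (by norm_num)]
        refine ENNReal.ofReal_le_ofReal ?_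
        rw [(hZ J hJ).2, abs_sub_comm] at h1
        rw [mul_one_div, div_le_div_iff₀ (by positivity) (by positivity)]
        nlinarith [abs_nonneg (x - y)]
    _ ≤ ∫⁻ x in univ, 4 * ENNReal.ofReal (1 / (τ + |x - y|) ^ 2) ∂w :=
        sum_setLIntegral_le (L := id) (fun _ _ => subset_univ _)
          (fun J hJ => hw.nullEnds (hZ J hJ).1) hd _
    _ = _ := by rw [Measure.restrict_univ, lintegral_const_mul' _ _ (by norm_num)]; rfl

/-- The intervals of the grid of length at most `2 ^ k`, grouped by scale. -/
lemma tsum_kern_le_smoothing {D : Set Interval} (hD : IsDyadicGrid D) {w : Measure ℝ}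
    (hw : Admissible D w) (k : ℤ) (y : ℝ) :
    ∑' K : Interval, {K | K ∈ D ∧ K.length ≤ (2 : ℝ) ^ k}.indicator
        (fun K => ENNReal.ofReal (K.length ^ 2) * w (K : Set ℝ) * kern K y) K ≤
      4 * ∑' j : ℕ, ENNReal.ofReal (((2 : ℝ) ^ k / 2 ^ j) ^ 2) *
        smoothing w ((2 : ℝ) ^ k / 2 ^ j) y := by
  classical
  rw [ENNReal.tsum_eq_iSup_sum]
  refine iSup_le fun Z => ?_
  rw [Finset.sum_indicator_eq_sum_filter]
  set Z' := Z.filter fun K => K ∈ {K | K ∈ D ∧ K.length ≤ (2 : ℝ) ^ k} with hZ'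
  have hZ : ∀ K ∈ Z', K ∈ D ∧ K.length ≤ (2 : ℝ) ^ k := fun K hK => (Finset.mem_filter.1 hK).2
  have hex : ∀ K, ∃ j : ℕ, K ∈ Z' → K.length = (2 : ℝ) ^ k / 2 ^ j := by
    intro K
    by_cases hK : K ∈ Z'
    · obtain ⟨n, hn⟩ := hD.length_eq K (hZ K hK).1
      have h1 := (hZ K hK).2
      rw [hn] at h1
      have h2 : n ≤ k := (zpow_le_zpow_iff_right₀ one_lt_two).1 h1
      refine ⟨(k - n).toNat, fun _ => ?_⟩
      rw [hn, ← zpow_natCast, Int.toNat_of_nonneg (by omega), ← zpow_sub₀ two_ne_zero]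
      congr 1
      ring
    · exact ⟨0, fun h => absurd h hK⟩
  choose j hj using hex
  rw [← Finset.sum_fiberwise_of_maps_to (t := Z'.image j) (g := j)
    fun K hK => Finset.mem_image_of_mem j hK]
  calc _ ≤ ∑ i ∈ Z'.image j, 4 * (ENNReal.ofReal (((2 : ℝ) ^ k / 2 ^ i) ^ 2) *
        smoothing w ((2 : ℝ) ^ k / 2 ^ i) y) := by
        refine Finset.sum_le_sum fun i _ => ?_
        have h1 := sum_kern_le_smoothing hD hw (τ := (2 : ℝ) ^ k / 2 ^ i) (by positivity)
          (Z'.filter fun K => j K = i) (fun K hK => by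
            have := Finset.mem_filter.1 hK
            exact ⟨(hZ K this.1).1, this.2 ▸ hj K this.1⟩) y
        calc _ = ∑ K ∈ Z' with j K = i, ENNReal.ofReal (((2 : ℝ) ^ k / 2 ^ i) ^ 2) *
              (w (K : Set ℝ) * kern K y) := by
              refine Finset.sum_congr rfl fun K hK => ?_
              have := Finset.mem_filter.1 hK
              rw [← this.2, ← hj K this.1, mul_assoc]
          _ ≤ ENNReal.ofReal (((2 : ℝ) ^ k / 2 ^ i) ^ 2) *
              (4 * smoothing w ((2 : ℝ) ^ k / 2 ^ i) y) := by
              rw [← Finset.mul_sum]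
              gcongr
          _ = _ := by ring
    _ ≤ _ := by
        rw [← ENNReal.tsum_mul_left]
        exact ENNReal.sum_le_tsum _

/-- The Schur test for the dual inequality. The weight of `J t` is spread over the smaller intervals
`𝒥 t` of the grid, and these are summed scale by scale. -/
theorem lintegral_sum_kern_sq_le {D : Set Interval} (hD : IsDyadicGrid D) (σ : Measure ℝ)
    {w : Measure ℝ} [SFinite w] (hw : Admissible D w) {β : Type*} {E : Finset β}
    {J : β → Interval} (hJ : ∀ t ∈ E, J t ∈ D) {𝒥 : β → Set Interval}
    (h𝒥 : ∀ t ∈ E, ∀ K ∈ 𝒥 t, K ∈ D ∧ K ≤ J t)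
    (hdisj : ∀ t ∈ E, ∀ t' ∈ E, t ≠ t' → Disjoint (𝒥 t) (𝒥 t')) {a : Interval → ℝ≥0∞}
    (ha : ∀ K ∈ D, a K ≤ ENNReal.ofReal (K.length ^ 2) * w (K : Set ℝ)) {e : β → ℝ≥0∞}
    (he : ∀ t ∈ E, e t = ∑' K, (𝒥 t).indicator a K) :
    ∫⁻ y, (∑ t ∈ E, e t * kern (J t) y) ^ 2 ∂σ ≤ 2048 * A2Const σ w * ∑ t ∈ E, e t := by
  classical
  have hsmall : ∀ t ∈ E, ∀ y, ∑ t' ∈ E with (J t').length ≤ (J t).length,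
      e t' * kern (J t') y ≤ 16 * ∑' j : ℕ, ENNReal.ofReal (((J t).length / 2 ^ j) ^ 2) *
        smoothing w ((J t).length / 2 ^ j) y := by
    intro t ht y
    obtain ⟨k, hk⟩ := hD.length_eq (J t) (hJ t ht)
    set E' := E.filter fun t' => (J t').length ≤ (J t).length with hE'
    have hE : ∀ t' ∈ E', t' ∈ E ∧ (J t').length ≤ (2 : ℝ) ^ k := fun t' ht' =>
      hk ▸ Finset.mem_filter.1 ht'
    calc ∑ t' ∈ E', e t' * kern (J t') y
        ≤ ∑ t' ∈ E', ∑' K, 4 * ((𝒥 t').indicator a K * kern K y) := by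
          refine Finset.sum_le_sum fun t' ht' => ?_
          rw [he t' (hE t' ht').1, ← ENNReal.tsum_mul_right]
          refine ENNReal.tsum_le_tsum fun K => ?_
          by_cases hK : K ∈ 𝒥 t'
          · have hK' := h𝒥 t' (hE t' ht').1 K hK
            rw [mul_left_comm]
            gcongr
            refine (kern_le_mul (I := K) (J := J t') (x := y) (y := y) two_pos
              (hD.length_pos hK'.1) ?_).trans (le_of_eq (by norm_num))
            have h1 := abs_sub_le_infDist (y := y) (coe_subset hK'.2 (nonempty_coe K).some_mem)
            have h2 := infDist_le_abs (y := y) (nonempty_coe K).some_mem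
            have h3 := length_mono hK'.2
            have h4 := Metric.infDist_nonneg (x := y) (s := (J t' : Set ℝ))
            linarith
          · simp [hK]
      _ = ∑' K, ∑ t' ∈ E', 4 * ((𝒥 t').indicator a K * kern K y) :=
          (Summable.tsum_finsetSum fun _ _ => ENNReal.summable).symm
      _ ≤ ∑' K : Interval, 4 * {K | K ∈ D ∧ K.length ≤ (2 : ℝ) ^ k}.indicator
        (fun K => ENNReal.ofReal (K.length ^ 2) * w (K : Set ℝ) * kern K y) K := by
          refine ENNReal.tsum_le_tsum fun K => ?_
          by_cases hK : ∃ t' ∈ E', K ∈ 𝒥 t'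
          · obtain ⟨t', ht', hKt⟩ := hK
            have hK' := h𝒥 t' (hE t' ht').1 K hKt
            rw [Finset.sum_eq_single t', indicator_of_mem hKt, indicator_of_mem]
            · gcongr
              exact ha K hK'.1
            · exact ⟨hK'.1, (length_mono hK'.2).trans (hE t' ht').2⟩
            · intro t'' ht'' hne
              rw [indicator_of_notMem, zero_mul, mul_zero]
              exact fun h => disjoint_left.1
                (hdisj t'' (hE t'' ht'').1 t' (hE t' ht').1 hne) h hKt
            · exact fun h => absurd ht' h
          · rw [Finset.sum_eq_zero]
            · exact zero_le
            · intro t' ht'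
              rw [indicator_of_notMem fun h => hK ⟨t', ht', h⟩, zero_mul, mul_zero]
      _ ≤ 4 * (4 * ∑' j : ℕ, ENNReal.ofReal (((2 : ℝ) ^ k / 2 ^ j) ^ 2) *
            smoothing w ((2 : ℝ) ^ k / 2 ^ j) y) := by
          rw [ENNReal.tsum_mul_left]
          gcongr
          exact tsum_kern_le_smoothing hD hw k y
      _ = _ := by rw [hk]; ring
  have hgeom : ∑' j : ℕ, ENNReal.ofReal (1 / 2 ^ j) = 2 := by
    rw [← ENNReal.ofReal_tsum_of_nonneg (fun j => by positivity)]
    · have := tsum_geometric_two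
      simp only [one_div, inv_pow] at this ⊢
      rw [this]; norm_num
    · have := summable_geometric_two
      simpa only [one_div, inv_pow] using this
  have hterm : ∀ t ∈ E, ∫⁻ y, kern (J t) y * ∑' j : ℕ,
      ENNReal.ofReal (((J t).length / 2 ^ j) ^ 2) * smoothing w ((J t).length / 2 ^ j) y ∂σ ≤
      64 * A2Const σ w := by
    intro t ht
    have hpos := hD.length_pos (hJ t ht)
    set l := (J t).length with hl
    calc _ = ∑' j : ℕ, ∫⁻ y, ENNReal.ofReal ((l / 2 ^ j) ^ 2) *
          (kern (J t) y * smoothing w (l / 2 ^ j) y) ∂σ := by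
          rw [← lintegral_tsum]
          · refine lintegral_congr fun y => ?_
            rw [← ENNReal.tsum_mul_left]
            simp only [mul_left_comm]
          · intro j
            exact (((measurable_kern (J t)).mul
              (measurable_smoothing w _)).const_mul _).aemeasurable
      _ ≤ ∑' j : ℕ, ENNReal.ofReal (l / 2 ^ j) * (A2Const σ w * ENNReal.ofReal (32 / l)) := by
          refine ENNReal.tsum_le_tsum fun j => ?_
          have hjl : l / 2 ^ j ≤ l := div_le_self hpos.le (one_le_pow₀ one_le_two)
          have h1 := lintegral_kern_mul_smoothing_le σ w hpos (τ := l / 2 ^ j) (by positivity) hjl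
          rw [lintegral_const_mul' _ _ ENNReal.ofReal_ne_top, sq,
            ENNReal.ofReal_mul (by positivity), mul_assoc]
          gcongr
      _ = ∑' j : ℕ, 32 * A2Const σ w * ENNReal.ofReal (1 / 2 ^ j) := by
          refine tsum_congr fun j => ?_
          rw [mul_left_comm, ← ENNReal.ofReal_mul (by positivity),
            show l / 2 ^ j * (32 / l) = 32 * (1 / 2 ^ j) by field_simp,
            ENNReal.ofReal_mul (by norm_num)]
          norm_num
          ring
      _ = _ := by rw [ENNReal.tsum_mul_left, hgeom]; ring
  calc ∫⁻ y, (∑ t ∈ E, e t * kern (J t) y) ^ 2 ∂σ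
      ≤ ∫⁻ y, ∑ t ∈ E, 32 * e t * (kern (J t) y * ∑' j : ℕ,
          ENNReal.ofReal (((J t).length / 2 ^ j) ^ 2) *
            smoothing w ((J t).length / 2 ^ j) y) ∂σ := by
        refine lintegral_mono fun y => ?_
        refine (sum_sq_le_two_mul_sum_le E (fun t => e t * kern (J t) y)
          fun t => (J t).length).trans ?_
        rw [Finset.mul_sum]
        refine Finset.sum_le_sum fun t ht => ?_
        calc _ ≤ 2 * (e t * kern (J t) y * (16 * ∑' j : ℕ,
              ENNReal.ofReal (((J t).length / 2 ^ j) ^ 2) *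
                smoothing w ((J t).length / 2 ^ j) y)) := by
              gcongr
              exact hsmall t ht y
          _ = _ := by ring
    _ = ∑ t ∈ E, 32 * e t * ∫⁻ y, kern (J t) y * ∑' j : ℕ,
          ENNReal.ofReal (((J t).length / 2 ^ j) ^ 2) *
            smoothing w ((J t).length / 2 ^ j) y ∂σ := by
        have hm : ∀ t, Measurable fun y => kern (J t) y * ∑' j : ℕ,
          ENNReal.ofReal (((J t).length / 2 ^ j) ^ 2) *
            smoothing w ((J t).length / 2 ^ j) y := fun t =>
          (measurable_kern (J t)).mul
            (Measurable.tsum fun j => (measurable_smoothing w _).const_mul _)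
        rw [lintegral_finsetSum _ fun t _ => (hm t).const_mul _]
        exact Finset.sum_congr rfl fun t _ => lintegral_const_mul _ (hm t)
    _ ≤ ∑ t ∈ E, 32 * e t * (64 * A2Const σ w) := by
        refine Finset.sum_le_sum fun t ht => ?_
        gcongr
        exact hterm t ht
    _ = _ := by rw [← Finset.sum_mul, ← Finset.mul_sum]; ring

/-! ### Adjacent dyadic grids -/

/-- The half-open dyadic interval of length `2 ^ k` that contains `x`, in the grid of scale `k`
translated by `2 ^ k * θ k`. -/
def cell (θ : ℤ → ℝ) (k : ℤ) (x : ℝ) : Set ℝ := {y | ⌊y / 2 ^ k - θ k⌋ = ⌊x / 2 ^ k - θ k⌋}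

/-- The translations of consecutive scales are compatible: the cells of scale `k + 1` are unions of
cells of scale `k`. -/
def IsCompatible (θ : ℤ → ℝ) : Prop := ∀ k, ∃ n : ℤ, 2 * θ (k + 1) - θ k = n

lemma cell_eq_of_mem {θ : ℤ → ℝ} {k : ℤ} {x y : ℝ} (h : y ∈ cell θ k x) :
    cell θ k y = cell θ k x := by
  ext z
  rw [cell, cell, mem_ofPred_eq, mem_ofPred_eq, show ⌊y / 2 ^ k - θ k⌋ = _ from h]

lemma cell_eq_Ico (θ : ℤ → ℝ) (k : ℤ) (x : ℝ) :
    cell θ k x =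
      Ico (2 ^ k * (⌊x / 2 ^ k - θ k⌋ + θ k)) (2 ^ k * (⌊x / 2 ^ k - θ k⌋ + θ k + 1)) := by
  ext y
  have h2 : (0 : ℝ) < 2 ^ k := by positivity
  rw [cell, mem_ofPred_eq, Int.floor_eq_iff, mem_Ico, le_sub_iff_add_le, le_div_iff₀ h2,
    sub_lt_iff_lt_add, div_lt_iff₀ h2, mul_comm ((2 : ℝ) ^ k),
    mul_comm ((2 : ℝ) ^ k), add_right_comm]

lemma measurableSet_cell (θ : ℤ → ℝ) (k : ℤ) (x : ℝ) : MeasurableSet (cell θ k x) := by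
  rw [cell_eq_Ico]; exact measurableSet_Ico

lemma volume_real_cell (θ : ℤ → ℝ) (k : ℤ) (x : ℝ) : volume.real (cell θ k x) = 2 ^ k := by
  have h2 : (0 : ℝ) < 2 ^ k := by positivity
  rw [cell_eq_Ico, Real.volume_real_Ico_of_le] <;> nlinarith

lemma cell_subset_cell_succ {θ : ℤ → ℝ} (hθ : IsCompatible θ) (k : ℤ) (x : ℝ) :
    cell θ k x ⊆ cell θ (k + 1) x := by
  intro y hy
  obtain ⟨n, hn⟩ := hθ k
  have h : ∀ z : ℝ, ⌊z / 2 ^ (k + 1) - θ (k + 1)⌋ = (⌊z / 2 ^ k - θ k⌋ - n) / 2 := by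
    intro z
    have h1 : z / 2 ^ (k + 1) - θ (k + 1) = (z / 2 ^ k - θ k - n) / (2 : ℕ) := by
      rw [← hn, zpow_add_one₀ two_ne_zero]
      push_cast
      field_simp
      ring
    rw [h1, Int.floor_div_natCast, Int.floor_sub_intCast]
    rfl
  rw [cell, mem_ofPred_eq, h, h, show ⌊y / 2 ^ k - θ k⌋ = _ from hy]

lemma cell_mono {θ : ℤ → ℝ} (hθ : IsCompatible θ) {k l : ℤ} (hkl : k ≤ l) (x : ℝ) :
    cell θ k x ⊆ cell θ l x :=
  monotone_int_of_le_succ (f := fun k => cell θ k x) (fun k => cell_subset_cell_succ hθ k x) hkl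

lemma cell_nested {θ : ℤ → ℝ} (hθ : IsCompatible θ) (k l : ℤ) (x y : ℝ) :
    cell θ k x ⊆ cell θ l y ∨ cell θ l y ⊆ cell θ k x ∨ Disjoint (cell θ k x) (cell θ l y) := by
  by_cases h : Disjoint (cell θ k x) (cell θ l y)
  · exact Or.inr (Or.inr h)
  obtain ⟨z, hzx, hzy⟩ := not_disjoint_iff.1 h
  rw [← cell_eq_of_mem hzx, ← cell_eq_of_mem hzy]
  rcases le_total k l with hkl | hkl
  · exact Or.inl (cell_mono hθ hkl z)
  · exact Or.inr (Or.inl (cell_mono hθ hkl z))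

lemma ofReal_volume_cell (θ : ℤ → ℝ) (k : ℤ) (x : ℝ) :
    ENNReal.ofReal (1 / volume.real (cell θ k x) ^ 2) = 4 ^ (-k) := by
  have h1 : (1 : ℝ) / (2 ^ k) ^ 2 = (((4 : ℝ≥0) ^ (-k) : ℝ≥0) : ℝ) := by
    push_cast
    rw [one_div, zpow_neg, ← zpow_natCast, ← zpow_mul, mul_comm, zpow_mul]
    norm_num
  rw [volume_real_cell, h1, ENNReal.ofReal_coe_nnreal, ENNReal.coe_zpow four_ne_zero]
  rfl

/-- The cells that contain both `J` and `y` are at least as long as the distance between them, and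
there is at most one of each length. -/
lemma sum_cell_le (θ : ℤ → ℝ) {𝒦 : Finset (Set ℝ)}
    (h𝒦 : ∀ K ∈ 𝒦, ∃ k x, K = cell θ k x) {J : Interval} (hJ : 0 < J.length)
    (hJ𝒦 : ∀ K ∈ 𝒦, (J : Set ℝ) ⊆ K) (y : ℝ) :
    ∑ K ∈ 𝒦, ENNReal.ofReal (1 / volume.real K ^ 2) * K.indicator 1 y ≤ 2 * kern J y := by
  classical
  have e1 : ∑ K ∈ 𝒦, ENNReal.ofReal (1 / volume.real K ^ 2) * K.indicator 1 y =
      ∑ K ∈ 𝒦 with y ∈ K, ENNReal.ofReal (1 / volume.real K ^ 2) := by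
    rw [Finset.sum_filter]
    refine Finset.sum_congr rfl fun K _ => ?_
    by_cases hK : y ∈ K <;> simp [hK]
  rw [e1]
  set Z := 𝒦.filter fun K => y ∈ K with hZ
  have hsub : ∀ K ∈ Z, K ∈ 𝒦 ∧ y ∈ K := fun K hK => Finset.mem_filter.1 hK
  rcases Z.eq_empty_or_nonempty with h0 | h0
  · rw [h0]; simp
  have hk : ∀ K, ∃ k : ℤ, K ∈ Z → K = cell θ k y := by
    intro K
    by_cases hK : K ∈ Z
    · obtain ⟨k, x, hkx⟩ := h𝒦 K (hsub K hK).1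
      refine ⟨k, fun _ => ?_⟩
      have h1 : y ∈ cell θ k x := hkx ▸ (hsub K hK).2
      rw [cell_eq_of_mem h1, hkx]
    · exact ⟨0, fun h => absurd h hK⟩
  choose k hk using hk
  obtain ⟨K₀, hK₀, hmin⟩ := Z.exists_min_image k h0
  have hinj : Set.InjOn (fun K => -k K) Z := by
    intro K hK K' hK' h
    rw [hk K hK, hk K' hK', neg_inj.1 h]
  calc ∑ K ∈ Z, ENNReal.ofReal (1 / volume.real K ^ 2) = ∑ K ∈ Z, (4 : ℝ≥0∞) ^ (-k K) := by
        refine Finset.sum_congr rfl fun K hK => ?_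
        conv_lhs => rw [hk K hK]
        exact ofReal_volume_cell θ (k K) y
    _ = ∑ n ∈ Z.image fun K => -k K, (4 : ℝ≥0∞) ^ n := (Finset.sum_image hinj).symm
    _ ≤ 2 * 4 ^ (-k K₀) := by
        refine sum_zpow_le 4 (by norm_num) (by norm_num) _ _ fun n hn => ?_
        obtain ⟨K, hK, rfl⟩ := Finset.mem_image.1 hn
        exact neg_le_neg (hmin K hK)
    _ ≤ _ := by
        gcongr
        rw [← ofReal_volume_cell θ (k K₀) y, volume_real_cell, kern]
        refine ENNReal.ofReal_le_ofReal ?_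
        have hd := Metric.infDist_nonneg (x := y) (s := (J : Set ℝ))
        gcongr
        have hJK := hJ𝒦 K₀ (hsub K₀ hK₀).1
        have hy := (hsub K₀ hK₀).2
        rw [hk K₀ hK₀, cell_eq_Ico] at hJK
        rw [hk K₀ hK₀, cell_eq_Ico] at hy
        set u : ℝ := 2 ^ k K₀ * (⌊y / 2 ^ k K₀ - θ (k K₀)⌋ + θ (k K₀)) with hu
        have hv : (2 : ℝ) ^ k K₀ * (⌊y / 2 ^ k K₀ - θ (k K₀)⌋ + θ (k K₀) + 1) = u + 2 ^ k K₀ := by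
          rw [hu]; ring
        rw [hv] at hJK hy
        have h1 := hJK (show J.fst ∈ (J : Set ℝ) from ⟨le_rfl, J.fst_le_snd⟩)
        have h2 := hJK (show J.snd ∈ (J : Set ℝ) from ⟨J.fst_le_snd, le_rfl⟩)
        have h3 := infDist_le_abs (y := y) (show J.fst ∈ (J : Set ℝ) from ⟨le_rfl, J.fst_le_snd⟩)
        have h4 := infDist_le_abs (y := y) (show J.snd ∈ (J : Set ℝ) from ⟨J.fst_le_snd, le_rfl⟩)
        rw [length_eq] at hJ ⊢
        by_cases h5 : y ∈ (J : Set ℝ)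
        · have h6 : Metric.infDist y (J : Set ℝ) = 0 := Metric.infDist_zero_of_mem h5
          linarith [h1.1, h2.2]
        · rcases lt_or_ge y J.fst with h6 | h6
          · rw [abs_of_neg (by linarith)] at h3
            linarith [hy.1, h2.2]
          · have h7 : J.snd < y := by
              by_contra h8
              exact h5 ⟨h6, not_lt.1 h8⟩
            rw [abs_of_pos (by linarith)] at h4
            linarith [hy.2, h1.1]

open Classical in
/-- The sum over the scales in `S` of the normalized integrals of `h` over the cells that contain
`J`. -/
noncomputable def cellSum (θ : ℤ → ℝ) (S : Finset ℤ) (σ : Measure ℝ) (h : ℝ → ℝ≥0∞) (J : Interval) :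
    ℝ≥0∞ :=
  ∑ k ∈ S with (J : Set ℝ) ⊆ cell θ k J.fst, 4 ^ (-k) * ∫⁻ y in cell θ k J.fst, h y ∂σ

open Classical in
/-- The two-weight inequality for a discrete Poisson operator, from forward and dual testing of
`kern`. -/
lemma sum_cellSum_sq_le {θ : ℤ → ℝ} (hθ : IsCompatible θ) (S : Finset ℤ) {σ : Measure ℝ}
    [IsLocallyFiniteMeasure σ] {h : ℝ → ℝ≥0∞} (hh : AEMeasurable h σ)
    (hh2 : ∫⁻ y, h y ^ 2 ∂σ ≠ ∞) {β : Type*} {𝒮 : Finset β} {J : β → Interval}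
    (hJ : ∀ t ∈ 𝒮, 0 < (J t).length) {e : β → ℝ≥0∞} (he : ∀ t ∈ 𝒮, e t ≠ ∞) {A : ℝ≥0∞}
    (fwd : ∀ k x, ∑ t ∈ 𝒮 with (J t : Set ℝ) ⊆ cell θ k x,
      e t * (∫⁻ y in cell θ k x, kern (J t) y ∂σ) ^ 2 ≤ A * σ (cell θ k x))
    (dual : ∀ E ⊆ 𝒮, ∫⁻ y, (∑ t ∈ E, e t * kern (J t) y) ^ 2 ∂σ ≤ A * ∑ t ∈ E, e t) :
    ∑ t ∈ 𝒮, e t * cellSum θ S σ h (J t) ^ 2 ≤ 9600 * A * ∫⁻ y, h y ^ 2 ∂σ := by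
  classical
  set 𝒦 : Finset (Set ℝ) := (𝒮 ×ˢ S).image fun p => cell θ p.2 (J p.1).fst with h𝒦
  have hcell : ∀ K ∈ 𝒦, ∃ k x, K = cell θ k x := by
    intro K hK
    obtain ⟨p, _, rfl⟩ := Finset.mem_image.1 hK
    exact ⟨_, _, rfl⟩
  have hmeas : ∀ K ∈ 𝒦, MeasurableSet K := by
    intro K hK
    obtain ⟨k, x, rfl⟩ := hcell K hK
    exact measurableSet_cell θ k x
  have hfin : ∀ K ∈ 𝒦, σ K ≠ ∞ := by
    intro K hK
    obtain ⟨k, x, rfl⟩ := hcell K hK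
    rw [cell_eq_Ico]
    exact (lt_of_le_of_lt (measure_mono Ico_subset_Icc_self) isCompact_Icc.measure_lt_top).ne
  set lam : Set ℝ → ℝ≥0∞ := fun K => ENNReal.ofReal (1 / volume.real K ^ 2) with hlam
  have hker : ∀ t ∈ 𝒮, ∀ y, ∀ 𝒦' ⊆ 𝒦, (∀ K ∈ 𝒦', (J t : Set ℝ) ⊆ K) →
      ∑ K ∈ 𝒦', lam K * K.indicator 1 y ≤ 2 * kern (J t) y := fun t ht y 𝒦' h1 h2 =>
    sum_cell_le θ (fun K hK => hcell K (h1 hK)) (hJ t ht) h2 y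
  have key := sum_sq_le_of_testing (σ := σ) (h := h) (e := e) (𝒮 := 𝒮) (B := fun t => (J t : Set ℝ))
    (𝒦 := 𝒦) (lam := lam) (A := 4 * A) hmeas ?_ hfin (fun t _ => nonempty_coe (J t)) he
    (fun K => ENNReal.ofReal_ne_top) hh ?_ ?_ ?_
  · calc _ ≤ ∑ t ∈ 𝒮, e t * (∑ K ∈ 𝒦 with (J t : Set ℝ) ⊆ K, lam K * ∫⁻ y in K, h y ∂σ) ^ 2 := by
          refine Finset.sum_le_sum fun t ht => ?_
          gcongr
          have hinj : Set.InjOn (fun k => cell θ k (J t).fst)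
              (S.filter fun k => (J t : Set ℝ) ⊆ cell θ k (J t).fst) := by
            intro k _ l _ hkl
            have h1 := congrArg volume.real hkl
            rw [volume_real_cell, volume_real_cell] at h1
            exact zpow_right_injective₀ two_pos (by norm_num) h1
          calc cellSum θ S σ h (J t)
              = ∑ K ∈ (S.filter fun k => (J t : Set ℝ) ⊆ cell θ k (J t).fst).image
                  fun k => cell θ k (J t).fst, lam K * ∫⁻ y in K, h y ∂σ := by
                rw [Finset.sum_image hinj, cellSum]
                refine Finset.sum_congr rfl fun k _ => ?_
                rw [hlam, ← ofReal_volume_cell θ k (J t).fst]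
            _ ≤ _ := by
                refine Finset.sum_le_sum_of_subset fun K hK => ?_
                obtain ⟨k, hk, rfl⟩ := Finset.mem_image.1 hK
                have hk' := Finset.mem_filter.1 hk
                exact Finset.mem_filter.2 ⟨Finset.mem_image.2
                  ⟨(t, k), Finset.mem_product.2 ⟨ht, hk'.1⟩, rfl⟩, hk'.2⟩
      _ ≤ _ := key
      _ = _ := by ring
  · intro K hK K' hK'
    obtain ⟨k, x, rfl⟩ := hcell K hK
    obtain ⟨l, y, rfl⟩ := hcell K' hK'
    exact cell_nested hθ k l x y
  · intro K hK
    have h1 := lintegral_mul_sq_le (σ.restrict K) (f := h) (g := fun _ => 1) hh.restrict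
      aemeasurable_const
    simp only [mul_one, one_pow, lintegral_const, Measure.restrict_apply_univ, one_mul] at h1
    have h2 : (∫⁻ y in K, h y ^ 2 ∂σ) * σ K ≠ ∞ :=
      ENNReal.mul_ne_top (ne_top_of_le_ne_top hh2 (setLIntegral_le_lintegral _ _)) (hfin K hK)
    intro h3
    rw [h3] at h1
    exact h2 (top_le_iff.1 (le_trans (by simp) h1))
  · intro H hH
    obtain ⟨k, x, rfl⟩ := hcell H hH
    refine le_trans ?_ (le_trans (mul_le_mul_right (fwd k x) 4) (le_of_eq (by ring)))
    rw [Finset.mul_sum]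
    refine Finset.sum_le_sum fun t ht => ?_
    have ht' := Finset.mem_filter.1 ht
    calc _ ≤ e t * (2 * ∫⁻ y in cell θ k x, kern (J t) y ∂σ) ^ 2 := by
          gcongr
          rw [← lintegral_const_mul _ (measurable_kern _)]
          calc _ = ∑ K ∈ 𝒦 with (J t : Set ℝ) ⊆ K ∧ K ⊆ cell θ k x,
                ∫⁻ y in cell θ k x, lam K * K.indicator 1 y ∂σ := by
                refine Finset.sum_congr rfl fun K hK => ?_
                have hK' := Finset.mem_filter.1 hK
                rw [lintegral_const_mul' _ _ ENNReal.ofReal_ne_top,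
                  lintegral_indicator_one (hmeas K hK'.1),
                  Measure.restrict_apply (hmeas K hK'.1), inter_eq_self_of_subset_left hK'.2.2]
            _ = ∫⁻ y in cell θ k x, ∑ K ∈ 𝒦 with (J t : Set ℝ) ⊆ K ∧ K ⊆ cell θ k x,
                lam K * K.indicator 1 y ∂σ := by
                rw [lintegral_finsetSum]
                intro K hK
                exact (measurable_one.indicator (hmeas K (Finset.mem_filter.1 hK).1)).const_mul _
            _ ≤ _ := lintegral_mono fun y => hker t ht'.1 y _ (Finset.filter_subset _ _)
                fun K hK => (Finset.mem_filter.1 hK).2.1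
      _ = _ := by ring
  · intro E hE
    calc _ ≤ ∫⁻ y, 4 * (∑ t ∈ E, e t * kern (J t) y) ^ 2 ∂σ := by
          refine lintegral_mono fun y => ?_
          calc _ ≤ (∑ t ∈ E, e t * (2 * kern (J t) y)) ^ 2 := by
                gcongr with t ht
                exact hker t (hE ht) y _ (Finset.filter_subset _ _)
                  fun K hK => (Finset.mem_filter.1 hK).2
            _ = (2 * ∑ t ∈ E, e t * kern (J t) y) ^ 2 := by
                rw [Finset.mul_sum]
                simp only [mul_left_comm]
            _ = _ := by ring
      _ = 4 * ∫⁻ y, (∑ t ∈ E, e t * kern (J t) y) ^ 2 ∂σ := lintegral_const_mul' _ _ (by norm_num)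
      _ ≤ 4 * (A * ∑ t ∈ E, e t) := by gcongr; exact dual E hE
      _ = _ := by ring

/-- The translations `0` (for `i = 0`) and `± 1 / 3` (for `i = 1`), the sign alternating with the
scale so that the grids are nested. -/
noncomputable def thirds (i : Fin 2) (k : ℤ) : ℝ := (i : ℕ) * (if Even k then 1 / 3 else -1 / 3)

lemma isCompatible_thirds (i : Fin 2) : IsCompatible (thirds i) := by
  intro k
  fin_cases i
  · exact ⟨0, by simp [thirds]⟩
  · by_cases hk : Even k
    · refine ⟨-1, ?_⟩
      have : ¬ Even (k + 1) := by rw [Int.even_add_one]; simpa using hk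
      simp [thirds, hk, this]
      norm_num
    · refine ⟨1, ?_⟩
      have : Even (k + 1) := by rw [Int.even_add_one]; exact hk
      simp [thirds, hk, this]
      norm_num

/-- An interval of length at most `2 ^ k / 3` is contained in a cell of scale `k` of one of two
grids. -/
lemma exists_mem_cell {p q : ℝ} (hpq : p ≤ q) {k : ℤ} (h : 3 * (q - p) ≤ 2 ^ k) :
    ∃ i, ∀ z ∈ Icc p q, z ∈ cell (thirds i) k p := by
  have h2 : (0 : ℝ) < 2 ^ k := by positivity
  have hdiv : ∀ z ∈ Icc p q, p / 2 ^ k ≤ z / 2 ^ k ∧ 3 * (z / 2 ^ k - p / 2 ^ k) ≤ 1 := by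
    intro z hz
    refine ⟨by gcongr; exact hz.1, ?_⟩
    rw [← sub_div, ← mul_div_assoc, div_le_one h2]
    linarith [hz.2]
  set u := p / 2 ^ k with hu
  by_cases hc : q / 2 ^ k < ⌊u⌋ + 1
  · refine ⟨0, fun z hz => ?_⟩
    have h3 := hdiv z hz
    have h4 : z / 2 ^ k ≤ q / 2 ^ k := by gcongr; exact hz.2
    simp only [cell, thirds, mem_ofPred_eq, Fin.val_zero, Nat.cast_zero, zero_mul, sub_zero]
    rw [Int.floor_eq_iff]
    exact ⟨(Int.floor_le u).trans h3.1, h4.trans_lt hc⟩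
  · -- the interval contains the endpoint `2 ^ k * (⌊u⌋ + 1)` of the grid that is not translated
    refine ⟨1, fun z hz => ?_⟩
    have hq := hdiv q ⟨hpq, le_rfl⟩
    have h3 := hdiv z hz
    have h4 : z / 2 ^ k ≤ q / 2 ^ k := by gcongr; exact hz.2
    have h5 := Int.lt_floor_add_one u
    simp only [cell, thirds, mem_ofPred_eq, Fin.val_one, Nat.cast_one, one_mul]
    push Not at hc
    split_ifs
    · have e : ∀ v : ℝ, (⌊u⌋ : ℝ) + 1 - 1 / 3 ≤ v → v < ⌊u⌋ + 1 + 1 / 3 → ⌊v - 1 / 3⌋ = ⌊u⌋ := by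
        intro v h6 h7
        rw [Int.floor_eq_iff]
        constructor <;> linarith
      rw [e _ (by linarith) (by linarith), e _ (by linarith) (by linarith)]
    · have e : ∀ v : ℝ, (⌊u⌋ : ℝ) + 1 - 1 / 3 ≤ v → v < ⌊u⌋ + 1 + 1 / 3 →
          ⌊v - -1 / 3⌋ = ⌊u⌋ + 1 := by
        intro v h6 h7
        rw [Int.floor_eq_iff]
        push_cast
        constructor <;> linarith
      rw [e _ (by linarith) (by linarith), e _ (by linarith) (by linarith)]

open Classical in
/-- The kernel is dominated by the sum of its discrete versions over the two grids: the cell is one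
whose length is comparable to the distance between `J` and `y`. -/
lemma kern_le_sum_cell {J : Interval} (hJ : 0 < J.length) (y : ℝ) :
    kern J y ≤ 36 * ∑ i, ∑' k : ℤ, if (J : Set ℝ) ⊆ cell (thirds i) k J.fst then
      4 ^ (-k) * (cell (thirds i) k J.fst).indicator 1 y else 0 := by
  set R := J.length + Metric.infDist y (J : Set ℝ) with hR
  have hRpos : 0 < R := add_pos_of_pos_of_nonneg hJ Metric.infDist_nonneg
  obtain ⟨n, hn, hn'⟩ := exists_mem_Ioc_zpow (x := 3 * R) (y := (2 : ℝ)) (by positivity) one_lt_two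
  -- the hull of `J` and `y`
  have hhull : max J.snd y - min J.fst y ≤ R := by
    have h2 := abs_sub_le_infDist (y := y) (show J.fst ∈ (J : Set ℝ) from ⟨le_rfl, J.fst_le_snd⟩)
    have h3 := abs_sub_le_infDist (y := y) (show J.snd ∈ (J : Set ℝ) from ⟨J.fst_le_snd, le_rfl⟩)
    have h4 := Metric.infDist_nonneg (x := y) (s := (J : Set ℝ))
    have h5 := J.fst_le_snd
    have e := length_eq J
    rcases max_cases J.snd y with ⟨ha, hb⟩ | ⟨ha, hb⟩ <;>
    rcases min_cases J.fst y with ⟨hc, hd⟩ | ⟨hc, hd⟩ <;> rw [ha, hc] <;>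
    linarith [neg_abs_le (y - J.fst), le_abs_self (y - J.fst), neg_abs_le (y - J.snd),
      le_abs_self (y - J.snd), neg_abs_le (J.snd - y), le_abs_self (J.snd - y),
      neg_abs_le (J.fst - y), le_abs_self (J.fst - y)]
  obtain ⟨i, hi⟩ := exists_mem_cell (p := min J.fst y) (q := max J.snd y) (k := n + 1)
    ((min_le_left _ _).trans (J.fst_le_snd.trans (le_max_left _ _))) (by linarith)
  have hmem : ∀ z ∈ Icc (min J.fst y) (max J.snd y), z ∈ cell (thirds i) (n + 1) J.fst := by
    intro z hz
    rw [cell_eq_of_mem (hi J.fst ⟨min_le_left _ _, J.fst_le_snd.trans (le_max_left _ _)⟩)]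
    exact hi z hz
  have hy := hmem y ⟨min_le_right _ _, le_max_right _ _⟩
  have hJK : (J : Set ℝ) ⊆ cell (thirds i) (n + 1) J.fst := fun z hz =>
    hmem z ⟨(min_le_left _ _).trans hz.1, hz.2.trans (le_max_left _ _)⟩
  calc kern J y ≤ 36 * 4 ^ (-(n + 1)) := by
        rw [← ofReal_volume_cell (thirds i) (n + 1) J.fst, volume_real_cell, kern,
          show (36 : ℝ≥0∞) = ENNReal.ofReal 36 by norm_num, ← ENNReal.ofReal_mul (by norm_num)]
        refine ENNReal.ofReal_le_ofReal ?_
        have h2 : (0 : ℝ) < 2 ^ n := by positivity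
        rw [← hR, zpow_add_one₀ two_ne_zero, mul_one_div, div_le_div_iff₀ (by positivity)
          (by positivity)]
        nlinarith
    _ ≤ _ := by
        gcongr
        refine le_trans ?_ (Finset.single_le_sum (fun _ _ => zero_le) (Finset.mem_univ i))
        refine le_trans ?_ (ENNReal.le_tsum (n + 1))
        rw [if_pos hJK, indicator_of_mem hy, Pi.one_apply, mul_one]

open Classical in
lemma tendsto_cellSum (θ : ℤ → ℝ) (σ : Measure ℝ) (h : ℝ → ℝ≥0∞) (J : Interval) :
    Tendsto (fun S => cellSum θ S σ h J) atTop
      (𝓝 (∑' k : ℤ, if (J : Set ℝ) ⊆ cell θ k J.fst then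
        4 ^ (-k) * ∫⁻ y in cell θ k J.fst, h y ∂σ else 0)) := by
  simp only [cellSum, Finset.sum_filter]
  exact ENNReal.summable.hasSum

open Classical in
lemma lintegral_mul_kern_le {σ : Measure ℝ} {h : ℝ → ℝ≥0∞} (hh : AEMeasurable h σ) {J : Interval}
    (hJ : 0 < J.length) :
    ∫⁻ y, h y * kern J y ∂σ ≤ 36 * ∑ i, ∑' k : ℤ, if (J : Set ℝ) ⊆ cell (thirds i) k J.fst then
      4 ^ (-k) * ∫⁻ y in cell (thirds i) k J.fst, h y ∂σ else 0 := by
  set f : Fin 2 → ℤ → ℝ → ℝ≥0∞ := fun i k y => if (J : Set ℝ) ⊆ cell (thirds i) k J.fst then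
    4 ^ (-k) * (cell (thirds i) k J.fst).indicator h y else 0 with hf
  have hm : ∀ i k, AEMeasurable (f i k) σ := by
    intro i k
    by_cases hc : (J : Set ℝ) ⊆ cell (thirds i) k J.fst
    · simp only [hf, if_pos hc]
      exact (hh.indicator (measurableSet_cell _ _ _)).const_mul _
    · simp only [hf, if_neg hc]
      exact aemeasurable_const
  calc ∫⁻ y, h y * kern J y ∂σ ≤ ∫⁻ y, 36 * ∑ i, ∑' k : ℤ, f i k y ∂σ := by
        refine lintegral_mono fun y => ?_
        refine (mul_le_mul_right (kern_le_sum_cell hJ y) _).trans (le_of_eq ?_)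
        rw [mul_left_comm, Finset.mul_sum]
        congr 1
        refine Finset.sum_congr rfl fun i _ => ?_
        rw [← ENNReal.tsum_mul_left]
        refine tsum_congr fun k => ?_
        simp only [hf]
        split_ifs
        · by_cases hy : y ∈ cell (thirds i) k J.fst
          · simp [hy, mul_comm]
          · simp [hy]
        · simp
    _ = 36 * ∑ i, ∑' k : ℤ, ∫⁻ y, f i k y ∂σ := by
        rw [lintegral_const_mul' _ _ (by norm_num),
          lintegral_finsetSum' _ fun i _ => AEMeasurable.tsum (hm i)]
        congr 1
        exact Finset.sum_congr rfl fun i _ => lintegral_tsum (hm i)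
    _ = _ := by
        congr 1
        refine Finset.sum_congr rfl fun i _ => tsum_congr fun k => ?_
        simp only [hf]
        split_ifs
        · rw [lintegral_const_mul'' _ (hh.indicator (measurableSet_cell _ _ _)),
            lintegral_indicator (measurableSet_cell _ _ _)]
        · simp

open Classical in
/-- The two-weight inequality for the operator with kernel `kern`, from forward and dual testing. -/
theorem sum_lintegral_kern_sq_le {σ : Measure ℝ}
    [IsLocallyFiniteMeasure σ] {h : ℝ → ℝ≥0∞} (hh : AEMeasurable h σ)
    (hh2 : ∫⁻ y, h y ^ 2 ∂σ ≠ ∞) {β : Type*} {𝒮 : Finset β} {J : β → Interval}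
    (hJ : ∀ t ∈ 𝒮, 0 < (J t).length) {e : β → ℝ≥0∞} (he : ∀ t ∈ 𝒮, e t ≠ ∞) {A : ℝ≥0∞}
    (fwd : ∀ a b : ℝ, a < b → ∑ t ∈ 𝒮 with (J t : Set ℝ) ⊆ Ico a b,
      e t * (∫⁻ y in Ico a b, kern (J t) y ∂σ) ^ 2 ≤ A * σ (Ico a b))
    (dual : ∀ E ⊆ 𝒮, ∫⁻ y, (∑ t ∈ E, e t * kern (J t) y) ^ 2 ∂σ ≤ A * ∑ t ∈ E, e t) :
    ∑ t ∈ 𝒮, e t * (∫⁻ y, h y * kern (J t) y ∂σ) ^ 2 ≤ 49766400 * A * ∫⁻ y, h y ^ 2 ∂σ := by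
  set Φ : Fin 2 → Interval → ℝ≥0∞ := fun i J => ∑' k : ℤ,
    if (J : Set ℝ) ⊆ cell (thirds i) k J.fst then
      4 ^ (-k) * ∫⁻ y in cell (thirds i) k J.fst, h y ∂σ else 0 with hΦ
  have hgrid : ∀ i, ∑ t ∈ 𝒮, e t * Φ i (J t) ^ 2 ≤ 9600 * A * ∫⁻ y, h y ^ 2 ∂σ := by
    intro i
    refine le_of_tendsto' (x := atTop)
      (f := fun S => ∑ t ∈ 𝒮, e t * cellSum (thirds i) S σ h (J t) ^ 2)
      (tendsto_finsetSum _ fun t ht => ?_) fun S =>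
      sum_cellSum_sq_le (isCompatible_thirds i) S hh hh2 hJ he (fun k x => ?_) dual
    · exact ENNReal.Tendsto.const_mul (ENNReal.Tendsto.pow (tendsto_cellSum _ σ h (J t)))
        (Or.inr (he t ht))
    · have h2 : (0 : ℝ) < 2 ^ k := by positivity
      simp only [cell_eq_Ico]
      exact fwd _ _ (by nlinarith)
  calc ∑ t ∈ 𝒮, e t * (∫⁻ y, h y * kern (J t) y ∂σ) ^ 2
      ≤ ∑ t ∈ 𝒮, 2592 * (e t * Φ 0 (J t) ^ 2 + e t * Φ 1 (J t) ^ 2) := by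
        refine Finset.sum_le_sum fun t ht => ?_
        calc _ ≤ e t * (36 * (Φ 0 (J t) + Φ 1 (J t))) ^ 2 := by
              gcongr
              have := lintegral_mul_kern_le hh (hJ t ht)
              rwa [Fin.sum_univ_two] at this
          _ = 1296 * (e t * (Φ 0 (J t) + Φ 1 (J t)) ^ 2) := by ring
          _ ≤ 1296 * (e t * (2 * (Φ 0 (J t) ^ 2 + Φ 1 (J t) ^ 2))) := by
              gcongr
              exact add_sq_le_two_mul _ _
          _ = _ := by ring
    _ ≤ 2592 * (9600 * A * ∫⁻ y, h y ^ 2 ∂σ + 9600 * A * ∫⁻ y, h y ^ 2 ∂σ) := by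
        rw [← Finset.mul_sum, Finset.sum_add_distrib]
        gcongr
        · exact hgrid 0
        · exact hgrid 1
    _ = _ := by ring

/-- The two-weight inequality for an energy family whose weights are spread over smaller intervals
of the grid. -/
theorem IsEnergyFamily.sum_lintegral_kern_sq_le {D : Set Interval} {σ w : Measure ℝ}
    {𝓕 : Set Interval} {β : Type*} {𝒮 : Finset β} {J F : β → Interval} {e : β → ℝ≥0∞}
    [IsLocallyFiniteMeasure σ] [IsLocallyFiniteMeasure w]
    (H : IsEnergyFamily D σ w 𝓕 𝒮 J F e) {T : ℝ≥0∞} (hT : Testing σ w T) {𝒥 : β → Set Interval}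
    (h𝒥 : ∀ t ∈ 𝒮, ∀ K ∈ 𝒥 t, K ∈ D ∧ K ≤ J t)
    (hdisj : ∀ t ∈ 𝒮, ∀ t' ∈ 𝒮, t ≠ t' → Disjoint (𝒥 t) (𝒥 t')) {a : Interval → ℝ≥0∞}
    (ha : ∀ K ∈ D, a K ≤ ENNReal.ofReal (K.length ^ 2) * w (K : Set ℝ))
    (hea : ∀ t ∈ 𝒮, e t = ∑' K, (𝒥 t).indicator a K) {h : ℝ → ℝ≥0∞} (hh : AEMeasurable h σ)
    (hh2 : ∫⁻ y, h y ^ 2 ∂σ ≠ ∞) :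
    ∑ t ∈ 𝒮, e t * (∫⁻ y, h y * kern (J t) y ∂σ) ^ 2 ≤
      49766400 * (5424 * (A2Const σ w + T ^ 2)) * ∫⁻ y, h y ^ 2 ∂σ := by
  refine FunctionalEnergy.sum_lintegral_kern_sq_le hh hh2 (fun t ht => H.length_pos ht)
    (fun t ht => H.weight_ne_top ht) (fun a b hab => H.forward_testing_Ico hT hab) fun E hE => ?_
  refine (lintegral_sum_kern_sq_le H.grid σ H.null_right (fun t ht => H.mem t (hE ht))
    (fun t ht => h𝒥 t (hE ht)) (fun t ht t' ht' => hdisj t (hE ht) t' (hE ht')) ha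
    (fun t ht => hea t (hE ht))).trans ?_
  gcongr
  · norm_num
  · exact le_self_add

/-! ### Haar functions -/

lemma eq_of_le_of_length_le {I J : Interval} (h : I ≤ J)
    (hl : J.length ≤ I.length) : I = J := by
  have h1 : J.fst ≤ I.fst := h.1
  have h2 : I.snd ≤ J.snd := h.2
  rw [FunctionalEnergy.length_eq, FunctionalEnergy.length_eq] at hl
  exact NonemptyInterval.ext (Prod.ext (by linarith) (by linarith))

/-- The intervals of the grid of half the length of `I` that meet the interior of `I` lie in `I`. -/
lemma IsDyadicGrid.exists_half {D : Set Interval} (hD : IsDyadicGrid D) {I : Interval} (hI : I ∈ D)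
    {p : ℝ} (hp : p ∈ Ioo I.fst I.snd) :
    ∃ K ∈ D, K.length = I.length / 2 ∧ p ∈ (K : Set ℝ) ∧ K ≤ I := by
  obtain ⟨n, hn⟩ := hD.length_eq I hI
  obtain ⟨K, hK, hKn, hpK⟩ := hD.cover (n - 1) p
  have hl : K.length = I.length / 2 := by
    rw [hKn, hn, zpow_sub_one₀ two_ne_zero]; ring
  have hpos := hD.length_pos hI
  refine ⟨K, hK, hl, hpK, ?_⟩
  rcases hD.trichotomy hK hI with h | h | h
  · exact h
  · have := length_mono h
    linarith
  · exfalso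
    have hpK' : K.fst ≤ p ∧ p ≤ K.snd := hpK
    rw [FunctionalEnergy.length_eq, FunctionalEnergy.length_eq] at hl
    rw [FunctionalEnergy.length_eq] at hpos
    rcases lt_or_ge p K.snd with h1 | h1
    · obtain ⟨q, hq1, hq2⟩ := exists_between (lt_min h1 hp.2)
      exact disjoint_left.1 (show Disjoint _ _ from h)
        (⟨by linarith, hq2.trans_le (min_le_left _ _)⟩ : q ∈ Ioo K.fst K.snd)
        ⟨hp.1.trans hq1, hq2.trans_le (min_le_right _ _)⟩
    · obtain ⟨q, hq1, hq2⟩ := exists_between (max_lt (show K.fst < p by linarith) hp.1)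
      exact disjoint_left.1 (show Disjoint _ _ from h)
        (⟨(le_max_left _ _).trans_lt hq1, by linarith⟩ : q ∈ Ioo K.fst K.snd)
        ⟨(le_max_right _ _).trans_lt hq1, hq2.trans hp.2⟩

lemma IsDyadicGrid.leftChild_mem {D : Set Interval} (hD : IsDyadicGrid D) {I : Interval}
    (hI : I ∈ D) : leftChild I ∈ D := by
  have hpos := hD.length_pos hI
  rw [FunctionalEnergy.length_eq] at hpos
  obtain ⟨K, hK, hl, hpK, hKI⟩ := hD.exists_half hI (p := I.fst + (I.snd - I.fst) / 4)
    ⟨by linarith, by linarith⟩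
  have h1 : I.fst ≤ K.fst := hKI.1
  have h2 : K.fst ≤ I.fst + (I.snd - I.fst) / 4 := hpK.1
  have h3 : K.fst = I.fst := by
    by_contra hne
    have hlt : I.fst < K.fst := lt_of_le_of_ne h1 (Ne.symm hne)
    obtain ⟨q, hq1, hq2⟩ := exists_between hlt
    -- a second half that starts to the left of the first one overlaps it
    obtain ⟨K', hK', hl', hqK', hKI'⟩ := hD.exists_half hI (p := q) ⟨hq1, by linarith⟩
    have h4 : K'.fst ≤ q := hqK'.1
    have h5 : I.fst ≤ K'.fst := hKI'.1
    rw [FunctionalEnergy.length_eq, FunctionalEnergy.length_eq] at hl hl'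
    rcases hD.trichotomy hK hK' with h | h | h
    · have h6 : K.snd ≤ K'.snd := h.2
      linarith
    · have h6 : K.fst ≤ K'.fst := h.1
      linarith
    · refine disjoint_left.1 (show Disjoint _ _ from h)
        (⟨?_, ?_⟩ : (K.fst + K'.snd) / 2 ∈ Ioo K.fst K.snd) ⟨?_, ?_⟩ <;> linarith
  rw [FunctionalEnergy.length_eq, FunctionalEnergy.length_eq] at hl
  have : leftChild I = K := by
    refine NonemptyInterval.ext (Prod.ext ?_ ?_)
    · exact h3.symm
    · change (I.fst + I.snd) / 2 = K.snd
      linarith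
  rwa [this]

lemma IsDyadicGrid.rightChild_mem {D : Set Interval} (hD : IsDyadicGrid D) {I : Interval}
    (hI : I ∈ D) : rightChild I ∈ D := by
  have hpos := hD.length_pos hI
  rw [FunctionalEnergy.length_eq] at hpos
  obtain ⟨K, hK, hl, hpK, hKI⟩ := hD.exists_half hI (p := I.snd - (I.snd - I.fst) / 4)
    ⟨by linarith, by linarith⟩
  have hL := hD.leftChild_mem hI
  have h1 : I.snd - (I.snd - I.fst) / 4 ≤ K.snd := hpK.2
  have h2 : K.snd ≤ I.snd := hKI.2
  have h3 : I.fst ≤ K.fst := hKI.1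
  rw [FunctionalEnergy.length_eq, FunctionalEnergy.length_eq] at hl
  have hLf : (leftChild I).fst = I.fst := rfl
  have hLs : (leftChild I).snd = (I.fst + I.snd) / 2 := rfl
  have h4 : (I.fst + I.snd) / 2 ≤ K.fst := by
    by_contra hlt
    push Not at hlt
    rcases hD.trichotomy hK hL with h | h | h
    · have h6 : K.snd ≤ (leftChild I).snd := h.2
      linarith
    · have h6 : K.fst ≤ (leftChild I).fst := h.1
      linarith
    · refine disjoint_left.1 (show Disjoint _ _ from h)
        (⟨?_, ?_⟩ : (K.fst + (leftChild I).snd) / 2 ∈ Ioo K.fst K.snd) ⟨?_, ?_⟩ <;> linarith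
  have : rightChild I = K := by
    refine NonemptyInterval.ext (Prod.ext ?_ ?_)
    · change (I.fst + I.snd) / 2 = K.fst
      linarith
    · change I.snd = K.snd
      linarith
  rwa [this]

lemma length_leftChild (I : Interval) : (leftChild I).length = I.length / 2 := by
  change (I.fst + I.snd) / 2 - I.fst = (I.snd - I.fst) / 2
  ring

lemma length_rightChild (I : Interval) : (rightChild I).length = I.length / 2 := by
  change I.snd - (I.fst + I.snd) / 2 = (I.snd - I.fst) / 2
  ring

lemma leftChild_le (I : Interval) : leftChild I ≤ I :=
  ⟨show I.fst ≤ I.fst from le_rfl, show (I.fst + I.snd) / 2 ≤ I.snd by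
    linarith [I.fst_le_snd]⟩

lemma rightChild_le (I : Interval) : rightChild I ≤ I :=
  ⟨show I.fst ≤ (I.fst + I.snd) / 2 by linarith [I.fst_le_snd], show I.snd ≤ I.snd from le_rfl⟩

lemma coe_leftChild_union (I : Interval) : (leftChild I : Set ℝ) ∪ rightChild I = I := by
  exact Icc_union_Icc_eq_Icc (show I.fst ≤ (I.fst + I.snd) / 2 by linarith [I.fst_le_snd])
    (show (I.fst + I.snd) / 2 ≤ I.snd by linarith [I.fst_le_snd])

lemma IsDyadicGrid.le_or_nonoverlapping {D : Set Interval} (hD : IsDyadicGrid D) {I J : Interval}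
    (hI : I ∈ D) (hJ : J ∈ D) (hIJ : I.length ≤ J.length) : I ≤ J ∨ Nonoverlapping I J := by
  rcases hD.trichotomy hI hJ with h | h | h
  · exact Or.inl h
  · exact Or.inl (eq_of_le_of_length_le h hIJ).ge
  · exact Or.inr h

lemma IsDyadicGrid.length_le_half {D : Set Interval} (hD : IsDyadicGrid D) {I J : Interval}
    (hI : I ∈ D) (hJ : J ∈ D) (hIJ : I < J) : I.length ≤ J.length / 2 := by
  obtain ⟨m, hm⟩ := hD.length_eq I hI
  obtain ⟨n, hn⟩ := hD.length_eq J hJ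
  have h1 : I.length < J.length := by
    by_contra h
    exact hIJ.ne (eq_of_le_of_length_le hIJ.le (not_lt.1 h))
  rw [hm, hn] at h1 ⊢
  have h2 : m < n := (zpow_lt_zpow_iff_right₀ one_lt_two).1 h1
  rw [le_div_iff₀ two_pos, ← zpow_add_one₀ two_ne_zero]
  exact zpow_le_zpow_right₀ one_le_two h2

section Haar

variable {D : Set Interval} {w : Measure ℝ}

/-- The normalizing factor of the Haar function. -/
noncomputable def haarFactor (w : Measure ℝ) (I : Interval) : ℝ :=
  √(w.real (leftChild I : Set ℝ) * w.real (rightChild I : Set ℝ) / w.real (I : Set ℝ))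

lemma integral_mul_haar {I : Interval} {f : ℝ → ℝ} (hf : IntegrableOn f I w) :
    ∫ x, f x * haar w I x ∂w = haarFactor w I *
      ((∫ x in (rightChild I : Set ℝ), f x ∂w) / w.real (rightChild I : Set ℝ) -
        (∫ x in (leftChild I : Set ℝ), f x ∂w) / w.real (leftChild I : Set ℝ)) := by
  have hL : IntegrableOn f (leftChild I : Set ℝ) w := hf.mono_set (coe_subset (leftChild_le I))
  have hR : IntegrableOn f (rightChild I : Set ℝ) w := hf.mono_set (coe_subset (rightChild_le I))
  have e : ∀ x, f x * haar w I x = haarFactor w I *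
      ((rightChild I : Set ℝ).indicator f x / w.real (rightChild I : Set ℝ) -
        (leftChild I : Set ℝ).indicator f x / w.real (leftChild I : Set ℝ)) := by
    intro x
    have e1 : ∀ s : Set ℝ, s.indicator f x = f x * s.indicator 1 x := fun s => by
      by_cases hx : x ∈ s <;> simp [hx]
    rw [e1, e1, haar, haarFactor]
    ring
  simp only [e]
  rw [integral_const_mul, integral_sub, integral_div, integral_div,
    integral_indicator (measurableSet_coe _), integral_indicator (measurableSet_coe _)]
  · exact (hR.integrable_indicator (measurableSet_coe _)).div_const _
  · exact (hL.integrable_indicator (measurableSet_coe _)).div_const _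

lemma haar_eq_zero_of_notMem {I : Interval} {x : ℝ} (hx : x ∉ (I : Set ℝ)) : haar w I x = 0 := by
  have h1 : x ∉ (leftChild I : Set ℝ) := fun h => hx (coe_subset (leftChild_le I) h)
  have h2 : x ∉ (rightChild I : Set ℝ) := fun h => hx (coe_subset (rightChild_le I) h)
  rw [haar, indicator_of_notMem h1, indicator_of_notMem h2]
  simp

lemma integrable_haar [IsLocallyFiniteMeasure w] (I : Interval) : Integrable (haar w I) w := by
  have h1 : IntegrableOn (haar w I) I w := by
    have : IsFiniteMeasure (w.restrict (I : Set ℝ)) :=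
      ⟨by rw [Measure.restrict_apply_univ]; exact measure_coe_lt_top w I⟩
    exact ((memLp_haar w I).restrict _).integrable (by norm_num)
  have h2 : (I : Set ℝ).indicator (haar w I) = haar w I := by
    ext x
    by_cases hx : x ∈ (I : Set ℝ)
    · rw [indicator_of_mem hx]
    · rw [indicator_of_notMem hx, haar_eq_zero_of_notMem hx]
  rw [← h2]
  exact h1.integrable_indicator (measurableSet_coe I)

lemma Admissible.measure_inter_eq_zero (hw : Admissible D w) {I J : Interval} (hI : I ∈ D)
    (hJ : J ∈ D) (h : Nonoverlapping I J) : w ((I : Set ℝ) ∩ J) = 0 := by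
  have h1 := (hw.nullEnds hI).ae_eq.inter (hw.nullEnds hJ).ae_eq
  rw [measure_congr h1, Disjoint.inter_eq (show Disjoint _ _ from h), measure_empty]

lemma Admissible.measure_leftChild_inter (hw : Admissible D w) (hD : IsDyadicGrid D) {I : Interval}
    (hI : I ∈ D) : w ((leftChild I : Set ℝ) ∩ rightChild I) = 0 := by
  have h : (leftChild I : Set ℝ) ∩ rightChild I ⊆ {(leftChild I).snd} := by
    rintro x ⟨hx1, hx2⟩
    exact le_antisymm hx1.2 hx2.1
  exact measure_mono_null h (hw _ (hD.leftChild_mem hI)).2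

lemma haarFactor_eq_zero_or (w : Measure ℝ) (I : Interval) :
    haarFactor w I = 0 ∨ 0 < w.real (leftChild I : Set ℝ) ∧ 0 < w.real (rightChild I : Set ℝ) := by
  rcases eq_or_lt_of_le (measureReal_nonneg (μ := w) (s := (leftChild I : Set ℝ))) with h | h
  · left; rw [haarFactor, ← h]; simp
  rcases eq_or_lt_of_le (measureReal_nonneg (μ := w) (s := (rightChild I : Set ℝ))) with h' | h'
  · left; rw [haarFactor, ← h']; simp
  · exact Or.inr ⟨h, h'⟩

/-- The halves of `I` share their common endpoint, which has no mass. -/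
lemma setIntegral_child_haar [IsLocallyFiniteMeasure w] (hD : IsDyadicGrid D)
    (hw : Admissible D w) {I : Interval}
    (hI : I ∈ D) : ∫ x in (leftChild I : Set ℝ), haar w I x ∂w = -haarFactor w I ∧
      ∫ x in (rightChild I : Set ℝ), haar w I x ∂w = haarFactor w I := by
  have h0 : w.real ((leftChild I : Set ℝ) ∩ rightChild I) = 0 := by
    rw [measureReal_def, hw.measure_leftChild_inter hD hI]; rfl
  have h0' : w.real ((rightChild I : Set ℝ) ∩ leftChild I) = 0 := by rwa [inter_comm]
  have hfin : ∀ K : Interval, w (K : Set ℝ) ≠ ∞ := fun K => (measure_coe_lt_top w K).ne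
  have key : ∀ K : Interval, ∫ x in (K : Set ℝ), haar w I x ∂w = haarFactor w I *
      (w.real ((rightChild I : Set ℝ) ∩ K) / w.real (rightChild I : Set ℝ) -
        w.real ((leftChild I : Set ℝ) ∩ K) / w.real (leftChild I : Set ℝ)) := by
    intro K
    have e := integral_mul_haar (w := w) (I := I) (f := (K : Set ℝ).indicator 1) ?_
    · rw [← integral_indicator (measurableSet_coe K)]
      have e1 : ∀ x, (K : Set ℝ).indicator (haar w I) x = (K : Set ℝ).indicator 1 x * haar w I x :=
        fun x => by by_cases hx : x ∈ (K : Set ℝ) <;> simp [hx]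
      simp only [e1]
      rw [e]
      have e2 : ∀ L : Interval, ∫ x in (L : Set ℝ), (K : Set ℝ).indicator (1 : ℝ → ℝ) x ∂w =
          w.real ((L : Set ℝ) ∩ K) := by
        intro L
        rw [integral_indicator_one (measurableSet_coe K), measureReal_restrict_apply
          (measurableSet_coe K), inter_comm]
      rw [e2, e2]
    · exact ((integrable_indicator_iff (measurableSet_coe K)).2
        (integrableOn_const (hfin K))).integrableOn
  rcases haarFactor_eq_zero_or w I with h | ⟨h1, h2⟩
  · rw [key, key, h]; simp
  · rw [key, key, inter_self, inter_self, h0, h0', div_self h1.ne', div_self h2.ne']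
    simp

lemma setIntegral_haar_eq_inter (I K : Interval) :
    ∫ x in (K : Set ℝ), haar w I x ∂w = ∫ x in (I : Set ℝ) ∩ K, haar w I x ∂w := by
  refine (setIntegral_eq_of_subset_of_forall_sdiff_eq_zero (measurableSet_coe K)
    inter_subset_right fun x hx => ?_)
  exact haar_eq_zero_of_notMem fun h => hx.2 ⟨h, hx.1⟩

lemma setIntegral_haar_of_le [IsLocallyFiniteMeasure w] {I K : Interval} (hIK : I ≤ K) :
    ∫ x in (K : Set ℝ), haar w I x ∂w = 0 := by
  have e : ∫ x in (K : Set ℝ), haar w I x ∂w = ∫ x, 1 * haar w I x ∂w := by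
    simp only [one_mul]
    exact setIntegral_eq_integral_of_forall_compl_eq_zero fun x hx =>
      haar_eq_zero_of_notMem fun h => hx (coe_subset hIK h)
  rw [e, integral_mul_haar (integrableOn_const (measure_coe_lt_top w I).ne)]
  rcases haarFactor_eq_zero_or w I with h | ⟨h1, h2⟩
  · rw [h, zero_mul]
  · simp [div_self h1.ne', div_self h2.ne']

lemma setIntegral_haar_of_nonoverlapping (hw : Admissible D w) {I K : Interval} (hI : I ∈ D)
    (hK : K ∈ D) (h : Nonoverlapping I K) : ∫ x in (K : Set ℝ), haar w I x ∂w = 0 := by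
  rw [setIntegral_haar_eq_inter, setIntegral_measure_zero _ (hw.measure_inter_eq_zero hI hK h)]

/-- A Haar function is orthogonal to the Haar functions of all the intervals that are not strictly
inside its own, because it has mean zero on their halves. -/
lemma integral_haar_mul_haar_of_not_lt [IsLocallyFiniteMeasure w] (hD : IsDyadicGrid D)
    (hw : Admissible D w) {I J : Interval} (hI : I ∈ D) (hJ : J ∈ D) (hne : I ≠ J)
    (h : ¬ J < I) : ∫ x, haar w I x * haar w J x ∂w = 0 := by
  have key : ∀ K ∈ D, K ≤ J → K.length = J.length / 2 →
      ∫ x in (K : Set ℝ), haar w I x ∂w = 0 := by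
    intro K hK hKJ hl
    rcases hD.trichotomy hI hJ with h1 | h1 | h1
    · have h2 := hD.length_le_half hI hJ (lt_of_le_of_ne h1 hne)
      rcases hD.le_or_nonoverlapping hI hK (hl ▸ h2) with h3 | h3
      · exact setIntegral_haar_of_le h3
      · exact setIntegral_haar_of_nonoverlapping hw hI hK h3
    · exact absurd (lt_of_le_of_ne h1 hne.symm) h
    · refine setIntegral_haar_of_nonoverlapping hw hI hK ?_
      exact Disjoint.mono_right (Ioo_subset_Ioo hKJ.1 hKJ.2) (show Disjoint _ _ from h1)
  rw [integral_mul_haar (integrable_haar I).integrableOn,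
    key _ (hD.rightChild_mem hJ) (rightChild_le J) (length_rightChild J),
    key _ (hD.leftChild_mem hJ) (leftChild_le J) (length_leftChild J)]
  simp

lemma integral_haar_mul_haar [IsLocallyFiniteMeasure w] (hD : IsDyadicGrid D)
    (hw : Admissible D w) {I J : Interval} (hI : I ∈ D) (hJ : J ∈ D) (hne : I ≠ J) :
    ∫ x, haar w I x * haar w J x ∂w = 0 := by
  by_cases h : J < I
  · simp only [mul_comm (haar w I _)]
    exact integral_haar_mul_haar_of_not_lt hD hw hJ hI hne.symm h.not_gt
  · exact integral_haar_mul_haar_of_not_lt hD hw hI hJ hne h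

lemma integral_haar_mul_self [IsLocallyFiniteMeasure w] (hD : IsDyadicGrid D)
    (hw : Admissible D w) {I : Interval} (hI : I ∈ D) (h : haarFactor w I ≠ 0) :
    ∫ x, haar w I x * haar w I x ∂w = 1 := by
  obtain ⟨h1, h2⟩ := (haarFactor_eq_zero_or w I).resolve_left h
  obtain ⟨e1, e2⟩ := setIntegral_child_haar hD hw hI
  have hsum : w.real (I : Set ℝ) =
      w.real (leftChild I : Set ℝ) + w.real (rightChild I : Set ℝ) := by
    rw [← coe_leftChild_union, ← measureReal_union_add_inter (measurableSet_coe _)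
      (measure_coe_lt_top w _).ne (measure_coe_lt_top w _).ne,
      measureReal_def (s := (leftChild I : Set ℝ) ∩ _), hw.measure_leftChild_inter hD hI]
    simp
  rw [integral_mul_haar (integrable_haar I).integrableOn, e1, e2]
  have e3 : haarFactor w I ^ 2 = w.real (leftChild I : Set ℝ) * w.real (rightChild I : Set ℝ) /
      w.real (I : Set ℝ) := by
    rw [haarFactor, Real.sq_sqrt (by positivity)]
  have e4 : haarFactor w I * (haarFactor w I / w.real (rightChild I : Set ℝ) -
      -haarFactor w I / w.real (leftChild I : Set ℝ)) = haarFactor w I ^ 2 *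
      (1 / w.real (rightChild I : Set ℝ) + 1 / w.real (leftChild I : Set ℝ)) := by ring
  rw [e4, e3, hsum]
  field_simp

lemma inner_haarLp [IsLocallyFiniteMeasure w] (I : Interval) (g : Lp ℝ 2 w) :
    inner ℝ (haarLp w I) g = haarCoeff w g I := by
  rw [L2.inner_def, haarCoeff]
  refine integral_congr_ae ?_
  filter_upwards [(memLp_haar w I).coeFn_toLp] with x hx
  rw [haarLp, hx]
  rfl

lemma haarCoeff_toLp {f : ℝ → ℝ} (hf : MemLp f 2 w) (I : Interval) :
    haarCoeff w (hf.toLp f) I = ∫ x, f x * haar w I x ∂w := by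
  refine integral_congr_ae ?_
  filter_upwards [hf.coeFn_toLp] with x hx
  rw [hx]

/-- The intervals of the grid with a nonzero Haar function. -/
abbrev HaarIndex (D : Set Interval) (w : Measure ℝ) : Type :=
  {I : Interval // I ∈ D ∧ haarFactor w I ≠ 0}

lemma orthonormal_haarLp [IsLocallyFiniteMeasure w] (hD : IsDyadicGrid D)
    (hw : Admissible D w) : Orthonormal ℝ fun I : HaarIndex D w => haarLp w I.1 := by
  classical
  rw [orthonormal_iff_ite]
  intro I J
  have e : inner ℝ (haarLp w I.1) (haarLp w J.1) = ∫ x, haar w J.1 x * haar w I.1 x ∂w := by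
    rw [inner_haarLp]
    exact haarCoeff_toLp (memLp_haar w J.1) I.1
  rw [e]
  split_ifs with h
  · rw [h]; exact integral_haar_mul_self hD hw J.2.1 J.2.2
  · exact integral_haar_mul_haar hD hw J.2.1 I.2.1 fun h' => h (Subtype.ext h'.symm)

lemma haarLp_eq_zero [IsLocallyFiniteMeasure w] {I : Interval} (h : haarFactor w I = 0) :
    haarLp w I = 0 := by
  have : haar w I = 0 := by
    ext x
    rw [haar, ← haarFactor, h]
    simp
  rw [haarLp]
  simp only [this]
  exact MemLp.toLp_zero _

/-- Bessel's inequality. -/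
lemma tsum_haarCoeff_sq_le [IsLocallyFiniteMeasure w] (hD : IsDyadicGrid D)
    (hw : Admissible D w) (g : Lp ℝ 2 w) :
    ∑' I : Interval, D.indicator (fun I => ‖haarCoeff w g I‖ₑ ^ 2) I ≤ ‖g‖ₑ ^ 2 := by
  classical
  rw [ENNReal.tsum_eq_iSup_sum]
  refine iSup_le fun Z => ?_
  have h1 := (orthonormal_haarLp hD hw).sum_inner_products_le g
    (s := Z.subtype fun I => I ∈ D ∧ haarFactor w I ≠ 0)
  simp only [inner_haarLp] at h1
  rw [Finset.sum_subtype_eq_sum_filter (f := fun I => ‖haarCoeff w g I‖ ^ 2)] at h1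
  calc ∑ I ∈ Z, D.indicator (fun I => ‖haarCoeff w g I‖ₑ ^ 2) I
      = ∑ I ∈ Z with I ∈ D ∧ haarFactor w I ≠ 0, ‖haarCoeff w g I‖ₑ ^ 2 := by
        rw [Finset.sum_filter]
        refine Finset.sum_congr rfl fun I _ => ?_
        by_cases hI : I ∈ D
        · by_cases h0 : haarFactor w I = 0
          · simp [hI, h0, ← inner_haarLp, haarLp_eq_zero h0]
          · simp [hI, h0]
        · simp [hI]
    _ = ENNReal.ofReal (∑ I ∈ Z with I ∈ D ∧ haarFactor w I ≠ 0, ‖haarCoeff w g I‖ ^ 2) := by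
        rw [ENNReal.ofReal_sum_of_nonneg fun I _ => by positivity]
        refine Finset.sum_congr rfl fun I _ => ?_
        rw [ENNReal.ofReal_pow (norm_nonneg _), ofReal_norm]
    _ ≤ ENNReal.ofReal (‖g‖ ^ 2) := ENNReal.ofReal_le_ofReal h1
    _ = _ := by rw [ENNReal.ofReal_pow (norm_nonneg _), ofReal_norm]

end Haar

/-- Parseval's identity for a vector in the closed span of an orthonormal family. -/
lemma hasSum_inner_mul_inner {E ι : Type*} [NormedAddCommGroup E] [InnerProductSpace ℝ E]
    [CompleteSpace E] {v : ι → E} (hv : Orthonormal ℝ v) {g : E}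
    (hg : g ∈ (Submodule.span ℝ (range v)).topologicalClosure) (f : E) :
    HasSum (fun i => inner ℝ f (v i) * inner ℝ (v i) g) (inner ℝ f g) := by
  obtain ⟨s, b, hsub, hb⟩ := hv.toSubtypeRange.exists_hilbertBasis_extension
  have h1 := b.hasSum_inner_mul_inner f g
  let j : ι → s := fun i => ⟨v i, hsub (mem_range_self i)⟩
  have hj : Function.Injective j := fun i i' h =>
    hv.linearIndependent.injective (congrArg Subtype.val h)
  rw [← hj.hasSum_iff] at h1
  · simp only [hb] at h1
    exact h1
  · -- the additional basis vectors are orthogonal to the closed span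
    intro x hx
    have h2 : b x ∈ (Submodule.span ℝ (range v)).topologicalClosureᗮ := by
      rw [Submodule.orthogonal_closure, Submodule.mem_orthogonal]
      intro u hu
      induction hu using Submodule.span_induction with
      | mem u hu =>
        obtain ⟨i, rfl⟩ := hu
        have h3 : j i ≠ x := fun h => hx ⟨i, h⟩
        have h4 := b.orthonormal.inner_eq_zero h3
        simp only [hb] at h4 ⊢
        exact h4
      | zero => exact inner_zero_left _
      | add y z _ _ hy hz => rw [inner_add_left, hy, hz, add_zero]
      | smul c y _ hy => rw [inner_smul_left, hy, mul_zero]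
    rw [Submodule.inner_left_of_mem_orthogonal hg h2, mul_zero]

/-! ### Haar coefficients of the position -/

lemma eLpNorm_two_sq {μ : Measure ℝ} (f : ℝ → ℝ) : eLpNorm f 2 μ ^ 2 = ∫⁻ x, ‖f x‖ₑ ^ 2 ∂μ := by
  have h := eLpNorm_nnreal_pow_eq_lintegral (f := f) (μ := μ) (p := 2) two_ne_zero
  simpa using h

lemma tsum_sq_le_of_sq_le_mul {ι : Type*} (x U V : ι → ℝ≥0∞) (h : ∀ i, x i ^ 2 ≤ U i * V i) :
    (∑' i, x i) ^ 2 ≤ (∑' i, U i) * ∑' i, V i := by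
  have h1 : Tendsto (fun s : Finset ι => (∑ i ∈ s, x i) ^ 2) atTop (𝓝 ((∑' i, x i) ^ 2)) :=
    ENNReal.Tendsto.pow ENNReal.summable.hasSum
  refine le_of_tendsto' h1 fun s => ?_
  refine (sum_sq_le_of_sq_le_mul s x U V fun i _ => h i).trans ?_
  exact mul_le_mul' (ENNReal.sum_le_tsum s) (ENNReal.sum_le_tsum s)

/-- The Haar coefficient of the function `x`. -/
noncomputable def positionCoeff (w : Measure ℝ) (I : Interval) : ℝ := ∫ x, x * haar w I x ∂w

/-- The part of the Haar support that lies in `J`. -/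
def haarSupportIn (D : Set Interval) (w : Measure ℝ) (g : Lp ℝ 2 w) (J : Interval) : Set Interval :=
  {K | K ∈ haarSupport D w g ∧ K ≤ J}

/-- The maximal intervals of the Haar support do not share smaller intervals. -/
lemma disjoint_haarSupportIn {D : Set Interval} (hD : IsDyadicGrid D)
    {w : Measure ℝ} {g : Lp ℝ 2 w} {J J' : Interval}
    (hJ : J ∈ maxHaarSupport D w g) (hJ' : J' ∈ maxHaarSupport D w g) (hne : J ≠ J') :
    Disjoint (haarSupportIn D w g J) (haarSupportIn D w g J') := by
  refine disjoint_left.2 fun K hK hK' => hne ?_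
  rcases hD.le_or_le hJ.prop.1 hJ'.prop.1 (hD.length_pos hK.1.1) hK.2 hK'.2 with h | h
  · exact le_antisymm h (hJ.le_of_ge hJ'.prop h)
  · exact le_antisymm (hJ'.le_of_ge hJ.prop h) h

variable {D : Set Interval} {w : Measure ℝ} [IsLocallyFiniteMeasure w]

lemma memLp_indicator_sub (w : Measure ℝ) [IsLocallyFiniteMeasure w] (K : Interval) (c : ℝ) :
    MemLp ((K : Set ℝ).indicator fun x => x - c) 2 w := by
  refine MemLp.of_le_mul (c := K.length + |K.fst - c|) (memLp_indicator w K) ?_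
    (Eventually.of_forall fun x => ?_)
  · exact ((measurable_id.sub_const c).indicator (measurableSet_coe K)).aestronglyMeasurable
  · by_cases hx : x ∈ (K : Set ℝ)
    · have h1 := abs_sub_le_length hx (show K.fst ∈ (K : Set ℝ) from ⟨le_rfl, K.fst_le_snd⟩)
      simp only [indicator_of_mem hx, Pi.one_apply, norm_one, mul_one, Real.norm_eq_abs]
      have h2 := abs_sub_le x K.fst c
      linarith
    · simp [hx]

lemma enorm_toLp_indicator_sub_sq (K : Interval) (c : ℝ) :
    ‖(memLp_indicator_sub w K c).toLp _‖ₑ ^ 2 =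
      ∫⁻ x in (K : Set ℝ), ENNReal.ofReal ((x - c) ^ 2) ∂w := by
  rw [Lp.enorm_toLp, eLpNorm_two_sq, ← lintegral_indicator (measurableSet_coe K)]
  refine lintegral_congr fun x => ?_
  by_cases hx : x ∈ (K : Set ℝ)
  · rw [indicator_of_mem hx, indicator_of_mem hx, ← enorm_pow, Real.enorm_of_nonneg (sq_nonneg _)]
  · rw [indicator_of_notMem hx, indicator_of_notMem hx]; simp

/-- As the Haar function has mean zero, its coefficient does not see the constants. -/
lemma haarCoeff_indicator_sub_of_le {I K : Interval} (h : I ≤ K) (c : ℝ) :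
    haarCoeff w ((memLp_indicator_sub w K c).toLp _) I = positionCoeff w I := by
  rw [haarCoeff_toLp]
  have e : ∀ x, (K : Set ℝ).indicator (fun x => x - c) x * haar w I x =
      (I : Set ℝ).indicator (fun x => x) x * haar w I x - c * haar w I x := by
    intro x
    by_cases hx : x ∈ (I : Set ℝ)
    · rw [indicator_of_mem hx, indicator_of_mem (coe_subset h hx)]; ring
    · rw [haar_eq_zero_of_notMem hx]; ring
  have e2 : ∀ x, (I : Set ℝ).indicator (fun x => x) x * haar w I x = x * haar w I x := by
    intro x
    by_cases hx : x ∈ (I : Set ℝ)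
    · rw [indicator_of_mem hx]
    · rw [haar_eq_zero_of_notMem hx]; ring
  have hint : Integrable (fun x => (I : Set ℝ).indicator (fun x => x) x * haar w I x) w := by
    have := memLp_indicator_sub w I 0
    simp only [sub_zero] at this
    exact this.integrable_mul (memLp_haar w I)
  simp only [e]
  rw [integral_sub hint ((integrable_haar I).const_mul c), integral_const_mul]
  have h0 : ∫ x, haar w I x ∂w = 0 := by
    rw [← setIntegral_haar_of_le (w := w) (le_refl I),
      setIntegral_eq_integral_of_forall_compl_eq_zero]
    exact fun x hx => haar_eq_zero_of_notMem hx
  simp only [e2]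
  rw [h0, mul_zero, sub_zero, positionCoeff]

lemma haarCoeff_indicator_sub_of_nonoverlapping (hw : Admissible D w) {I K : Interval} (hI : I ∈ D)
    (hK : K ∈ D) (h : Nonoverlapping I K) (c : ℝ) :
    haarCoeff w ((memLp_indicator_sub w K c).toLp _) I = 0 := by
  rw [haarCoeff_toLp]
  refine integral_eq_zero_of_ae ?_
  have h1 : ∀ᵐ x ∂w, x ∉ (I : Set ℝ) ∩ K := measure_eq_zero_iff_ae_notMem.1
    (hw.measure_inter_eq_zero hI hK h)
  filter_upwards [h1] with x hx
  by_cases hxI : x ∈ (I : Set ℝ)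
  · rw [indicator_of_notMem fun hxK => hx ⟨hxI, hxK⟩]; simp
  · rw [haar_eq_zero_of_notMem hxI]; simp

/-- Bessel's inequality for `x - c` on `K`. -/
lemma tsum_positionCoeff_sq_le (hD : IsDyadicGrid D) (hw : Admissible D w) (K : Interval) (c : ℝ) :
    ∑' I : Interval, {I | I ∈ D ∧ I ≤ K}.indicator (fun I => ‖positionCoeff w I‖ₑ ^ 2) I ≤
      ∫⁻ x in (K : Set ℝ), ENNReal.ofReal ((x - c) ^ 2) ∂w := by
  rw [← enorm_toLp_indicator_sub_sq]
  refine le_trans (ENNReal.tsum_le_tsum fun I => ?_)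
    (tsum_haarCoeff_sq_le hD hw ((memLp_indicator_sub w K c).toLp _))
  by_cases hI : I ∈ {I | I ∈ D ∧ I ≤ K}
  · rw [indicator_of_mem hI, indicator_of_mem hI.1, haarCoeff_indicator_sub_of_le hI.2]
  · rw [indicator_of_notMem hI]; exact zero_le

lemma positionCoeff_sq_le (hD : IsDyadicGrid D) (hw : Admissible D w) {K : Interval} (hK : K ∈ D) :
    ‖positionCoeff w K‖ₑ ^ 2 ≤ ENNReal.ofReal (K.length ^ 2) * w (K : Set ℝ) := by
  refine le_trans ?_ ((tsum_positionCoeff_sq_le hD hw K K.fst).trans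
    (setLIntegral_sub_sq_le w K ⟨le_rfl, K.fst_le_snd⟩ subset_rfl (measurableSet_coe K)))
  refine le_trans ?_ (ENNReal.le_tsum K)
  rw [indicator_of_mem (show K ∈ {I | I ∈ D ∧ I ≤ K} from ⟨hK, le_rfl⟩)]

/-- In the Haar expansion of `g` on a maximal interval `J` of its support, only the intervals inside
`J` contribute. -/
lemma enorm_setIntegral_sq_le (hD : IsDyadicGrid D) (hw : Admissible D w) {g : Lp ℝ 2 w}
    (hg : g ∈ haarSpan D w) {J : Interval} (hJ : J ∈ maxHaarSupport D w g) :
    ‖∫ x in (J : Set ℝ), x * g x ∂w‖ₑ ^ 2 ≤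
      (∑' K, (haarSupportIn D w g J).indicator (fun K => ‖positionCoeff w K‖ₑ ^ 2) K) *
        ∑' K, (haarSupportIn D w g J).indicator (fun K => ‖haarCoeff w g K‖ₑ ^ 2) K := by
  have hJD : J ∈ D := hJ.prop.1
  set f := (memLp_indicator_sub w J 0).toLp _ with hf
  have hfg : inner ℝ f g = ∫ x in (J : Set ℝ), x * g x ∂w := by
    rw [L2.inner_def, ← integral_indicator (measurableSet_coe J)]
    refine integral_congr_ae ?_
    filter_upwards [(memLp_indicator_sub w J 0).coeFn_toLp] with x hx
    rw [hf, hx]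
    by_cases hxJ : x ∈ (J : Set ℝ)
    · simp [hxJ, mul_comm]
    · simp [hxJ]
  have hg' : g ∈ (Submodule.span ℝ
      (range fun I : HaarIndex D w => haarLp w I.1)).topologicalClosure := by
    refine Submodule.topologicalClosure_mono (Submodule.span_le.2 ?_) hg
    rintro _ ⟨I, hI, rfl⟩
    by_cases h0 : haarFactor w I = 0
    · rw [haarLp_eq_zero h0]; exact Submodule.zero_mem _
    · exact Submodule.subset_span ⟨⟨I, hI, h0⟩, rfl⟩
  have hsum := hasSum_inner_mul_inner (orthonormal_haarLp hD hw) hg' f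
  rw [← hfg]
  set S := haarSupportIn D w g J with hS
  set U : Interval → ℝ≥0∞ := S.indicator fun K => ‖positionCoeff w K‖ₑ ^ 2 with hU
  set V : Interval → ℝ≥0∞ := S.indicator fun K => ‖haarCoeff w g K‖ₑ ^ 2 with hV
  calc ‖inner ℝ f g‖ₑ ^ 2
      ≤ (∑' I : HaarIndex D w, ‖inner ℝ f (haarLp w I.1) * inner ℝ (haarLp w I.1) g‖ₑ) ^ 2 := by
        gcongr
        rw [← hsum.tsum_eq]
        exact enorm_tsum_le_tsum_enorm
    _ ≤ (∑' I : HaarIndex D w, U I.1) * ∑' I : HaarIndex D w, V I.1 := by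
        refine tsum_sq_le_of_sq_le_mul _ _ _ fun I => ?_
        rw [real_inner_comm, inner_haarLp, inner_haarLp, enorm_mul, mul_pow]
        by_cases hI : I.1 ∈ S
        · rw [hU, hV, indicator_of_mem hI, indicator_of_mem hI, hf,
            haarCoeff_indicator_sub_of_le hI.2]
        · by_cases h0 : haarCoeff w g I.1 = 0
          · rw [h0]; simp
          · have h1 : I.1 ∈ haarSupport D w g := ⟨I.2.1, h0⟩
            have h2 : Nonoverlapping I.1 J := by
              rcases hD.trichotomy I.2.1 hJD with h | h | h
              · exact absurd ⟨h1, h⟩ hI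
              · exact absurd ⟨h1, hJ.le_of_ge h1 h⟩ hI
              · exact h
            rw [hf, haarCoeff_indicator_sub_of_nonoverlapping hw I.2.1 hJD h2]
            simp
    _ ≤ (∑' K, U K) * ∑' K, V K := by
        gcongr
        · exact ENNReal.tsum_comp_le_tsum_of_injective Subtype.val_injective U
        · exact ENNReal.tsum_comp_le_tsum_of_injective Subtype.val_injective V

lemma tsum_maxHaarSupport_le (hD : IsDyadicGrid D) (hw : Admissible D w) (g : Lp ℝ 2 w) :
    ∑' J : maxHaarSupport D w g, ∑' K,
      (haarSupportIn D w g J.1).indicator (fun K => ‖haarCoeff w g K‖ₑ ^ 2) K ≤ ‖g‖ₑ ^ 2 := by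
  classical
  rw [ENNReal.tsum_comm]
  refine le_trans (ENNReal.tsum_le_tsum fun K => ?_) (tsum_haarCoeff_sq_le hD hw g)
  by_cases hK : ∃ J : maxHaarSupport D w g, K ∈ haarSupportIn D w g J.1
  · obtain ⟨J, hJ⟩ := hK
    rw [tsum_eq_single J, indicator_of_mem hJ, indicator_of_mem hJ.1.1]
    intro J' hne
    refine indicator_of_notMem (fun h => ?_) _
    exact disjoint_left.1 (disjoint_haarSupportIn hD J'.2 J.2 fun h => hne (Subtype.ext h)) h hJ
  · push Not at hK
    simp [hK]

/-! ### Adapted functions -/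

lemma IsParent.unique {𝓕 : Set Interval} {J F F' : Interval} (h : IsParent 𝓕 J F)
    (h' : IsParent 𝓕 J F') : F = F' := IsLeast.unique h h'

lemma IsGrandparent.unique {𝓕 : Set Interval} {J F F' : Interval} (h : IsGrandparent 𝓕 J F)
    (h' : IsGrandparent 𝓕 J F') : F = F' := by
  obtain ⟨G, hG, hF⟩ := h
  obtain ⟨G', hG', hF'⟩ := h'
  obtain rfl := hG.unique hG'
  exact hF.unique hF'

lemma IsAncestor.unique {𝓕 : Set Interval} {s : ℕ} {J F F' : Interval} (h : IsAncestor 𝓕 s J F)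
    (h' : IsAncestor 𝓕 s J F') : F = F' := by
  rcases h with ⟨rfl, h⟩ | ⟨rfl, h⟩ <;> rcases h' with ⟨hs, h'⟩ | ⟨hs, h'⟩
  · exact h.unique h'
  · omega
  · omega
  · exact h.unique h'

/-- In a chain of three intervals whose ancestors all contain the largest one, two of the ancestors
coincide. -/
lemma IsAncestor.eq_of_chain {𝓕 : Set Interval} {s : ℕ} {J₁ J₂ J₃ F₁ F₂ F₃ : Interval}
    (h₁ : IsAncestor 𝓕 s J₁ F₁) (h₂ : IsAncestor 𝓕 s J₂ F₂) (h₃ : IsAncestor 𝓕 s J₃ F₃)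
    (h₁₂ : J₁ ≤ J₂) (h₂₃ : J₂ ≤ J₃) (h₃₁ : J₃ ≤ F₁) (h₃₂ : J₃ ≤ F₂) :
    F₁ = F₂ ∨ F₂ = F₃ ∨ F₁ = F₃ := by
  rcases h₁ with ⟨rfl, h₁⟩ | ⟨rfl, h₁⟩
  · have h₃' : IsParent 𝓕 J₃ F₃ := by
      rcases h₃ with ⟨_, h⟩ | ⟨h, _⟩
      · exact h
      · omega
    exact Or.inr (Or.inr (le_antisymm (h₁.2 ⟨h₃'.1.1, (h₁₂.trans h₂₃).trans h₃'.1.2⟩)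
      (h₃'.2 ⟨h₁.1.1, h₃₁⟩)))
  · have h₂' : IsGrandparent 𝓕 J₂ F₂ := by
      rcases h₂ with ⟨h, _⟩ | ⟨_, h⟩
      · omega
      · exact h
    have h₃' : IsGrandparent 𝓕 J₃ F₃ := by
      rcases h₃ with ⟨h, _⟩ | ⟨_, h⟩
      · omega
      · exact h
    obtain ⟨G₃, hG₃, hF₃⟩ := h₃'
    -- `F = π²J` contains `J₃ ⊇ J` only if `π¹J = π¹J₃` or `F = π¹J₃`
    have key : ∀ J F, IsGrandparent 𝓕 J F → J ≤ J₃ → J₃ ≤ F → F = F₃ ∨ F = G₃ := by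
      rintro J F ⟨G, hG, hF⟩ hJ hJF
      have hle : G ≤ G₃ := hG.2 ⟨hG₃.1.1, hJ.trans hG₃.1.2⟩
      rcases hle.eq_or_lt with rfl | hlt
      · exact Or.inl (hF.unique hF₃)
      · exact Or.inr (le_antisymm (hF.2 ⟨hG₃.1.1, hlt⟩) (hG₃.2 ⟨hF.1.1, hJF⟩))
    rcases key J₁ F₁ h₁ (h₁₂.trans h₂₃) h₃₁ with h4 | h4
    · exact Or.inr (Or.inr h4)
    · rcases key J₂ F₂ h₂' h₂₃ h₃₂ with h5 | h5
      · exact Or.inr (Or.inl h5)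
      · exact Or.inl (h4.trans h5.symm)

/-- A good interval strongly contained in `F` stays away from the boundary of `F`. -/
lemma IsGood.gap {D : Set Interval} {ε : ℝ} (hε : ε ≤ 1) {r : ℕ} {J F : Interval}
    (hJ : IsGood D ε r J) (hF : F ∈ D) (hJpos : 0 < J.length) (h : StronglyContained r J F) :
    F.fst + J.length ≤ J.fst ∧ J.snd + J.length ≤ F.snd := by
  have hlen : J.length ≤ F.length := length_mono h.1
  have hr : (2 : ℝ) ^ ((r : ℤ) - 1) * J.length ≤ F.length := by
    refine le_trans ?_ h.2
    gcongr
    rw [← zpow_natCast]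
    exact zpow_le_zpow_right₀ one_le_two (by omega)
  have hpow : J.length ≤ J.length ^ ε * F.length ^ (1 - ε) := by
    calc J.length = J.length ^ ε * J.length ^ (1 - ε) := by
          rw [← Real.rpow_add hJpos]; simp
      _ ≤ _ := by
          gcongr
  have h1 := hpow.trans (hJ F hF hr (leftChild J) (by simp) F.fst (by simp))
  have h2 := hpow.trans (hJ F hF hr (rightChild J) (by simp) F.snd (by simp))
  have h3 := h1.trans (infDist_le_abs (y := F.fst)
    (show J.fst ∈ (leftChild J : Set ℝ) from ⟨le_rfl, (leftChild J).fst_le_snd⟩))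
  have h4 := h2.trans (infDist_le_abs (y := F.snd)
    (show J.snd ∈ (rightChild J : Set ℝ) from ⟨(rightChild J).fst_le_snd, le_rfl⟩))
  have h5 : F.fst ≤ J.fst := h.1.1
  have h6 : J.snd ≤ F.snd := h.1.2
  rw [abs_of_nonpos (by linarith)] at h3
  rw [abs_of_nonneg (by linarith)] at h4
  exact ⟨by linarith, by linarith⟩

section Adapted

variable {D : Set Interval} {σ w : Measure ℝ} [IsLocallyFiniteMeasure w] {ε : ℝ} {r s : ℕ}
  {𝓕 : Set Interval} {g : 𝓕 → Lp ℝ 2 w}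

/-- The pairs `(F, J)` of a member of `𝓕` and a maximal interval of the Haar support of `g F`. -/
abbrev MaxPair (D : Set Interval) (w : Measure ℝ) (𝓕 : Set Interval) (g : 𝓕 → Lp ℝ 2 w) : Type :=
  Σ F : 𝓕, maxHaarSupport D w (g F)

/-- The energy of `w` in the part of the Haar support of `g F` that lies in `J`. -/
noncomputable def energyWeight (t : MaxPair D w 𝓕 g) : ℝ≥0∞ :=
  ∑' K, (haarSupportIn D w (g t.1) t.2.1).indicator (fun K => ‖positionCoeff w K‖ₑ ^ 2) K

lemma IsAdapted.eq_of_mem (hg : IsAdapted D ε r s w 𝓕 g) {F F' : 𝓕} {K : Interval}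
    (h : K ∈ haarSupport D w (g F)) (h' : K ∈ haarSupport D w (g F')) : F = F' :=
  Subtype.ext (((hg F).2 K h).2.1.unique ((hg F').2 K h').2.1)

lemma IsAdapted.disjoint (hg : IsAdapted D ε r s w 𝓕 g) (hD : IsDyadicGrid D)
    {t t' : MaxPair D w 𝓕 g} (hne : t ≠ t') :
    Disjoint (haarSupportIn D w (g t.1) t.2.1) (haarSupportIn D w (g t'.1) t'.2.1) := by
  refine disjoint_left.2 fun K hK hK' => hne ?_
  obtain ⟨F, J⟩ := t
  obtain ⟨F', J'⟩ := t'
  obtain rfl : F = F' := hg.eq_of_mem hK.1 hK'.1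
  by_contra h
  exact disjoint_left.1 (disjoint_haarSupportIn hD J.2 J'.2 fun h' => h (by
    rw [Subtype.ext h'])) hK hK'

lemma IsAdapted.isEnergyFamily (hg : IsAdapted D ε r s w 𝓕 g) (hε : ε ≤ 1)
    (hD : IsDyadicGrid D) (hσ : Admissible D σ) (hw : Admissible D w) (h𝓕 : 𝓕 ⊆ D)
    (hC : IsCarleson D σ 𝓕) (𝒮 : Finset (MaxPair D w 𝓕 g)) :
    IsEnergyFamily D σ w 𝓕 𝒮 (fun t => t.2.1) (fun t => t.1.1) energyWeight where
  grid := hD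
  null_left := hσ
  null_right := hw
  subset := h𝓕
  carleson := hC
  mem t _ := t.2.2.prop.1
  top_mem t _ := t.1.2
  gap t _ := by
    have h := (hg t.1).2 _ t.2.2.prop
    exact h.1.gap hε (h𝓕 t.1.2) (hD.length_pos t.2.2.prop.1) h.2.2
  sep t _ t' _ hne hF := by
    obtain ⟨F, J⟩ := t
    obtain ⟨F', J'⟩ := t'
    obtain rfl : F = F' := Subtype.ext hF
    rcases hD.trichotomy J.2.prop.1 J'.2.prop.1 with h | h | h
    · exact absurd (by rw [Subtype.ext (le_antisymm h (J.2.le_of_ge J'.2.prop h))]) hne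
    · exact absurd (by rw [Subtype.ext (le_antisymm (J'.2.le_of_ge J.2.prop h) h)]) hne
    · exact h
  inj t _ t' _ hJ := by
    obtain ⟨F, J⟩ := t
    obtain ⟨F', J'⟩ := t'
    obtain rfl : F = F' := hg.eq_of_mem J.2.prop (by
      have := J'.2.prop
      rwa [show (J' : Interval) = J from hJ.symm] at this)
    exact congrArg (Sigma.mk F) (Subtype.ext hJ)
  chain t₁ _ t₂ _ t₃ _ h₁₂ h₂₃ h₃₁ h₃₂ := by
    -- intervals with the same top are maximal in the same support
    have hmax : ∀ t t' : MaxPair D w 𝓕 g, t.2.1 < t'.2.1 → t.1.1 ≠ t'.1.1 := by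
      rintro ⟨F, J⟩ ⟨F', J'⟩ hlt hF
      obtain rfl : F = F' := Subtype.ext hF
      exact hlt.not_ge (J.2.le_of_ge J'.2.prop hlt.le)
    have hanc : ∀ t : MaxPair D w 𝓕 g, IsAncestor 𝓕 s t.2.1 t.1.1 := fun t =>
      ((hg t.1).2 _ t.2.2.prop).2.1
    rcases (hanc t₁).eq_of_chain (hanc t₂) (hanc t₃) h₁₂.le h₂₃.le h₃₁ h₃₂ with h | h | h
    · exact hmax t₁ t₂ h₁₂ h
    · exact hmax t₂ t₃ h₂₃ h
    · exact hmax t₁ t₃ (h₁₂.trans h₂₃) h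
  energy I c := by
    classical
    refine le_trans ?_ (tsum_positionCoeff_sq_le hD hw I c)
    simp only [energyWeight]
    rw [← Summable.tsum_finsetSum fun _ _ => ENNReal.summable]
    refine ENNReal.tsum_le_tsum fun K => ?_
    by_cases hK : ∃ t ∈ 𝒮.filter fun t => t.2.1 ≤ I, K ∈ haarSupportIn D w (g t.1) t.2.1
    · obtain ⟨t, ht, hKt⟩ := hK
      rw [Finset.sum_eq_single t, indicator_of_mem hKt, indicator_of_mem]
      · exact ⟨hKt.1.1, hKt.2.trans (Finset.mem_filter.1 ht).2⟩
      · intro t' _ hne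
        exact indicator_of_notMem (fun h => disjoint_left.1 (hg.disjoint hD hne) h hKt) _
      · exact fun h => absurd ht h
    · rw [Finset.sum_eq_zero]
      · exact zero_le
      · exact fun t ht => indicator_of_notMem (fun h => hK ⟨t, ht, h⟩) _

end Adapted

/-! ### The functional energy inequality -/

/-- The best constant satisfies the testing inequality. -/
lemma testing_testingConst (σ w : Measure ℝ) [IsLocallyFiniteMeasure σ] :
    Testing σ w (testingConst σ w) := by
  intro I hI α β hα hαβ
  set X := ∫⁻ x in (I : Set ℝ), ‖hilbert α β (σ.restrict (I : Set ℝ)) x‖ₑ ^ 2 ∂w with hX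
  by_cases h0 : σ (I : Set ℝ) = 0
  · have : X = 0 := by
      rw [hX, Measure.restrict_eq_zero.2 h0]
      simp [hilbert]
    rw [this]; exact zero_le
  · have hfin := (measure_coe_lt_top σ I).ne
    have h1 : (X / σ (I : Set ℝ)) ^ (1 / 2 : ℝ) ≤ testingConst σ w := by
      refine le_sInf fun T hT => ?_
      have h2 : X / σ (I : Set ℝ) ≤ T ^ 2 := ENNReal.div_le_of_le_mul (hT.1 I hI α β hα hαβ)
      calc (X / σ (I : Set ℝ)) ^ (1 / 2 : ℝ) ≤ (T ^ 2) ^ (1 / 2 : ℝ) := by gcongr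
        _ = T := by rw [← ENNReal.rpow_natCast, ← ENNReal.rpow_mul]; norm_num
    calc X = X / σ (I : Set ℝ) * σ (I : Set ℝ) := (ENNReal.div_mul_cancel h0 hfin).symm
      _ = ((X / σ (I : Set ℝ)) ^ (1 / 2 : ℝ)) ^ 2 * σ (I : Set ℝ) := by
          rw [← ENNReal.rpow_natCast, ← ENNReal.rpow_mul]; norm_num
      _ ≤ _ := by gcongr

lemma A2Const_add_le (σ w : Measure ℝ) :
    A2Const σ w + testingConst σ w ^ 2 ≤ HConst σ w ^ 2 := by
  have h : A2Const σ w = (A2Const σ w ^ (1 / 2 : ℝ)) ^ 2 := by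
    rw [← ENNReal.rpow_natCast, ← ENNReal.rpow_mul]; norm_num
  calc A2Const σ w + testingConst σ w ^ 2
      = (A2Const σ w ^ (1 / 2 : ℝ)) ^ 2 + testingConst σ w ^ 2 := by rw [← h]
    _ ≤ (A2Const σ w ^ (1 / 2 : ℝ)) ^ 2 + testingConst σ w ^ 2 +
          2 * A2Const σ w ^ (1 / 2 : ℝ) * testingConst σ w := le_self_add
    _ = HConst σ w ^ 2 := by rw [HConst]; ring

lemma poisson_mul_enorm_setIntegral (ν w : Measure ℝ) {J : Interval} (hJ : 0 < J.length)
    (f : ℝ → ℝ) : poisson ν J * ‖∫ x in (J : Set ℝ), x / J.length * f x ∂w‖ₑ =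
      (∫⁻ y, kern J y ∂ν) * ‖∫ x in (J : Set ℝ), x * f x ∂w‖ₑ := by
  have e : ∀ x, x / J.length * f x = J.length⁻¹ * (x * f x) := fun x => by
    rw [div_eq_inv_mul]; ring
  simp only [e]
  have hl : ENNReal.ofReal J.length * ENNReal.ofReal J.length⁻¹ = 1 := by
    rw [← ENNReal.ofReal_mul hJ.le, mul_inv_cancel₀ hJ.ne', ENNReal.ofReal_one]
  rw [poisson_eq, integral_const_mul, enorm_mul, Real.enorm_of_nonneg (by positivity),
    mul_mul_mul_comm, hl, one_mul]

/-- The functional energy inequality with an absolute constant. -/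
theorem tsum_poisson_mul_le {σ w : Measure ℝ} [IsLocallyFiniteMeasure σ]
    [IsLocallyFiniteMeasure w] {ε : ℝ} (hε : ε ≤ 1) {r s : ℕ} {D : Set Interval}
    (hD : IsDyadicGrid D) (hσ : Admissible D σ) (hw : Admissible D w) {h : ℝ → ℝ} (hh : MemLp h 2 σ)
    {𝓕 : Set Interval} (h𝓕 : 𝓕 ⊆ D) (hC : IsCarleson D σ 𝓕) {g : 𝓕 → Lp ℝ 2 w}
    (hg : IsAdapted D ε r s w 𝓕 g) :
    ∑' F : 𝓕, ∑' J : maxHaarSupport D w (g F),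
        poisson (σ.withDensity fun x => ENNReal.ofReal (h x)) J.1 *
          ‖∫ x in (J.1 : Set ℝ), x / J.1.length * g F x ∂w‖ₑ ≤
      (600000 : ℝ≥0) * HConst σ w * eLpNorm h 2 σ * (∑' F : 𝓕, ‖g F‖ₑ ^ 2) ^ (1 / 2 : ℝ) := by
  set H : ℝ → ℝ≥0∞ := fun x => ENNReal.ofReal (h x) with hH
  have hHm : AEMeasurable H σ := hh.1.aemeasurable.ennreal_ofReal
  have hH2 : ∫⁻ y, H y ^ 2 ∂σ ≤ eLpNorm h 2 σ ^ 2 := by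
    rw [eLpNorm_two_sq]
    gcongr with y
    exact Real.ofReal_le_enorm _
  have hH2top : ∫⁻ y, H y ^ 2 ∂σ ≠ ∞ := ne_top_of_le_ne_top (ENNReal.pow_ne_top hh.2.ne) hH2
  rw [← ENNReal.tsum_sigma' fun t : MaxPair D w 𝓕 g => poisson (σ.withDensity H) t.2.1 *
    ‖∫ x in (t.2.1 : Set ℝ), x / t.2.1.length * g t.1 x ∂w‖ₑ, ENNReal.tsum_eq_iSup_sum]
  refine iSup_le fun 𝒮 => ?_
  have hE := hg.isEnergyFamily hε hD hσ hw h𝓕 hC 𝒮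
  have hmain := hE.sum_lintegral_kern_sq_le (testing_testingConst σ w)
    (𝒥 := fun t => haarSupportIn D w (g t.1) t.2.1) (fun t _ K hK => ⟨hK.1.1, hK.2⟩)
    (fun t _ t' _ hne => hg.disjoint hD hne) (a := fun K => ‖positionCoeff w K‖ₑ ^ 2)
    (fun K hK => positionCoeff_sq_le hD hw hK) (fun t _ => rfl) hHm hH2top
  set γ : MaxPair D w 𝓕 g → ℝ≥0∞ := fun t => ∑' K,
    (haarSupportIn D w (g t.1) t.2.1).indicator (fun K => ‖haarCoeff w (g t.1) K‖ₑ ^ 2) K with hγ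
  have hγ' : ∑ t ∈ 𝒮, γ t ≤ ∑' F : 𝓕, ‖g F‖ₑ ^ 2 := by
    refine (ENNReal.sum_le_tsum 𝒮).trans ?_
    rw [ENNReal.tsum_sigma']
    exact ENNReal.tsum_le_tsum fun F => tsum_maxHaarSupport_le hD hw (g F)
  refine (ENNReal.pow_le_pow_left_iff two_ne_zero).1 ?_
  refine (sum_sq_le_of_sq_le_mul 𝒮 _ (fun t => energyWeight t *
    (∫⁻ y, H y * kern t.2.1 y ∂σ) ^ 2) γ fun t _ => ?_).trans ?_
  · have hJ := hD.length_pos t.2.2.prop.1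
    rw [poisson_mul_enorm_setIntegral _ w hJ, lintegral_withDensity_eq_lintegral_mul₀ hHm
      (measurable_kern _).aemeasurable, mul_pow]
    simp only [Pi.mul_apply]
    calc _ ≤ (∫⁻ y, H y * kern t.2.1 y ∂σ) ^ 2 * (energyWeight t * γ t) := by
          gcongr
          exact enorm_setIntegral_sq_le hD hw (hg t.1).1 t.2.2
      _ = _ := by ring
  · calc _ ≤ 49766400 * (5424 * (A2Const σ w + testingConst σ w ^ 2)) * (∫⁻ y, H y ^ 2 ∂σ) *
          ∑' F : 𝓕, ‖g F‖ₑ ^ 2 := mul_le_mul' hmain hγ'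
      _ ≤ 49766400 * (5424 * HConst σ w ^ 2) * eLpNorm h 2 σ ^ 2 * ∑' F : 𝓕, ‖g F‖ₑ ^ 2 := by
          gcongr
          exact A2Const_add_le σ w
      _ = 269932953600 * (HConst σ w ^ 2 * eLpNorm h 2 σ ^ 2 * ∑' F : 𝓕, ‖g F‖ₑ ^ 2) := by ring
      _ ≤ 600000 ^ 2 * (HConst σ w ^ 2 * eLpNorm h 2 σ ^ 2 * ∑' F : 𝓕, ‖g F‖ₑ ^ 2) := by
          gcongr
          norm_num
      _ = _ := by
          have e : ∑' F : 𝓕, ‖g F‖ₑ ^ 2 = ((∑' F : 𝓕, ‖g F‖ₑ ^ 2) ^ (1 / 2 : ℝ)) ^ 2 := by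
            rw [← ENNReal.rpow_natCast, ← ENNReal.rpow_mul]; norm_num
          conv_lhs => rw [e]
          push_cast
          ring

end FunctionalEnergy

theorem theorem5 (ε : ℝ) (hε : 0 < ε) (hε' : ε ≤ 1 / 4) (r : ℕ) :
    ∃ C : ℝ≥0,
      ∀ (σ w : Measure ℝ) [IsLocallyFiniteMeasure σ] [IsLocallyFiniteMeasure w],
      (∀ x : ℝ, σ {x} * w {x} = 0) →
      ∀ D : Set FunctionalEnergy.Interval, FunctionalEnergy.IsDyadicGrid D →
      FunctionalEnergy.Admissible D σ → FunctionalEnergy.Admissible D w →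
      ∀ h : ℝ → ℝ, MemLp h 2 σ → (∀ᵐ x ∂σ, 0 ≤ h x) →
      ∀ 𝓕 : Set FunctionalEnergy.Interval, 𝓕 ⊆ D → FunctionalEnergy.IsCarleson D σ 𝓕 →
      ∀ s ∈ ({1, 2} : Set ℕ),
      ∀ g : 𝓕 → Lp ℝ 2 w, FunctionalEnergy.IsAdapted D ε r s w 𝓕 g →
        ∑' F : 𝓕, ∑' J : FunctionalEnergy.maxHaarSupport D w (g F),
            FunctionalEnergy.poisson (σ.withDensity fun x => ENNReal.ofReal (h x)) J.1 *
              ‖∫ x in (J.1 : Set ℝ), x / J.1.length * g F x ∂w‖ₑ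
          ≤ C * FunctionalEnergy.HConst σ w * eLpNorm h 2 σ *
              (∑' F : 𝓕, ‖g F‖ₑ ^ 2) ^ (1 / 2 : ℝ) := by
  refine ⟨600000, fun σ w _ _ _ D hD hσ hw h hh _ 𝓕 h𝓕 hC s _ g hg => ?_⟩
  exact FunctionalEnergy.tsum_poisson_mul_le (by linarith) hD hσ hw hh h𝓕 hC hg
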